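/- **Conventions.** Let $K$ be a finite-dimensional ribbon Hopf algebra over a field $\mathbb F$ of characteristic zero, with coproduct $\Delta(h)=h_{(1)}\otimes h_{(2)}$, counit $\epsilon$, antipode $S$ and dual $K^*$. An $R$-matrix is an invertible $R\in K\otimes K$ with $R\,\Delta(h)=\Delta^{op}(h)\,R$, $(\Delta\otimes \mathrm{id})(R)=R_{13}R_{23}$, $(\mathrm{id}\otimes\Delta)(R)=R_{13}R_{12}$; $K$ is ribbon if it has an $R$-matrix with a ribbon element. For an index set $X$, $(\alpha)_x$ and $(\alpha\otimes\beta)_{xy}$ denote the elements of $K^{*\otimes X}$ with the indicated entries and the unit $1=\epsilon$ elsewhere; likewise $(h)_x\in K^{\otimes X}$. A ciliated ribbon graph $\Gamma$ is a finite directed graph (loops and multiple edges allowed, all vertices of valence $\ge 1$), with vertex set $V$ and edge set $E$, starting and target vertices $\mathbf s(e),\mathbf t(e)$, and a linear ordering of the incident edge ends at each vertex. The starting and target ends of $e$ are denoted $s(e)$ and $t(e)$. The vertex neighbourhood $\Gamma_v$ consists of $v$, the edge ends at $v$ as edges and a univalent vertex at the other end of each of them; gauge transformations on $\Gamma_v$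 are associated only with $v$. **Gauge theories.** A $K$-valued Hopf algebra gauge theory on $\Gamma$ consists of an associative algebra structure on $K^{*\otimes E}$ with unit $1^{\otimes E}$ and a left module structure $\rhd$ of the tensor product Hopf algebra $K^{\otimes V}$ on $K^{\otimes E}$ such that * $(\alpha)_e(\beta)_e\in\{(\gamma)_e:\gamma\in K^*\}$; $(\alpha)_e(\beta)_f\in \mathrm{span}\{(\gamma\otimes\delta)_{ef}\}$ for $e\ne f$; and $(\alpha)_e(\beta)_f=(\beta)_f(\alpha)_e=(\alpha\otimes\beta)_{ef}$ if $e,f$ have no common vertex; * the dual right module structure $\lhd^*$ makes $K^{*\otimes E}$ a right $K^{\otimes V}$-module algebra, i.e. $(ab)\lhd^* h=(a\lhd^* h_{(1)})(b\lhd^* h_{(2)})$ and $1\lhd^* h=\epsilon(h)1$; * for each edge $e$ with $\mathbf s(e)\ne\mathbf t(e)$ and $h\in K$: $(h)_v$ acts by $k\mapsto\epsilon(h)k$ for $v\notin\{\mathbf s(e),\mathbf t(e)\}$, by $k\mapsto hk$ for $v=\mathbf t(e)$ and by $k\mapsto kS(h)$ for $v=\mathbf s(e)$ on the component of a connection at $e$.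 Here the component of a connection at $e$ is its image under $\bigotimes_f k_f\mapsto \big(\prod_{f\neq e}\epsilon(k_f)\big)k_e$; dually, these are formulas for $(\alpha)_e\lhd^*(h)_v$. Gauge theories on $\Gamma_v$ are defined in the same way, with gauge transformations $K$ at $v$. Let $$G^*:K^{*\otimes E}\to\bigotimes_{v\in V}K^{*\otimes v},\qquad (\alpha)_e\mapsto(\alpha_{(2)}\otimes\alpha_{(1)})_{s(e)t(e)},$$ the tensor product over $e \in E$ of the maps $\alpha\mapsto\alpha_{(2)}\otimes\alpha_{(1)}$, where $K^{*\otimes v}$ has one factor for each edge end at $v$. A gauge theory on $\Gamma$ is local if there are gauge theories on all $\Gamma_v$ such that $G^*$ is a homomorphism of $K^{\otimes V}$-module algebras. **Data.** Assign to each $v\in V$ an $R$-matrix $R_v$ of $K$, and let $\rho$ choose for each edge $e$ one of its ends, $\rho(e)\in\{s(e),t(e)\}$. Put $\sigma(x)=0$ for edge ends $x$ in the image of $\rho$ and $\sigma(x)=1$ otherwise, and $\tau(x)=0$ for target (incoming) and $\tau(x)=1$ for starting (outgoing) ends. For edge ends $i,j$ at $v$ and $R=R_v$, let $\mathcal A^*_v$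 be $K^{*\otimes v}$ with $$(\alpha)_i(\beta)_i=\begin{cases}\langle\beta_{(1)}\otimes\alpha_{(1)},R\rangle(\beta_{(2)}\alpha_{(2)})_i&\sigma(i)=\tau(i)=0\\ \langle\beta_{(2)}\otimes\alpha_{(2)},R\rangle(\alpha_{(1)}\beta_{(1)})_i&\sigma(i)=0,\ \tau(i)=1\\ (\alpha\beta)_i&\sigma(i)=1,\ \tau(i)=0\\ (\beta\alpha)_i&\sigma(i)=\tau(i)=1,\end{cases}$$ $$(\alpha)_i(\beta)_j=\begin{cases}(\alpha\otimes\beta)_{ij}&i<j\\ \langle\beta_{(1+\tau(j))}\otimes\alpha_{(1+\tau(i))},(S^{\tau(j)}\otimes S^{\tau(i)})(R)\rangle(\alpha_{(2-\tau(i))}\otimes\beta_{(2-\tau(j))})_{ij}&i>j,\end{cases}$$ where $\alpha^1\otimes\dots\otimes\alpha^n$ is the ordered product $(\alpha^1)_1\cdots(\alpha^n)_n$, and with the $K$-action $$(\alpha^1\otimes\dots\otimes\alpha^n)\lhd^*h=\langle S^{\tau(1)}(\alpha^1_{(1+\tau(1))})\cdots S^{\tau(n)}(\alpha^n_{(1+\tau(n))}),h\rangle\;\alpha^1_{(2-\tau(1))}\otimes\dots\otimes\alpha^n_{(2-\tau(n))}.$$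 **Theorem.** 1. Each $\mathcal A^*_v$ is well defined and is a Hopf algebra gauge theory on $\Gamma_v$. 2. $G^*$ is injective, and $G^*(K^{*\otimes E})$ is a (unital) subalgebra and a $K^{\otimes V}$-submodule of $\bigotimes_v\mathcal A^*_v$. 3. There is exactly one Hopf algebra gauge theory on $\Gamma$ for which $G^*$ is a homomorphism of $K^{\otimes V}$-module algebras into $\bigotimes_v\mathcal A^*_v$ (the pullback of these structures along $G^*$), and it is local. 4. In it, gauge transformations act on the component $k$ of a connection at $e$ as follows: $(h)_v$ acts by $k\mapsto\epsilon(h)k$ for $v\notin\{\mathbf s(e),\mathbf t(e)\}$; if $\mathbf s(e)\ne\mathbf t(e)$, then $(h\otimes h')_{\mathbf s(e)\mathbf t(e)}$ acts by $k\mapsto h'kS(h)$; if $e$ is a loop, then $(h)_{\mathbf s(e)}$ acts by $k\mapsto h_{(1)}kS(h_{(2)})$ for $t(e)<s(e)$ and by $k\mapsto h_{(2)}kS(h_{(1)})$ for $s(e)<t(e)$. 5. If all $R_v$ are equal, the gauge theory from 3 does not depend on $\rho$. 6. If $\ell\in K$ is a Haar integral ($h\ell=\ell h=\epsilon(h)\ell$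 for all $h$, $\epsilon(\ell)=1$), then the linear map $$\Pi:\bigotimes_v\mathcal A^*_v\to\bigotimes_v\mathcal A^*_v,\qquad(\alpha\otimes\beta)_{s(e)t(e)}\mapsto\langle\alpha_{(1)}S(\beta_{(2)}),\ell\rangle\,(\alpha_{(2)}\otimes\beta_{(1)})_{s(e)t(e)}$$ (the tensor product of these maps over all edges $e$) is a projector onto $G^*(K^{*\otimes E})$. -/

import Mathlib

open scoped TensorProduct

noncomputable section

namespace HopfGauge

/-! ### Quasitriangular and ribbon Hopf algebras, Haar integrals -/

section HopfAlgebras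

variable (k : Type*) {K : Type*} [Field k] [Ring K] [HopfAlgebra k K]

/-- The flip `a ⊗ b ↦ b ⊗ a`; in particular `flip R = R₂₁` and `flip (Δ h) = Δᵒᵖ h`. -/
def flip : K ⊗[k] K →ₗ[k] K ⊗[k] K := (TensorProduct.comm k K K).toLinearMap

/-- `R₁₂ = R₁ ⊗ R₂ ⊗ 1`. -/
def emb12 (R : K ⊗[k] K) : K ⊗[k] (K ⊗[k] K) :=
  TensorProduct.assoc k K K K (R ⊗ₜ[k] (1 : K))

/-- `R₁₃ = R₁ ⊗ 1 ⊗ R₂`. -/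
def emb13 (R : K ⊗[k] K) : K ⊗[k] (K ⊗[k] K) :=
  LinearMap.lTensor K (TensorProduct.mk k K K 1) R

/-- `R₂₃ = 1 ⊗ R₁ ⊗ R₂`. -/
def emb23 (R : K ⊗[k] K) : K ⊗[k] (K ⊗[k] K) := (1 : K) ⊗ₜ[k] R

/-- `R` is an `R`-matrix for the Hopf algebra `K`. -/
structure IsRMatrix (R : K ⊗[k] K) : Prop where
  isUnit : IsUnit R
  mul_comul : ∀ h : K, R * Coalgebra.comul (R := k) h = flip k (Coalgebra.comul (R := k) h) * R
  comul_left : TensorProduct.assoc k K K K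
      (LinearMap.rTensor K (Coalgebra.comul (R := k) (A := K)) R) = emb13 k R * emb23 k R
  comul_right : LinearMap.lTensor K (Coalgebra.comul (R := k) (A := K)) R
      = emb13 k R * emb12 k R

/-- The Drinfel'd element `u = S(R₂) R₁ = m ∘ (S ⊗ id) (R₂₁)`. -/
def drinfeldElement (R : K ⊗[k] K) : K :=
  LinearMap.mul' k K (LinearMap.rTensor K (HopfAlgebra.antipode k (A := K)) (flip k R))

/-- `ν` is a ribbon element for the quasitriangular Hopf algebra `(K, R)`; the last condition is
`Δ(ν) = R⁻¹ R₂₁⁻¹ (ν ⊗ ν)`, multiplied by the invertible element `R₂₁ R`. -/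
structure IsRibbonElement (R : K ⊗[k] K) (ν : K) : Prop where
  isUnit : IsUnit ν
  central : ∀ h : K, ν * h = h * ν
  sq : drinfeldElement k R * HopfAlgebra.antipode k (drinfeldElement k R) = ν * ν
  counit : Coalgebra.counit (R := k) ν = 1
  antipode : HopfAlgebra.antipode k ν = ν
  comul : (flip k R * R) * Coalgebra.comul (R := k) ν = ν ⊗ₜ[k] ν

variable (K) in
/-- `K` is a ribbon Hopf algebra: it has an `R`-matrix with a ribbon element. -/
def IsRibbon : Prop := ∃ (R : K ⊗[k] K) (ν : K), IsRMatrix k R ∧ IsRibbonElement k R ν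

/-- `ℓ` is a (normalised, two-sided) Haar integral in `K`. -/
structure IsHaarIntegral (ℓ : K) : Prop where
  mul_left : ∀ h : K, h * ℓ = Coalgebra.counit (R := k) h • ℓ
  mul_right : ∀ h : K, ℓ * h = Coalgebra.counit (R := k) h • ℓ
  counit : Coalgebra.counit (R := k) ℓ = 1

end HopfAlgebras

/-! ### The dual Hopf algebra `K*` and the regular actions of `K` on it -/

section DualAlgebra

variable (k K : Type*) [Field k] [Ring K] [HopfAlgebra k K]

/-- The dual vector space `K*`. -/
abbrev D : Type _ := Module.Dual k K

/-- The product of `K*`: `⟨α β, h⟩ = ⟨α, h₁⟩ ⟨β, h₂⟩`. Its unit is the counit of `K`. -/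
def dualMul : D k K →ₗ[k] D k K →ₗ[k] D k K :=
  LinearMap.mk₂ k
    (fun α β => LinearMap.mul' k k ∘ₗ TensorProduct.map α β ∘ₗ Coalgebra.comul (R := k) (A := K))
    (fun a b c => by simp [TensorProduct.map_add_left, LinearMap.add_comp, LinearMap.comp_add])
    (fun a b c => by simp [TensorProduct.map_smul_left, LinearMap.smul_comp, LinearMap.comp_smul])
    (fun a b c => by simp [TensorProduct.map_add_right, LinearMap.add_comp, LinearMap.comp_add])
    (fun a b c => by simp [TensorProduct.map_smul_right, LinearMap.smul_comp, LinearMap.comp_smul])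

/-- The coproduct of `K*`: `⟨α₁, h⟩ ⟨α₂, h'⟩ = ⟨α, h h'⟩`. -/
def dualComul [Module.Finite k K] : D k K →ₗ[k] D k K ⊗[k] D k K :=
  (TensorProduct.dualDistribEquiv k K K).symm.toLinearMap ∘ₗ (LinearMap.mul' k K).dualMap

/-- The right regular action of `K` on `K*`: `α ◁ h = ⟨α₁, h⟩ α₂`, that is `x ↦ ⟨α, h x⟩`. -/
def regRight : K →ₗ[k] Module.End k (D k K) :=
  LinearMap.mk₂ k (fun h α => α ∘ₗ LinearMap.mulLeft k h)
    (fun a b c => by ext; simp [add_mul]) (fun a b c => by ext; simp)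
    (fun a b c => by ext; simp) (fun a b c => by ext; simp)

/-- The left regular action of `K` on `K*`: `h ▷ α = ⟨α₂, h⟩ α₁`, that is `x ↦ ⟨α, x h⟩`. -/
def regLeft : K →ₗ[k] Module.End k (D k K) :=
  LinearMap.mk₂ k (fun h α => α ∘ₗ LinearMap.mulRight k h)
    (fun a b c => by ext; simp [mul_add]) (fun a b c => by ext; simp)
    (fun a b c => by ext; simp) (fun a b c => by ext; simp)

/-- The right action of `K` on the copy of `K*` at an edge end, as a linear map in `h`:
`α ↦ ⟨S^τ(α_{1+τ}), h⟩ α_{2-τ}`, where `τ = 0` (`false`) for an incoming end and `τ = 1` (`true`)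
for an outgoing one. -/
def endAct : Bool → (K →ₗ[k] Module.End k (D k K))
  | false => regRight k K
  | true => regLeft k K ∘ₗ HopfAlgebra.antipode k (A := K)

variable {k K} in
/-- The product of two elements in the copy of `K*` at an edge end, for `σ, τ ∈ {0, 1}`:
* `σ = τ = 0`: `⟨β₁ ⊗ α₁, R⟩ β₂ α₂`;
* `σ = 0`, `τ = 1`: `⟨β₂ ⊗ α₂, R⟩ α₁ β₁`;
* `σ = 1`, `τ = 0`: `α β`;
* `σ = τ = 1`: `β α`. -/
def endMul (R : K ⊗[k] K) : (σ τ : Bool) → (D k K →ₗ[k] D k K →ₗ[k] D k K)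
  | false, false => TensorProduct.lift (LinearMap.mk₂ k
      (fun h₁ h₂ => (dualMul k K).flip.compl₁₂ (regRight k K h₂) (regRight k K h₁))
      (fun a b c => by ext; simp) (fun a b c => by ext; simp)
      (fun a b c => by ext; simp) (fun a b c => by ext; simp)) R
  | false, true => TensorProduct.lift (LinearMap.mk₂ k
      (fun h₁ h₂ => (dualMul k K).compl₁₂ (regLeft k K h₂) (regLeft k K h₁))
      (fun a b c => by ext; simp) (fun a b c => by ext; simp)
      (fun a b c => by ext; simp) (fun a b c => by ext; simp)) R
  | true, false => dualMul k K
  | true, true => (dualMul k K).flip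

end DualAlgebra

/-! ### Tensor powers -/

section TensorPowers

variable (k : Type*) [Field k]

/-- The canonical map `(⨂ᵤ M) ⊗ (⨂ᵤ N) → ⨂ᵤ (M ⊗ N)`. -/
def interchangeMap (U M N : Type*) [AddCommGroup M] [Module k M] [AddCommGroup N] [Module k N] :
    (⨂[k] _ : U, M) ⊗[k] (⨂[k] _ : U, N) →ₗ[k] ⨂[k] _ : U, (M ⊗[k] N) :=
  TensorProduct.lift (PiTensorProduct.map₂ (fun _ => TensorProduct.mk k M N))

theorem interchangeMap_bijective (U M N : Type*) [Finite U] [AddCommGroup M] [Module k M]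
    [AddCommGroup N] [Module k N] : Function.Bijective (interchangeMap k U M N) := by
  let b := Module.Free.chooseBasis k M
  let c := Module.Free.chooseBasis k N
  let B₁ := (Basis.piTensorProduct (fun _ : U => b)).tensorProduct
    (Basis.piTensorProduct (fun _ : U => c))
  let B₂ := Basis.piTensorProduct (fun _ : U => b.tensorProduct c)
  let e := B₁.equiv B₂ (Equiv.arrowProdEquivProdArrow U _ _).symm
  have : interchangeMap k U M N = e.toLinearMap := by
    refine B₁.ext fun i => ?_
    obtain ⟨i₁, i₂⟩ := i
    rw [LinearEquiv.coe_coe, Module.Basis.equiv_apply]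
    simp [B₁, B₂, interchangeMap, Module.Basis.tensorProduct_apply,
      PiTensorProduct.map₂_tprod_tprod, Equiv.arrowProdEquivProdArrow]
  rw [this]
  exact e.bijective

/-- The canonical isomorphism `(⨂ᵤ M) ⊗ (⨂ᵤ N) ≃ ⨂ᵤ (M ⊗ N)`. -/
def interchange (U M N : Type*) [Finite U] [AddCommGroup M] [Module k M]
    [AddCommGroup N] [Module k N] :
    (⨂[k] _ : U, M) ⊗[k] (⨂[k] _ : U, N) ≃ₗ[k] ⨂[k] _ : U, (M ⊗[k] N) :=
  LinearEquiv.ofBijective _ (interchangeMap_bijective k U M N)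

theorem group_update {X V : Type*} [DecidableEq X] [DecidableEq V] (f : X → V) (M : Type*) [AddCommGroup M] [Module k M]
    (m : X → M) (x : X) (c : M) :
    (fun v => PiTensorProduct.tprod k
        (fun y : {x : X // f x = v} => Function.update m x c y.1)) =
      Function.update (fun v => PiTensorProduct.tprod k
        (fun y : {x : X // f x = v} => m y.1)) (f x)
        (PiTensorProduct.tprod k (Function.update
          (fun y : {z : X // f z = f x} => m y.1) ⟨x, rfl⟩ c)) := by
  ext v
  by_cases hv : v = f x
  · subst hv
    rw [Function.update_self]
    congr 1
    ext y
    simp [Function.update_apply, Subtype.ext_iff]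
  · rw [Function.update_of_ne hv]
    congr 1
    ext y
    have : y.1 ≠ x := fun h => hv (by rw [← y.2, h])
    simp [Function.update_of_ne this]

/-- The multilinear map `(mₓ)ₓ ↦ ⨂ᵥ ⨂_{f x = v} mₓ`. -/
def groupTensor {X V : Type*} (f : X → V) (M : Type*) [AddCommGroup M] [Module k M] :
    MultilinearMap k (fun _ : X => M) (⨂[k] v : V, ⨂[k] _ : {x : X // f x = v}, M) where
  toFun m := PiTensorProduct.tprod k fun v => PiTensorProduct.tprod k fun x => m x.1
  map_update_add' m x a b := by
    classical
    simp only [group_update, MultilinearMap.map_update_add]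
  map_update_smul' m x r a := by
    classical
    simp only [group_update, MultilinearMap.map_update_smul]

theorem lift_groupTensor_bijective {X V : Type*} [Finite X] [Finite V] (f : X → V) (M : Type*)
    [AddCommGroup M] [Module k M] :
    Function.Bijective (PiTensorProduct.lift (groupTensor k f M)) := by
  let b := Module.Free.chooseBasis k M
  let B₁ := Basis.piTensorProduct (fun _ : X => b)
  let B₂ := Basis.piTensorProduct (fun v : V =>
    Basis.piTensorProduct (fun _ : {x : X // f x = v} => b))
  let e := B₁.equiv B₂
    { toFun := fun i v x => i x.1
      invFun := fun j x => j (f x) ⟨x, rfl⟩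
      left_inv := fun i => rfl
      right_inv := fun j => by
        ext v ⟨x, hx⟩
        subst hx
        rfl }
  have : PiTensorProduct.lift (groupTensor k f M) = e.toLinearMap := by
    refine B₁.ext fun i => ?_
    rw [LinearEquiv.coe_coe, Module.Basis.equiv_apply]
    simp [B₁, B₂, groupTensor]
  rw [this]
  exact e.bijective

/-- The canonical isomorphism `⨂ₓ M ≃ ⨂ᵥ ⨂_{f x = v} M`. -/
def group {X V : Type*} [Finite X] [Finite V] (f : X → V) (M : Type*)
    [AddCommGroup M] [Module k M] :
    (⨂[k] _ : X, M) ≃ₗ[k] ⨂[k] v : V, ⨂[k] _ : {x : X // f x = v}, M :=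
  LinearEquiv.ofBijective _ (lift_groupTensor_bijective k f M)

open scoped Classical in
/-- The operator on `⨂ M` which acts by `f` on the `i`th factor and trivially on all others,
as a linear map in `f`. -/
def atFactor {ι : Type*} {M : Type*} [AddCommGroup M] [Module k M] (i : ι) :
    Module.End k M →ₗ[k] Module.End k (⨂[k] _ : ι, M) :=
  (PiTensorProduct.mapMultilinear k (fun _ : ι => M) (fun _ : ι => M)).toLinearMap
    (fun _ => LinearMap.id) i

variable {K : Type*} [Ring K] [HopfAlgebra k K]

open scoped Classical in
/-- The algebra homomorphism `K → K^{⊗ι}`, `h ↦ (h)ᵢ`, with entry `h` at `i` and `1` elsewhere. -/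
def incl {ι : Type*} (i : ι) : K →ₐ[k] ⨂[k] _ : ι, K :=
  PiTensorProduct.singleAlgHom (R := k) (A := fun _ : ι => K) i

variable (K) in
/-- The comultiplication of the tensor product Hopf algebra `K^{⊗ι}`. -/
def tensorComul (ι : Type*) [Finite ι] :
    (⨂[k] _ : ι, K) →ₗ[k] (⨂[k] _ : ι, K) ⊗[k] (⨂[k] _ : ι, K) :=
  (interchange k ι K K).symm.toLinearMap ∘ₗ
    PiTensorProduct.map (fun _ => Coalgebra.comul (R := k) (A := K))

variable (K) in
/-- The counit of the tensor product Hopf algebra `K^{⊗ι}`. -/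
def tensorCounit (ι : Type*) [Finite ι] : (⨂[k] _ : ι, K) →ₗ[k] k :=
  PiTensorProduct.dualDistrib
    (PiTensorProduct.tprod k fun _ : ι => Coalgebra.counit (R := k) (A := K))

variable (K) in
/-- The element `1^{⊗ι}` of `K*^{⊗ι}`; the unit of `K*` is the counit of `K`. -/
def fnOne (ι : Type*) : ⨂[k] _ : ι, D k K :=
  PiTensorProduct.tprod k fun _ => Coalgebra.counit (R := k) (A := K)

variable {k}

open scoped Classical in
/-- The element `(α)ᵢ` of `K*^{⊗ι}`. -/
def single {ι : Type*} (i : ι) (α : D k K) : ⨂[k] _ : ι, D k K :=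
  PiTensorProduct.tprod k
    (Function.update (fun _ => (Coalgebra.counit : K →ₗ[k] k)) i α)

open scoped Classical in
/-- The element `(α ⊗ β)ᵢⱼ` of `K*^{⊗ι}`, for `i ≠ j`. -/
def pairAt {ι : Type*} (i j : ι) (α β : D k K) : ⨂[k] _ : ι, D k K :=
  PiTensorProduct.tprod k (Function.update
    (Function.update (fun _ => (Coalgebra.counit : K →ₗ[k] k)) i α) j β)

/-- The transpose of an operator on `K^{⊗ι}`, as an operator on `K*^{⊗ι}`. -/
def transpose (ι : Type*) [Finite ι] [Module.Finite k K] :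
    Module.End k (⨂[k] _ : ι, K) →ₗ[k] Module.End k (⨂[k] _ : ι, D k K) :=
  (PiTensorProduct.dualDistribEquiv (R := k)
    (M := fun _ : ι => K)).symm.conj.toLinearMap ∘ₗ Module.Dual.transpose

end TensorPowers

/-! ### Directed graphs and ciliated ribbon graphs -/

section Graphs

/-- A directed graph with vertex set `V` and edge set `E`; loops and multiple edges are allowed. -/
structure DirectedGraph (V E : Type*) where
  src : E → V
  tgt : E → V

/-- The edge ends of a graph with edge set `E` are the elements of `E ⊕ E`: the starting end
`s(e)` of `e` is `inl e` and its target end `t(e)` is `inr e`. This is the vertex at which an edge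
end is incident. -/
def DirectedGraph.endVertex {V E : Type*} (Γ : DirectedGraph V E) : E ⊕ E → V :=
  Sum.elim Γ.src Γ.tgt

/-- The set of edge ends incident at the vertex `v`. -/
abbrev DirectedGraph.EndsAt {V E : Type*} (Γ : DirectedGraph V E) (v : V) : Type _ :=
  {x : E ⊕ E // Γ.endVertex x = v}

/-- A ciliated ribbon graph: a directed graph without isolated vertices, with a linear ordering of
the incident edge ends at each vertex. -/
structure CiliatedRibbonGraph (V E : Type*) extends DirectedGraph V E where
  valence_pos : ∀ v, Nonempty (toDirectedGraph.EndsAt v)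
  endOrder : ∀ v, LinearOrder (toDirectedGraph.EndsAt v)

/-- The edge ends `x` and `y` are incident at the same vertex and `x < y` there. -/
def CiliatedRibbonGraph.Before {V E : Type*} (Γ : CiliatedRibbonGraph V E) (x y : E ⊕ E) : Prop :=
  ∃ (v : V) (hx : Γ.endVertex x = v) (hy : Γ.endVertex y = v),
    (Γ.endOrder v).lt ⟨x, hx⟩ ⟨y, hy⟩

/-- The vertex neighbourhood `Γ_v`. Its edges are the edge ends at `v`; its vertices are `v`
itself (`none`) and one further univalent vertex (`some x`) for each edge end `x` at `v`. -/
def DirectedGraph.nbhd {V E : Type*} (Γ : DirectedGraph V E) (v : V) :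
    DirectedGraph (Option (Γ.EndsAt v)) (Γ.EndsAt v) where
  src x := if x.1.isLeft then none else some x
  tgt x := if x.1.isLeft then some x else none

end Graphs

/-! ### Hopf algebra gauge theories -/

section GaugeTheory

variable (k : Type*) {K : Type*} [Field k] [Ring K] [HopfAlgebra k K]

/-- The linear map `K^{⊗E} → K^{⊗E}`, `⨂ k_f ↦ (∏_{f ≠ e} ε(k_f)) (k_e)_e`, which retains only the
component of a connection at the edge `e`. -/
def edgePart {E : Type*} (e : E) : (⨂[k] _ : E, K) →ₗ[k] ⨂[k] _ : E, K :=
  open scoped Classical in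
  PiTensorProduct.map (Function.update
    (fun _ => Algebra.linearMap k K ∘ₗ Coalgebra.counit (R := k) (A := K)) e LinearMap.id)

variable (K) in
/-- A `K`-valued Hopf algebra gauge theory on a directed graph, with gauge transformations at the
vertices `vert u`, `u ∈ U`: an algebra structure on `K*^{⊗E}` with unit `1^{⊗E}` and a left module
structure on `K^{⊗E}` over the Hopf algebra `K^{⊗U}`, whose dual right module structure makes
`K*^{⊗E}` a right module algebra, subject to locality conditions. The conditions `act_far`,
`act_tgt`, `act_src` are those for the component of a connection at the edge `e`; by duality, they
say `(α)_e ◁ (h)_v = ε(h) (α)_e`, `⟨α₁, h⟩ (α₂)_e` and `⟨α₂, S(h)⟩ (α₁)_e`, respectively. -/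
@[ext]
structure HopfGaugeTheory [Module.Finite k K] {V E U : Type*} [Finite E] [Finite U]
    (Γ : DirectedGraph V E) (vert : U → V) where
  /-- the multiplication of functions -/
  mul : (⨂[k] _ : E, D k K) →ₗ[k] (⨂[k] _ : E, D k K) →ₗ[k] ⨂[k] _ : E, D k K
  /-- the action of gauge transformations on connections -/
  act : (⨂[k] _ : U, K) →ₐ[k] Module.End k (⨂[k] _ : E, K)
  mul_assoc : ∀ a b c, mul (mul a b) c = mul a (mul b c)
  one_mul : ∀ a, mul (fnOne k K E) a = a
  mul_one : ∀ a, mul a (fnOne k K E) = a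
  mul_same : ∀ (e : E) (α β : D k K), ∃ γ, mul (single e α) (single e β) = single e γ
  mul_pair : ∀ (e f : E) (α β : D k K), e ≠ f → mul (single e α) (single f β) ∈
    Submodule.span k (Set.range fun p : D k K × D k K => pairAt e f p.1 p.2)
  mul_disjoint : ∀ (e f : E) (α β : D k K),
    Disjoint ({Γ.src e, Γ.tgt e} : Set V) {Γ.src f, Γ.tgt f} →
      mul (single e α) (single f β) = pairAt e f α β ∧
      mul (single f β) (single e α) = pairAt e f α β
  mul_act : ∀ (h : ⨂[k] _ : U, K) (a b : ⨂[k] _ : E, D k K),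
    transpose E (act h) (mul a b) = TensorProduct.lift (mul.compl₁₂
      ((transpose E ∘ₗ act.toLinearMap).flip a) ((transpose E ∘ₗ act.toLinearMap).flip b))
      (tensorComul k K U h)
  one_act : ∀ h : ⨂[k] _ : U, K,
    transpose E (act h) (fnOne k K E) = tensorCounit k K U h • fnOne k K E
  act_far : ∀ (e : E) (u : U), Γ.src e ≠ Γ.tgt e → vert u ≠ Γ.src e → vert u ≠ Γ.tgt e →
    ∀ (h : K) (x : ⨂[k] _ : E, K), edgePart k e (act (incl k u h) x) =
      Coalgebra.counit (R := k) h • edgePart k e x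
  act_tgt : ∀ (e : E) (u : U), Γ.src e ≠ Γ.tgt e → vert u = Γ.tgt e →
    ∀ (h : K) (x : ⨂[k] _ : E, K), edgePart k e (act (incl k u h) x) =
      incl k e h * edgePart k e x
  act_src : ∀ (e : E) (u : U), Γ.src e ≠ Γ.tgt e → vert u = Γ.src e →
    ∀ (h : K) (x : ⨂[k] _ : E, K), edgePart k e (act (incl k u h) x) =
      edgePart k e x * incl k e (HopfAlgebra.antipode k h)

variable {k}

/-- The right module structure on functions, dual to the left module structure on connections:
`T.dualAct h α = α ◁* h`. -/
def HopfGaugeTheory.dualAct [Module.Finite k K] {V E U : Type*} [Finite E] [Finite U]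
    {Γ : DirectedGraph V E} {vert : U → V} (T : HopfGaugeTheory k K Γ vert) :
    (⨂[k] _ : U, K) →ₗ[k] Module.End k (⨂[k] _ : E, D k K) :=
  transpose E ∘ₗ T.act.toLinearMap

variable (k K) in
/-- A Hopf algebra gauge theory on `Γ`, with gauge transformations at all vertices. -/
abbrev GraphGaugeTheory [Module.Finite k K] {V E : Type*} [Finite E] [Finite V]
    (Γ : DirectedGraph V E) : Type _ := HopfGaugeTheory k K Γ (id : V → V)

variable (k K) in
/-- A Hopf algebra gauge theory on the vertex neighbourhood `Γ_v`, with gauge transformations only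
at `v`; these form the Hopf algebra `K`, written as the tensor power `K^{⊗Unit}`. -/
abbrev VertexGaugeTheory [Module.Finite k K] {V E : Type*} [Finite E]
    (Γ : DirectedGraph V E) (v : V) : Type _ :=
  HopfGaugeTheory k K (Γ.nbhd v) (fun _ : Unit => none)

/-! ### The embedding `G*` and local gauge theories -/

variable {V E : Type*} [Finite V] [Finite E]

variable (k K) in
/-- The vector space `⨂ᵥ K*^{⊗v}`, where `K*^{⊗v}` has one factor for each edge end at `v`. -/
abbrev VertexFns (Γ : DirectedGraph V E) : Type _ := ⨂[k] v : V, ⨂[k] _ : Γ.EndsAt v, D k K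

variable (k K) in
/-- The isomorphism `⨂ₑ (K* ⊗ K*) ≃ ⨂ᵥ K*^{⊗v}`, `⨂ₑ (αₑ ⊗ βₑ) ↦ ∏ₑ (αₑ ⊗ βₑ)_{s(e)t(e)}`. -/
def endSplit (Γ : DirectedGraph V E) :
    (⨂[k] _ : E, (D k K ⊗[k] D k K)) ≃ₗ[k] VertexFns k K Γ :=
  (interchange k E (D k K) (D k K)).symm ≪≫ₗ PiTensorProduct.tmulEquiv k (D k K) ≪≫ₗ
    group k Γ.endVertex (D k K)

variable (k K) in
/-- The linear map `G* : K*^{⊗E} → ⨂ᵥ K*^{⊗v}`, `(α)_e ↦ (α₂ ⊗ α₁)_{s(e)t(e)}`. -/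
def gStar [Module.Finite k K] (Γ : DirectedGraph V E) :
    (⨂[k] _ : E, D k K) →ₗ[k] VertexFns k K Γ :=
  (endSplit k K Γ).toLinearMap ∘ₗ PiTensorProduct.map (fun _ =>
    (TensorProduct.comm k (D k K) (D k K)).toLinearMap ∘ₗ dualComul k K)

/-- The `K^{⊗V}`-module structure on `⨂ᵥ K*^{⊗v}` induced by linear maps
`K → End (K*^{⊗v})`: `(⨂ᵥ aᵥ) ◁ (⨂ᵥ hᵥ) = ⨂ᵥ (aᵥ ◁ hᵥ)`. -/
def productAct {Γ : DirectedGraph V E}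
    (a : ∀ v, K →ₗ[k] Module.End k (⨂[k] _ : Γ.EndsAt v, D k K)) :
    (⨂[k] _ : V, K) →ₗ[k] Module.End k (VertexFns k K Γ) :=
  PiTensorProduct.piTensorHomMap ∘ₗ PiTensorProduct.map a

/-- `G*` is a homomorphism of `K^{⊗V}`-module algebras from the gauge theory `T` on `Γ` to the
tensor product of the algebras with multiplications `m v` and actions `a v`. -/
structure IsModuleAlgebraHom [Module.Finite k K] {Γ : DirectedGraph V E}
    (T : GraphGaugeTheory k K Γ)
    (m : ∀ v, (⨂[k] _ : Γ.EndsAt v, D k K) →ₗ[k] (⨂[k] _ : Γ.EndsAt v, D k K) →ₗ[k]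
      ⨂[k] _ : Γ.EndsAt v, D k K)
    (a : ∀ v, K →ₗ[k] Module.End k (⨂[k] _ : Γ.EndsAt v, D k K)) : Prop where
  map_mul : ∀ x y, gStar k K Γ (T.mul x y) =
    PiTensorProduct.map₂ m (gStar k K Γ x) (gStar k K Γ y)
  map_one : gStar k K Γ (fnOne k K E) =
    PiTensorProduct.tprod k fun v => fnOne k K (Γ.EndsAt v)
  map_act : ∀ h x, gStar k K Γ (T.dualAct h x) = productAct a h (gStar k K Γ x)

/-- A Hopf algebra gauge theory on `Γ` is local if there are Hopf algebra gauge theories on the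
vertex neighbourhoods such that `G*` is a homomorphism of `K^{⊗V}`-module algebras. -/
def IsLocal [Module.Finite k K] {Γ : DirectedGraph V E} (T : GraphGaugeTheory k K Γ) : Prop :=
  ∃ A : ∀ v, VertexGaugeTheory k K Γ v, IsModuleAlgebraHom T (fun v => (A v).mul)
    (fun v => (A v).dualAct ∘ₗ (incl k ()).toLinearMap)

end GaugeTheory

/-! ### The module algebra of a vertex neighbourhood -/

section VertexAlgebra

variable {k K : Type*} [Field k] [Ring K] [HopfAlgebra k K]
variable {ι : Type*} [Finite ι] [LinearOrder ι]

/-- The action of `K` on the `i`th factor of `K*^{⊗ι}`. -/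
def factorAct (τ : ι → Bool) (i : ι) : K →ₗ[k] Module.End k (⨂[k] _ : ι, D k K) :=
  atFactor k i ∘ₗ endAct k K (τ i)

open WithConv in
/-- The action of `K` on the factors of `K*^{⊗ι}` with index in `s`, distributed by means of the
iterated comultiplication in increasing order: if `s = {i₁ < ... < iₘ}`, then `h` acts by the
composite of the actions of `h₁` on factor `i₁`, ..., of `hₘ` on factor `iₘ`. This is a product
with respect to the convolution of linear maps from `K` to the algebra of operators. -/
def tensorAct (τ : ι → Bool) (s : Finset ι) : K →ₗ[k] Module.End k (⨂[k] _ : ι, D k K) :=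
  ((s.sort (· ≤ ·)).map fun i => toConv (factorAct (k := k) (K := K) τ i)).prod.ofConv

/-- The right action of `K` on `K*^{⊗ι}`: `(α¹ ⊗ ... ⊗ αⁿ) ◁ h =
⟨S^{τ(1)}(α¹_{1+τ(1)}) ⋯ S^{τ(n)}(αⁿ_{1+τ(n)}), h⟩ α¹_{2-τ(1)} ⊗ ... ⊗ αⁿ_{2-τ(n)}`. -/
def vertexAct (τ : ι → Bool) : K →ₗ[k] Module.End k (⨂[k] _ : ι, D k K) :=
  haveI := Fintype.ofFinite ι
  tensorAct τ Finset.univ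

/-- Left multiplication by `(α)ᵢ`, obtained by moving it past all factors with index `j < i`: these
are acted on by `R₁`, and `α ◁ R₂` is then multiplied with the `i`th factor. -/
def genMul (R : K ⊗[k] K) (σ τ : ι → Bool) (i : ι) :
    D k K →ₗ[k] Module.End k (⨂[k] _ : ι, D k K) :=
  haveI := Fintype.ofFinite ι
  TensorProduct.lift (LinearMap.mk₂ k
    (fun h₁ h₂ => LinearMap.mulRight k (tensorAct τ (Finset.univ.filter (· < i)) h₁) ∘ₗ
      atFactor k i ∘ₗ endMul R (σ i) (τ i) ∘ₗ endAct k K (τ i) h₂)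
    (fun a b c => by ext; simp [mul_add]) (fun a b c => by ext; simp)
    (fun a b c => by ext; simp) (fun a b c => by ext; simp)) R

/-- The multiplication of the algebra `K*^{⊗ι}` of a vertex: since `α¹ ⊗ ... ⊗ αⁿ` is the ordered
product `(α¹)₁ ⋯ (αⁿ)ₙ`, left multiplication by it is the ordered composite of the left
multiplications by the elements `(αⁱ)ᵢ`. -/
def vertexMul (R : K ⊗[k] K) (σ τ : ι → Bool) :
    (⨂[k] _ : ι, D k K) →ₗ[k] (⨂[k] _ : ι, D k K) →ₗ[k] ⨂[k] _ : ι, D k K :=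
  haveI := Fintype.ofFinite ι
  PiTensorProduct.lift (((MultilinearMap.mkPiAlgebraFin k (Fintype.card ι)
    (Module.End k (⨂[k] _ : ι, D k K))).domDomCongr
      (monoEquivOfFin ι rfl).toEquiv).compLinearMap (genMul R σ τ))

/-- The defining relations of the multiplication of a vertex algebra:
* `(α)ᵢ (β)ᵢ` is given by `endMul`;
* `(α)ᵢ (β)ⱼ = (α ⊗ β)ᵢⱼ` for `i < j`;
* `(α)ᵢ (β)ⱼ = ⟨β_{1+τ(j)} ⊗ α_{1+τ(i)}, (S^{τ(j)} ⊗ S^{τ(i)})(R)⟩ (α_{2-τ(i)} ⊗ β_{2-τ(j)})ᵢⱼ`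
  for `j < i`;
* `α¹ ⊗ ... ⊗ αⁿ = (α¹)₁ ⋯ (αⁿ)ₙ`, in the form `(α)ᵢ (⨂ β) = ⨂ β'` if `β` has unit entries in all
  places `j ≤ i`, where `β'` arises from `β` by inserting `α` in the place `i`. -/
structure VertexRelations (R : K ⊗[k] K) (σ τ : ι → Bool)
    (m : (⨂[k] _ : ι, D k K) →ₗ[k] (⨂[k] _ : ι, D k K) →ₗ[k] ⨂[k] _ : ι, D k K) : Prop where
  same : ∀ i α β, m (single i α) (single i β) = single i (endMul R (σ i) (τ i) α β)
  lt : ∀ i j α β, i < j → m (single i α) (single j β) = pairAt i j α β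
  gt : ∀ i j α β, j < i → m (single i α) (single j β) =
    TensorProduct.lift ((LinearMap.mul k (Module.End k (⨂[k] _ : ι, D k K))).compl₁₂
      (factorAct τ j) (factorAct τ i)) R (pairAt i j α β)
  ordered : ∀ i (α : D k K) (β : ι → D k K),
    (∀ j, j ≤ i → β j = (Coalgebra.counit : K →ₗ[k] k)) →
      m (single i α) (PiTensorProduct.tprod k β) =
        PiTensorProduct.tprod k (Function.update β i α)

end VertexAlgebra

/-! ### The algebras attached to a ciliated ribbon graph -/

section RibbonGraph

variable {k K : Type*} [Field k] [Ring K] [HopfAlgebra k K]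
variable {V E : Type*} [Finite V] [Finite E]

/-- `τ = 1` for outgoing (that is, starting) edge ends and `τ = 0` for incoming ones. -/
def tau (x : E ⊕ E) : Bool := x.isLeft

open scoped Classical in
/-- `σ = 0` for the edge ends in the image of `ρ` and `σ = 1` for the others. -/
def sigma (ρ : E → E ⊕ E) (x : E ⊕ E) : Bool := if x ∈ Set.range ρ then false else true

/-- `ρ` selects for each edge one of its two edge ends. -/
def IsEndChoice (ρ : E → E ⊕ E) : Prop := ∀ e, ρ e = Sum.inl e ∨ ρ e = Sum.inr e

/-- The multiplication of the algebra `A*_v`. -/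
def ribbonMul (Γ : CiliatedRibbonGraph V E) (R : V → K ⊗[k] K) (ρ : E → E ⊕ E) (v : V) :
    (⨂[k] _ : Γ.EndsAt v, D k K) →ₗ[k] (⨂[k] _ : Γ.EndsAt v, D k K) →ₗ[k]
      ⨂[k] _ : Γ.EndsAt v, D k K :=
  letI := Γ.endOrder v
  vertexMul (R v) (fun x => sigma ρ x.1) (fun x => tau x.1)

variable (k K) in
/-- The right action of `K` on `A*_v`. -/
def ribbonAct (Γ : CiliatedRibbonGraph V E) (v : V) :
    K →ₗ[k] Module.End k (⨂[k] _ : Γ.EndsAt v, D k K) :=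
  letI := Γ.endOrder v
  vertexAct (fun x => tau x.1)

/-- The multiplication `A*_v` satisfies its defining relations. -/
def RibbonRelations (Γ : CiliatedRibbonGraph V E) (R : V → K ⊗[k] K) (ρ : E → E ⊕ E) (v : V) :
    Prop :=
  letI := Γ.endOrder v
  VertexRelations (R v) (fun x : Γ.EndsAt v => sigma ρ x.1) (fun x => tau x.1) (ribbonMul Γ R ρ v)

/-- The gauge theory `T` on `Γ` is the pullback along `G*` of the module algebra `⨂ᵥ A*_v`. -/
def IsPullback [Module.Finite k K] (Γ : CiliatedRibbonGraph V E) (R : V → K ⊗[k] K)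
    (ρ : E → E ⊕ E) (T : GraphGaugeTheory k K Γ.toDirectedGraph) : Prop :=
  IsModuleAlgebraHom T (ribbonMul Γ R ρ) (ribbonAct k K Γ)

variable (k) in
/-- The linear map `h ⊗ h' ↦ (h)_e y (S(h'))_e`. -/
def sandwich (e : E) (y : ⨂[k] _ : E, K) : K ⊗[k] K →ₗ[k] ⨂[k] _ : E, K :=
  TensorProduct.lift ((LinearMap.mul k (⨂[k] _ : E, K)).compl₁₂
    (LinearMap.mulRight k y ∘ₗ (incl k e).toLinearMap)
    ((incl k e).toLinearMap ∘ₗ HopfAlgebra.antipode k (A := K)))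

/-- The explicit action of gauge transformations on the component of a connection `x` at `e`. -/
structure HasStandardAction [Module.Finite k K] (Γ : CiliatedRibbonGraph V E)
    (T : GraphGaugeTheory k K Γ.toDirectedGraph) : Prop where
  far : ∀ e v, v ≠ Γ.src e → v ≠ Γ.tgt e → ∀ (h : K) x,
    edgePart k e (T.act (incl k v h) x) = Coalgebra.counit (R := k) h • edgePart k e x
  nonloop : ∀ e, Γ.src e ≠ Γ.tgt e → ∀ (h h' : K) x,
    edgePart k e (T.act (incl k (Γ.src e) h * incl k (Γ.tgt e) h') x) =
      sandwich k e (edgePart k e x) (h' ⊗ₜ[k] h)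
  loop_tgt_lt : ∀ e, Γ.Before (Sum.inr e) (Sum.inl e) → ∀ (h : K) x,
    edgePart k e (T.act (incl k (Γ.src e) h) x) =
      sandwich k e (edgePart k e x) (Coalgebra.comul (R := k) h)
  loop_src_lt : ∀ e, Γ.Before (Sum.inl e) (Sum.inr e) → ∀ (h : K) x,
    edgePart k e (T.act (incl k (Γ.src e) h) x) =
      sandwich k e (edgePart k e x) (flip k (Coalgebra.comul (R := k) h))

/-- The linear map `Π : ⨂ᵥ A*_v → ⨂ᵥ A*_v`,
`(α ⊗ β)_{s(e)t(e)} ↦ ⟨α₁ S(β₂), ℓ⟩ (α₂ ⊗ β₁)_{s(e)t(e)}`. Note that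
`⟨α₁ S(β₂), ℓ⟩ α₂ ⊗ β₁ = (α ◁ ℓ₁) ⊗ (S(ℓ₂) ▷ β)` for the regular actions of `K` on `K*`. -/
def haarProj (Γ : DirectedGraph V E) (ℓ : K) : Module.End k (VertexFns k K Γ) :=
  (endSplit k K Γ).conj (PiTensorProduct.map fun _ =>
    TensorProduct.lift ((TensorProduct.mapBilinear (RingHom.id k) (D k K) (D k K) (D k K)
      (D k K)).compl₁₂ (regRight k K) (regLeft k K ∘ₗ HopfAlgebra.antipode k (A := K)))
      (Coalgebra.comul (R := k) ℓ))

end RibbonGraph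

end HopfGauge

end

open scoped TensorProduct
open HopfGauge

open scoped TensorProduct
open HopfGauge

noncomputable section

namespace HopfGauge

open WithConv
open scoped Coalgebra

/-! ### Sweedler calculus with unbundled multilinear functions. -/

section Sweedler

variable {k K P : Type*} [Field k] [Ring K] [HopfAlgebra k K] [AddCommMonoid P] [Module k P]

/-! At a vertex everything is done with operators. Let `genMul i α` be the operator on $K^{*\otimes
n}$ which left multiplication by $(α)_i$ has to be: $R_1$ acts on all factors below $i$, and $α ◁
R_2$ is multiplied into factor $i$. The axioms of an $R$-matrix imply that these operators satisfy
the defining relations (`genMul_mul_genMul_same`, `genMul_mul_genMul`). Every product of them can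
therefore be rewritten as a sum of increasingly ordered products, and an ordered product applied to
the unit returns the tensor from which it was built (`monomial_apply_one`). So the ordered products
form a left regular representation (`vertexMul_genMul`), which gives associativity. Compatibility
with gauge transformations only has to be checked on generators.

The passage to the graph rests on a second action. The copy of $K^*$ at an edge end carries two
commuting regular actions of $K$: gauge transformations act through one of them, `otherAct` is the
other one. An element lies in the image of $G^*$ if and only if the other actions at the two ends of
each edge agree on it (`mem_range_gStar`). The other action is compatible with the product through
$Δ$ at ends with $σ ≠ τ$ and through $Δ^{op}$ at ends with $σ = τ$. Both $σ$ and $τ$ take different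
values at the two ends of an edge, so these ends are of the same kind, and the image is a
subalgebra. It is a submodule because the two actions commute. The structures are pulled back with
an explicit left inverse of $G^*$, and injectivity of $G^*$ gives uniqueness. The support conditions
on products hold because a factor on which the other action is trivial contains the unit.

The product for $σ = 0$ at some end is the twist by $R$, through the other action, of the product
for $σ = 1$ (`vertexMul_twist`). On the image of $G^*$, a twist at the starting end of an edge
equals a twist at its target end by the same $R$. This yields independence of $ρ$.

The map $Π$ is treated edge by edge. It needs $\sum S(ℓ_2)ℓ_1 = 1$ and a Casimir property of $ℓ_1 ⊗
S(ℓ_2)$, and both come from $S^2 = \mathrm{id}$ (`IsHaarIntegral.antipode_antipode`), where the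
ribbon element and characteristic zero enter. The quotient of the Drinfel'd element by the ribbon
element is a group-like $g$ of finite order with $S^2 = g(\cdot)g^{-1}$. Character theory shows
$\mathrm{Tr}(S^2) ≠ 0$. The number $\mathrm{Tr}(S^2)/\dim K$ is the trace of $S^2$ on the range of a
projection commuting with $S^2$, hence an algebraic integer; it is also the mean of the eigenvalues
of $S^2$, which are roots of unity. A mean of roots of unity that is a nonzero algebraic integer
forces them to be equal, so $S^2$ is a scalar, and $S^2(1) = 1$. -/

variable (k) in
/-- Bilinearity of an unbundled function. -/
structure IsBilin (F : K → K → P) : Prop where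
  add₁ : ∀ x x' y, F (x + x') y = F x y + F x' y := by
    intros; simp [add_mul, mul_add, add_smul, TensorProduct.add_tmul, TensorProduct.tmul_add]
  smul₁ : ∀ (c : k) x y, F (c • x) y = c • F x y := by
    intros
    simp [TensorProduct.tmul_smul, ← TensorProduct.smul_tmul', smul_smul, mul_comm (G := k)]
  add₂ : ∀ x y y', F x (y + y') = F x y + F x y' := by
    intros; simp [add_mul, mul_add, add_smul, TensorProduct.add_tmul, TensorProduct.tmul_add]
  smul₂ : ∀ (c : k) x y, F x (c • y) = c • F x y := by
    intros
    simp [TensorProduct.tmul_smul, ← TensorProduct.smul_tmul', smul_smul, mul_comm (G := k)]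

variable (k) in
/-- Trilinearity of an unbundled function. -/
structure IsTrilin (F : K → K → K → P) : Prop where
  add₁ : ∀ x x' y z, F (x + x') y z = F x y z + F x' y z := by
    intros; simp [add_mul, mul_add, add_smul, TensorProduct.add_tmul, TensorProduct.tmul_add]
  smul₁ : ∀ (c : k) x y z, F (c • x) y z = c • F x y z := by
    intros
    simp [TensorProduct.tmul_smul, ← TensorProduct.smul_tmul', smul_smul, mul_comm (G := k)]
  add₂ : ∀ x y y' z, F x (y + y') z = F x y z + F x y' z := by
    intros; simp [add_mul, mul_add, add_smul, TensorProduct.add_tmul, TensorProduct.tmul_add]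
  smul₂ : ∀ (c : k) x y z, F x (c • y) z = c • F x y z := by
    intros
    simp [TensorProduct.tmul_smul, ← TensorProduct.smul_tmul', smul_smul, mul_comm (G := k)]
  add₃ : ∀ x y z z', F x y (z + z') = F x y z + F x y z' := by
    intros; simp [add_mul, mul_add, add_smul, TensorProduct.add_tmul, TensorProduct.tmul_add]
  smul₃ : ∀ (c : k) x y z, F x y (c • z) = c • F x y z := by
    intros
    simp [TensorProduct.tmul_smul, ← TensorProduct.smul_tmul', smul_smul, mul_comm (G := k)]

/-- The linear map on `K ⊗ K` determined by a bilinear function. -/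
def IsBilin.lift {F : K → K → P} (h : IsBilin k F) : K ⊗[k] K →ₗ[k] P :=
  TensorProduct.lift (LinearMap.mk₂ k F h.add₁ h.smul₁ h.add₂ h.smul₂)

@[simp]
theorem IsBilin.lift_tmul {F : K → K → P} (h : IsBilin k F) (x y : K) :
    h.lift (x ⊗ₜ[k] y) = F x y := rfl

/-- The linear map on `K ⊗ (K ⊗ K)` determined by a trilinear function. -/
def IsTrilin.lift {F : K → K → K → P} (h : IsTrilin k F) : K ⊗[k] (K ⊗[k] K) →ₗ[k] P :=
  TensorProduct.lift
    { toFun := fun x => IsBilin.lift (k := k) (F := F x)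
        ⟨h.add₂ x, fun c => h.smul₂ c x, h.add₃ x, fun c => h.smul₃ c x⟩
      map_add' := fun a b => TensorProduct.ext' fun y z => h.add₁ a b y z
      map_smul' := fun r a => TensorProduct.ext' fun y z => h.smul₁ r a y z }

@[simp]
theorem IsTrilin.lift_tmul {F : K → K → K → P} (h : IsTrilin k F) (x y z : K) :
    h.lift (x ⊗ₜ[k] (y ⊗ₜ[k] z)) = F x y z := rfl

theorem exists_sum_tmul (x : K ⊗[k] K) :
    ∃ (n : ℕ) (a b : Fin n → K), x = ∑ i, a i ⊗ₜ[k] b i := by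
  obtain ⟨n, a, b, h⟩ := TensorProduct.exists_sum_tmul_eq x
  exact ⟨n, a, b, h⟩

end Sweedler

/-! ### The antipode as a convolution inverse. -/

section Antipode

variable {k K : Type*} [Field k] [Ring K] [HopfAlgebra k K]

local notation "δ" => Coalgebra.comul (R := k) (A := K)
local notation "ε" => Coalgebra.counit (R := k) (A := K)
local notation "𝑺" => HopfAlgebra.antipode k (A := K)

/-- With $Δ$ factored into the two inclusions of $K$, a convolution inverse of $Δ$ can be assembled
from inverses of algebra homomorphisms. -/
theorem toConv_comul_eq :
    (toConv δ : WithConv (K →ₗ[k] K ⊗[k] K)) =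
      toConv (Algebra.TensorProduct.includeLeft (R := k) (S := k) (A := K) (B := K)).toLinearMap *
      toConv (Algebra.TensorProduct.includeRight (R := k) (A := K) (B := K)).toLinearMap := by
  ext h
  rw [LinearMap.convMul_apply]
  have key : ∀ x : K ⊗[k] K, x = LinearMap.mul' k (K ⊗[k] K) (TensorProduct.map
      (Algebra.TensorProduct.includeLeft (R := k) (S := k) (A := K) (B := K)).toLinearMap
      (Algebra.TensorProduct.includeRight (R := k) (A := K) (B := K)).toLinearMap x) := by
    intro x
    induction x with
    | zero => simp
    | add x y hx hy => rw [map_add, map_add, ← hx, ← hy]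
    | tmul x y => simp
  exact key _

theorem algHom_antipode_conv {B : Type*} [Ring B] [Algebra k B] (f : K →ₐ[k] B) :
    (toConv (f.toLinearMap ∘ₗ 𝑺) * toConv f.toLinearMap : WithConv (K →ₗ[k] B)) = 1 := by
  have := LinearMap.algHom_comp_convMul_distrib f (toConv 𝑺) (toConv (LinearMap.id (M := K)))
  rw [LinearMap.antipode_mul_id] at this
  simp only [LinearMap.comp_id] at this
  apply WithConv.ofConv_injective
  rw [← this]
  ext h
  simp [LinearMap.convOne_def]

/-- Both sides are convolution inverses of $Δ$ in $\mathrm{Hom}(K, K ⊗ K)$: the right one on the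
left, $Δ ∘ S$ on the right. -/
theorem comul_antipode (h : K) :
    Coalgebra.comul (R := k) (HopfAlgebra.antipode k h) =
      TensorProduct.map 𝑺 𝑺 (flip k (Coalgebra.comul (R := k) h)) := by
  set i1 := (Algebra.TensorProduct.includeLeft (R := k) (S := k) (A := K) (B := K))
  set i2 := (Algebra.TensorProduct.includeRight (R := k) (A := K) (B := K))
  have hG : (toConv (TensorProduct.map 𝑺 𝑺 ∘ₗ flip k ∘ₗ δ) : WithConv (K →ₗ[k] K ⊗[k] K)) =
      toConv (i2.toLinearMap ∘ₗ 𝑺) * toConv (i1.toLinearMap ∘ₗ 𝑺) := by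
    ext h
    rw [LinearMap.convMul_apply]
    change TensorProduct.map 𝑺 𝑺 (flip k (Coalgebra.comul (R := k) h)) =
      LinearMap.mul' k (K ⊗[k] K) (TensorProduct.map _ _ (Coalgebra.comul h))
    generalize Coalgebra.comul (R := k) h = x
    induction x with
    | zero => simp
    | add x y hx hy => rw [map_add, map_add, map_add, map_add, ← hx, ← hy]
    | tmul x y => simp [flip, i1, i2]
  have h1 : (toConv (TensorProduct.map 𝑺 𝑺 ∘ₗ flip k ∘ₗ δ) : WithConv (K →ₗ[k] K ⊗[k] K)) *
      toConv δ = 1 := by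
    rw [hG, toConv_comul_eq, mul_assoc, ← mul_assoc (toConv (i1.toLinearMap ∘ₗ 𝑺)),
      algHom_antipode_conv, one_mul, algHom_antipode_conv]
  have h2 := left_inv_eq_right_inv h1 (LinearMap.comul_right_inv (R := k) (C := K))
  exact (LinearMap.congr_fun (congrArg ofConv h2) h).symm

end Antipode

/-! ### Consequences of the axioms of an R-matrix. -/

section RMatrix

variable {k K : Type*} [Field k] [Ring K] [HopfAlgebra k K]

local notation "δ" => Coalgebra.comul (R := k) (A := K)
local notation "ε" => Coalgebra.counit (R := k) (A := K)
local notation "𝑺" => HopfAlgebra.antipode k (A := K)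

@[simp]
theorem flip_tmul (x y : K) : flip k (x ⊗ₜ[k] y) = y ⊗ₜ[k] x := rfl

theorem flip_mul (x y : K ⊗[k] K) : flip k (x * y) = flip k x * flip k y := by
  induction x with
  | zero => simp
  | add a b ha hb => simp [add_mul, ha, hb]
  | tmul a b =>
    induction y with
    | zero => simp
    | add c d hc hd => simp [mul_add, hc, hd]
    | tmul c d => simp

@[simp]
theorem flip_flip (x : K ⊗[k] K) : flip k (flip k x) = x := by
  simp [flip]

@[simp]
theorem flip_one : flip k (1 : K ⊗[k] K) = 1 := rfl

variable {R : K ⊗[k] K} (hR : IsRMatrix k R) {n : ℕ} {a b : Fin n → K}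
  (hab : R = ∑ i, a i ⊗ₜ[k] b i)

-- The axiom for $(Δ ⊗ \mathrm{id})(R)$, evaluated on a trilinear function; this and the two lemmas
-- below are the forms in which the axioms enter all later sums.
include hR hab in
theorem IsRMatrix.sum_comul_left {P : Type*} [AddCommMonoid P] [Module k P] {F : K → K → K → P}
    (hF : IsTrilin k F) :
    ∑ i, ∑ p ∈ (ℛ k (a i)).index, F ((ℛ k (a i)).left p) ((ℛ k (a i)).right p) (b i) =
      ∑ i, ∑ j, F (a i) (a j) (b i * b j) := by
  have h := hR.comul_left
  simp only [hab, emb13, emb23, map_sum, LinearMap.rTensor_tmul, LinearMap.lTensor_tmul,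
    TensorProduct.tmul_sum, Finset.sum_mul_sum] at h
  have h' := congrArg hF.lift h
  simp only [map_sum, TensorProduct.mk_apply, Algebra.TensorProduct.tmul_mul_tmul, mul_one,
    one_mul, IsTrilin.lift_tmul] at h'
  rw [← h']
  refine Finset.sum_congr rfl fun i _ => ?_
  rw [← (ℛ k (a i)).eq]
  simp [TensorProduct.sum_tmul]

include hR hab in
theorem IsRMatrix.sum_comul_right {P : Type*} [AddCommMonoid P] [Module k P] {F : K → K → K → P}
    (hF : IsTrilin k F) :
    ∑ i, ∑ p ∈ (ℛ k (b i)).index, F (a i) ((ℛ k (b i)).left p) ((ℛ k (b i)).right p) =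
      ∑ i, ∑ j, F (a i * a j) (b j) (b i) := by
  have h := hR.comul_right
  simp only [hab, emb13, emb12, map_sum, LinearMap.lTensor_tmul,
    TensorProduct.sum_tmul, Finset.sum_mul_sum, TensorProduct.assoc_tmul] at h
  have h' := congrArg hF.lift h
  simp only [map_sum, TensorProduct.mk_apply, Algebra.TensorProduct.tmul_mul_tmul, mul_one,
    one_mul, IsTrilin.lift_tmul] at h'
  rw [← h']
  refine Finset.sum_congr rfl fun i _ => ?_
  rw [← (ℛ k (b i)).eq]
  simp [TensorProduct.tmul_sum]

include hR hab in
theorem IsRMatrix.sum_mul_comul {P : Type*} [AddCommMonoid P] [Module k P] {F : K → K → P}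
    (hF : IsBilin k F) (h : K) :
    ∑ i, ∑ p ∈ (ℛ k h).index, F (a i * (ℛ k h).left p) (b i * (ℛ k h).right p) =
      ∑ i, ∑ p ∈ (ℛ k h).index, F ((ℛ k h).right p * a i) ((ℛ k h).left p * b i) := by
  have e := hR.mul_comul h
  rw [← (ℛ k h).eq, hab, map_sum, Finset.sum_mul_sum, Finset.sum_mul_sum] at e
  have e' := congrArg hF.lift e
  simp only [map_sum, flip_tmul, Algebra.TensorProduct.tmul_mul_tmul, IsBilin.lift_tmul] at e'
  rw [e', Finset.sum_comm]

-- Applying $ε$ to the first leg of $(Δ ⊗ \mathrm{id})(R) = R_{13}R_{23}$ gives $R = (1 ⊗ x)R$ with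
-- $x = (ε ⊗ \mathrm{id})(R)$, and $R$ can be cancelled.
include hR hab in
theorem IsRMatrix.sum_counit_left : ∑ i, ε (a i) • b i = 1 := by
  have h := hR.sum_comul_left hab (F := fun x y z => ε x • (y ⊗ₜ[k] z)) {}
  have h1 : ∀ i, ∑ p ∈ (ℛ k (a i)).index, ε ((ℛ k (a i)).left p) • (((ℛ k (a i)).right p) ⊗ₜ[k] b i)
      = a i ⊗ₜ[k] b i := by
    intro i
    conv_rhs => rw [← Coalgebra.sum_counit_smul (ℛ k (a i))]
    simp [TensorProduct.sum_tmul, TensorProduct.smul_tmul']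
  simp only [h1, ← hab] at h
  have h2 : R = ((1 : K) ⊗ₜ[k] (∑ i, ε (a i) • b i)) * R := by
    conv_lhs => rw [h]
    rw [hab, Finset.mul_sum, Finset.sum_comm]
    refine Finset.sum_congr rfl fun j _ => ?_
    simp [TensorProduct.tmul_sum, Finset.sum_mul, TensorProduct.tmul_smul]
  have h3 : (1 : K ⊗[k] K) = (1 : K) ⊗ₜ[k] (∑ i, ε (a i) • b i) :=
    hR.isUnit.mul_right_cancel (by rw [one_mul]; exact h2)
  have h4 := congrArg ((TensorProduct.lid k K).toLinearMap ∘ₗ TensorProduct.map ε LinearMap.id) h3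
  simpa [Algebra.TensorProduct.one_def] using h4.symm

include hR hab in
theorem IsRMatrix.sum_counit_right : ∑ i, ε (b i) • a i = 1 := by
  have h := hR.sum_comul_right hab (F := fun x y z => ε z • (x ⊗ₜ[k] y)) {}
  have h1 : ∀ i, ∑ p ∈ (ℛ k (b i)).index, ε ((ℛ k (b i)).right p) • (a i ⊗ₜ[k] ((ℛ k (b i)).left p))
      = a i ⊗ₜ[k] b i := by
    intro i
    have e := congrArg (TensorProduct.rid k K) (Coalgebra.sum_tmul_counit_eq (ℛ k (b i)))
    simp only [map_sum, TensorProduct.rid_tmul, one_smul] at e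
    conv_rhs => rw [← e]
    simp [TensorProduct.tmul_sum]
  simp only [h1, ← hab] at h
  have h2 : R = ((∑ i, ε (b i) • a i) ⊗ₜ[k] (1 : K)) * R := by
    conv_lhs => rw [h]
    rw [hab, Finset.mul_sum, Finset.sum_comm]
    refine Finset.sum_congr rfl fun j _ => ?_
    simp [TensorProduct.sum_tmul, Finset.sum_mul, TensorProduct.smul_tmul']
  have h3 : (1 : K ⊗[k] K) = (∑ i, ε (b i) • a i) ⊗ₜ[k] (1 : K) :=
    hR.isUnit.mul_right_cancel (by rw [one_mul]; exact h2)
  have h4 := congrArg ((TensorProduct.rid k K).toLinearMap ∘ₗ TensorProduct.map LinearMap.id ε) h3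
  simpa [Algebra.TensorProduct.one_def] using h4.symm

-- Multiply $S$ of the first leg with the second one in $(Δ ⊗ \mathrm{id})(R) = R_{13}R_{23}$: the
-- antipode axiom and $(ε ⊗ \mathrm{id})(R) = 1$ leave the unit.
include hR hab in
theorem IsRMatrix.antipode_left_mul : (∑ i, 𝑺 (a i) ⊗ₜ[k] b i) * R = 1 := by
  have h := hR.sum_comul_left hab (F := fun x y z => (𝑺 x * y) ⊗ₜ[k] z) {}
  rw [hab, Finset.sum_mul_sum]
  simp only [Algebra.TensorProduct.tmul_mul_tmul]
  rw [← h]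
  simp only [← TensorProduct.sum_tmul, HopfAlgebra.sum_antipode_mul_eq_smul]
  simp only [← TensorProduct.smul_tmul', ← TensorProduct.tmul_smul, ← TensorProduct.tmul_sum,
    hR.sum_counit_left hab, Algebra.TensorProduct.one_def]

include hR hab in
theorem IsRMatrix.mul_antipode_left : R * (∑ i, 𝑺 (a i) ⊗ₜ[k] b i) = 1 := by
  obtain ⟨v, hv⟩ := hR.isUnit
  have := hR.antipode_left_mul hab
  rw [← hv] at this ⊢
  rw [Units.mul_eq_one_iff_inv_eq, ← Units.mul_eq_one_iff_eq_inv.1 this]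

-- By $(\mathrm{id} ⊗ Δ)(R) = R_{13}R_{12}$, the element $(S ⊗ S)(R)$ is a right inverse of $(S ⊗
-- \mathrm{id})(R) = R^{-1}$, as $R$ is.
include hR hab in
theorem IsRMatrix.antipode_antipode : ∑ i, 𝑺 (a i) ⊗ₜ[k] 𝑺 (b i) = R := by
  have h := hR.sum_comul_right hab (F := fun x y z => 𝑺 x ⊗ₜ[k] (y * 𝑺 z)) {}
  have h1 : (∑ i, 𝑺 (a i) ⊗ₜ[k] b i) * (∑ i, 𝑺 (a i) ⊗ₜ[k] 𝑺 (b i)) = 1 := by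
    rw [Finset.sum_mul_sum]
    simp only [Algebra.TensorProduct.tmul_mul_tmul, ← HopfAlgebra.antipode_mul_antidistrib]
    rw [Finset.sum_comm, ← h]
    simp only [← TensorProduct.tmul_sum, HopfAlgebra.sum_mul_antipode_eq_smul]
    simp only [TensorProduct.tmul_smul, ← map_smul, TensorProduct.smul_tmul']
    rw [← TensorProduct.sum_tmul, ← map_sum, hR.sum_counit_right hab]
    simp [Algebra.TensorProduct.one_def]
  exact (left_inv_eq_right_inv (hR.mul_antipode_left hab) h1).symm

include hR hab in
/-- The Yang-Baxter equation. -/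
theorem IsRMatrix.yangBaxter {P : Type*} [AddCommMonoid P] [Module k P] {F : K → K → K → P}
    (hF : IsTrilin k F) :
    ∑ i, ∑ j, ∑ l, F (a l * a i) (b l * a j) (b i * b j) =
      ∑ i, ∑ j, ∑ l, F (a j * a l) (a i * b l) (b i * b j) := by
  have h1 := hR.sum_comul_left hab (F := fun x y z => ∑ l, F (a l * x) (b l * y) z)
    ⟨by simp [mul_add, hF.add₁, Finset.sum_add_distrib],
      by simp [hF.smul₁, Finset.smul_sum],
      by simp [mul_add, hF.add₂, Finset.sum_add_distrib],
      by simp [hF.smul₂, Finset.smul_sum],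
      by simp [hF.add₃, Finset.sum_add_distrib],
      by simp [hF.smul₃, Finset.smul_sum]⟩
  have h2 := hR.sum_comul_left hab (F := fun x y z => ∑ l, F (y * a l) (x * b l) z)
    ⟨by simp [add_mul, hF.add₂, Finset.sum_add_distrib],
      by simp [hF.smul₂, Finset.smul_sum],
      by simp [add_mul, hF.add₁, Finset.sum_add_distrib],
      by simp [hF.smul₁, Finset.smul_sum],
      by simp [hF.add₃, Finset.sum_add_distrib],
      by simp [hF.smul₃, Finset.smul_sum]⟩
  -- The two sides are now $R_{12}(Δ ⊗ \mathrm{id})(R)$ and $(Δ^{op} ⊗ \mathrm{id})(R)R_{12}$, so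
  -- only $RΔ = Δ^{op}R$ is left.
  rw [← h1, ← h2]
  refine Finset.sum_congr rfl fun i _ => ?_
  rw [Finset.sum_comm, hR.sum_mul_comul hab (F := fun x y => F x y (b i))
    ⟨fun _ _ _ => hF.add₁ .., fun _ _ _ => hF.smul₁ .., fun _ _ _ => hF.add₂ ..,
      fun _ _ _ => hF.smul₂ ..⟩, Finset.sum_comm]

end RMatrix

/-! ### The Drinfel'd element and the group-like element of a ribbon Hopf algebra. -/

section Drinfeld

variable {k K : Type*} [Field k] [Ring K] [HopfAlgebra k K]

local notation "δ" => Coalgebra.comul (R := k) (A := K)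
local notation "ε" => Coalgebra.counit (R := k) (A := K)
local notation "𝑺" => HopfAlgebra.antipode k (A := K)

variable {R : K ⊗[k] K} (hR : IsRMatrix k R) {n : ℕ} {a b : Fin n → K}
  (hab : R = ∑ i, a i ⊗ₜ[k] b i)

include hab in
theorem drinfeldElement_eq_sum : drinfeldElement k R = ∑ i, 𝑺 (b i) * a i := by
  simp [drinfeldElement, hab]

/-- `S²(h) u = u h` for the Drinfel'd element `u`. -/
theorem IsRMatrix.antipode_sq_mul_drinfeldElement (hR : IsRMatrix k R) (h : K) :
    𝑺 (𝑺 h) * drinfeldElement k R = drinfeldElement k R * h := by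
  obtain ⟨n, a, b, hab⟩ := exists_sum_tmul R
  have hu := drinfeldElement_eq_sum hab
  set u := drinfeldElement k R
  -- Convolution of maps $K → K^{op}$. Here $A * B$ sends $x$ to $S(x_2)ux_1 = ε(x)u$, a form of $RΔ
  -- = Δ^{op}R$, and $B * C = 1$; so $A = (A * B) * C$ is $h ↦ S^2(h)u$.
  let o := (MulOpposite.opLinearEquiv k : K ≃ₗ[k] Kᵐᵒᵖ).toLinearMap
  let A : WithConv (K →ₗ[k] Kᵐᵒᵖ) := toConv (o ∘ₗ LinearMap.mulLeft k u)
  let B : WithConv (K →ₗ[k] Kᵐᵒᵖ) := toConv (o ∘ₗ 𝑺)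
  let C : WithConv (K →ₗ[k] Kᵐᵒᵖ) := toConv (o ∘ₗ 𝑺 ∘ₗ 𝑺)
  have hBC : B * C = 1 := by
    ext x
    rw [(ℛ k x).convMul_apply]
    have e := HopfAlgebra.sum_mul_antipode_eq_smul (ℛ k x)
    have e2 := congrArg (fun y => MulOpposite.op (𝑺 y)) e
    simp only [map_sum, HopfAlgebra.antipode_mul_antidistrib, map_smul,
      HopfAlgebra.antipode_one] at e2
    simp only [LinearMap.convOne_apply, Algebra.algebraMap_eq_smul_one]
    rw [MulOpposite.op_smul] at e2
    simpa [B, C, o] using e2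
  have hAB : ∀ x, (A * B) x = MulOpposite.op (ε x • u) := by
    intro x
    rw [(ℛ k x).convMul_apply]
    have e := hR.sum_mul_comul hab (F := fun x y => 𝑺 y * x) {} x
    simp only [HopfAlgebra.antipode_mul_antidistrib] at e
    have e1 : ∀ p i, 𝑺 ((ℛ k x).right p) * 𝑺 (b i) * (a i * (ℛ k x).left p) =
      𝑺 ((ℛ k x).right p) * (𝑺 (b i) * a i) * (ℛ k x).left p := by intros; simp only [mul_assoc]
    have e2 : ∀ p i, 𝑺 (b i) * 𝑺 ((ℛ k x).left p) * ((ℛ k x).right p * a i) =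
      𝑺 (b i) * (𝑺 ((ℛ k x).left p) * (ℛ k x).right p) * a i := by intros; simp only [mul_assoc]
    simp only [e1, e2] at e
    simp only [← Finset.sum_mul, ← Finset.mul_sum, HopfAlgebra.sum_antipode_mul_eq_smul] at e
    rw [Finset.sum_comm] at e
    simp only [← Finset.sum_mul, ← Finset.mul_sum, ← hu] at e
    have e3 : ∀ i, 𝑺 (b i) * ε x • (1 : K) * a i = ε x • (𝑺 (b i) * a i) := by intro i; simp
    simp only [e3, ← Finset.smul_sum, ← hu] at e
    rw [← e]
    simp [A, B, o, mul_assoc]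
  have hA : A = (A * B) * C := by rw [mul_assoc, hBC, mul_one]
  have := LinearMap.congr_fun (congrArg ofConv hA) h
  rw [(ℛ k h).convMul_apply] at this
  simp only [hAB] at this
  have e4 := congrArg MulOpposite.unop this
  simp only [A, C, o] at e4
  simp at e4
  rw [e4]
  conv_lhs => rw [← Coalgebra.sum_counit_smul (ℛ k h)]
  simp [Finset.sum_mul]

/-- `Δ(u) R₂₁ R = u ⊗ u` for the Drinfel'd element `u`. -/
theorem IsRMatrix.comul_drinfeldElement (hR : IsRMatrix k R) :
    δ (drinfeldElement k R) * (flip k R * R) =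
      drinfeldElement k R ⊗ₜ[k] drinfeldElement k R := by
  obtain ⟨n, a, b, hab⟩ := exists_sum_tmul R
  have hu := drinfeldElement_eq_sum hab
  have hS := hR.antipode_sq_mul_drinfeldElement
  set u := drinfeldElement k R with hu'
  set Q : K ⊗[k] K := ∑ i, (𝑺 (b i) * u) ⊗ₜ[k] a i with hQ
  set Ri : K ⊗[k] K := ∑ i, 𝑺 (a i) ⊗ₜ[k] b i with hRi
  -- Replace $R$ by $(S ⊗ S)(R)$ in $Q$ and move the resulting $S^2$ past $u$.
  have hQ1 : Q = (u ⊗ₜ[k] 1) * flip k Ri := by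
    have e := hR.antipode_antipode hab
    have e1 := congrArg (IsBilin.lift (k := k) (F := fun x y : K => (𝑺 y * u) ⊗ₜ[k] x) {}) e
    conv_rhs at e1 => rw [hab]
    simp only [map_sum, IsBilin.lift_tmul, hS] at e1
    rw [hQ, ← e1]
    simp [hRi, Finset.mul_sum]
  have hQ2 : Q * flip k R = u ⊗ₜ[k] 1 := by
    rw [hQ1, mul_assoc, ← flip_mul, hR.antipode_left_mul hab, flip_one, mul_one]
  have hQ3 : flip k Q = (1 ⊗ₜ[k] u) * Ri := by
    rw [hQ1, flip_mul, flip_flip, flip_tmul]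
  have hδS : ∀ x, δ (𝑺 x) =
      ∑ p ∈ (ℛ k x).index, 𝑺 ((ℛ k x).right p) ⊗ₜ[k] 𝑺 ((ℛ k x).left p) := by
    intro x
    rw [comul_antipode]
    conv_lhs => rw [← (ℛ k x).eq]
    simp
  have E1 : ∀ P : K ⊗[k] K, ∑ i, δ (𝑺 (b i)) * P * (a i ⊗ₜ[k] 1) =
      ∑ i, ∑ j, (𝑺 (b i) ⊗ₜ[k] 𝑺 (b j)) * P * ((a i * a j) ⊗ₜ[k] 1) := by
    intro P
    rw [← hR.sum_comul_right hab (F := fun x y z => (𝑺 z ⊗ₜ[k] 𝑺 y) * P * (x ⊗ₜ[k] 1)) {}]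
    simp only [hδS, Finset.sum_mul]
  have E2 : ∀ P : K ⊗[k] K, ∑ i, δ (𝑺 (b i)) * P * (1 ⊗ₜ[k] a i) =
      ∑ i, ∑ j, (𝑺 (b i) ⊗ₜ[k] 𝑺 (b j)) * P * (1 ⊗ₜ[k] (a i * a j)) := by
    intro P
    rw [← hR.sum_comul_right hab (F := fun x y z => (𝑺 z ⊗ₜ[k] 𝑺 y) * P * (1 ⊗ₜ[k] x)) {}]
    simp only [hδS, Finset.sum_mul]
  have h0 : δ u = ∑ j, δ (𝑺 (b j)) * (∑ i, δ (𝑺 (b i)) * 1 * (a i ⊗ₜ[k] 1)) * (1 ⊗ₜ[k] a j) := by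
    have e := hR.sum_comul_left hab (F := fun x y z => δ (𝑺 z) * (x ⊗ₜ[k] y)) {}
    have e1 : ∀ i, ∑ p ∈ (ℛ k (a i)).index, δ (𝑺 (b i)) *
        (((ℛ k (a i)).left p) ⊗ₜ[k] ((ℛ k (a i)).right p)) = δ (𝑺 (b i)) * δ (a i) := by
      intro i
      rw [← Finset.mul_sum, (ℛ k (a i)).eq]
    simp only [e1, ← Bialgebra.comul_mul] at e
    rw [hu, map_sum, e, Finset.sum_comm]
    refine Finset.sum_congr rfl fun j _ => ?_
    rw [Finset.mul_sum, Finset.sum_mul]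
    refine Finset.sum_congr rfl fun i _ => ?_
    rw [HopfAlgebra.antipode_mul_antidistrib, Bialgebra.comul_mul]
    simp [mul_assoc]
  -- Expanding $Δ(S(b)a)$ with both hexagon axioms leaves four copies of $R$; the two innermost ones
  -- combine to $Q$.
  have h1 : δ u = ∑ l, ∑ m, (1 ⊗ₜ[k] 𝑺 (b l * b m)) * Q * (a l ⊗ₜ[k] a m) := by
    rw [h0, E1 1, E2]
    have hl : ∀ j m, (𝑺 (b j) ⊗ₜ[k] 𝑺 (b m)) * (∑ i, ∑ l, (𝑺 (b i) ⊗ₜ[k] 𝑺 (b l)) * 1 *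
          ((a i * a l) ⊗ₜ[k] 1)) * (1 ⊗ₜ[k] (a j * a m)) =
        ∑ i, ∑ l, (𝑺 (b j) * (𝑺 (b i) * (a i * a l))) ⊗ₜ[k] (𝑺 (b m) * (𝑺 (b l) * (a j * a m))) := by
      intro j m
      simp [Finset.mul_sum, Finset.sum_mul, mul_assoc]
    have hr : ∀ l m, (1 ⊗ₜ[k] 𝑺 (b l * b m)) * Q * (a l ⊗ₜ[k] a m) =
        ∑ j, ∑ i, (𝑺 (b j) * (𝑺 (b i) * (a i * a l))) ⊗ₜ[k]
          (𝑺 (b m) * (𝑺 (b l) * (a j * a m))) := by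
      intro l m
      simp [hQ, hu, Finset.mul_sum, Finset.sum_mul, TensorProduct.sum_tmul, mul_assoc,
        HopfAlgebra.antipode_mul_antidistrib]
    simp only [hl, hr]
    rw [Finset.sum_comm]
    conv_rhs => rw [Finset.sum_comm]
    refine Finset.sum_congr rfl fun m _ => ?_
    conv_rhs => rw [Finset.sum_comm]
    exact Finset.sum_congr rfl fun j _ => Finset.sum_comm
  -- The Yang-Baxter equation moves $R_{21}$ next to $Q$, where $QR_{21} = u ⊗ 1$ applies.
  have h2 : δ u * flip k R = (u ⊗ₜ[k] 1) * flip k Q := by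
    have e := hR.yangBaxter hab (F := fun x y z => (1 ⊗ₜ[k] 𝑺 z) * Q * (y ⊗ₜ[k] x)) {}
    have e1 : δ u * flip k R =
        ∑ i, ∑ j, ∑ l, (1 ⊗ₜ[k] 𝑺 (b i * b j)) * Q * ((a i * b l) ⊗ₜ[k] (a j * a l)) := by
      have e0 : flip k R = ∑ l, b l ⊗ₜ[k] a l := by rw [hab]; simp
      rw [h1, e0]
      simp only [Finset.sum_mul]
      refine Finset.sum_congr rfl fun i _ => Finset.sum_congr rfl fun j _ => ?_
      simp [Finset.mul_sum, mul_assoc]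
    rw [e1, ← e]
    have e2 : ∀ i j l, (1 ⊗ₜ[k] 𝑺 (b i * b j)) * Q * ((b l * a j) ⊗ₜ[k] (a l * a i)) =
      (1 ⊗ₜ[k] 𝑺 (b i * b j)) * (Q * b l ⊗ₜ[k] a l) * (a j ⊗ₜ[k] a i) := by
      intro i j l
      simp [mul_assoc]
    have e3 : ∑ l, Q * b l ⊗ₜ[k] a l = u ⊗ₜ[k] 1 := by
      rw [← hQ2, hab]
      simp [Finset.mul_sum]
    simp only [e2, ← Finset.mul_sum, ← Finset.sum_mul, e3]
    rw [Finset.sum_comm, hQ, map_sum, Finset.mul_sum]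
    refine Finset.sum_congr rfl fun j _ => ?_
    simp only [hu, HopfAlgebra.antipode_mul_antidistrib, flip_tmul,
      Algebra.TensorProduct.tmul_mul_tmul, one_mul, mul_one, mul_assoc, Finset.mul_sum,
      TensorProduct.tmul_sum]
  rw [← mul_assoc, h2, hQ3, mul_assoc, mul_assoc, hR.antipode_left_mul hab, mul_one]
  simp

/-- A quasitriangular Hopf algebra with a ribbon element has a group-like element implementing
the square of the antipode. -/
theorem IsRMatrix.exists_isGroupLikeElem (hR : IsRMatrix k R) {ν : K}
    (hν : IsRibbonElement k R ν) :
    ∃ g : K, IsGroupLikeElem k g ∧ ∀ h, 𝑺 (𝑺 h) * g = g * h := by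
  obtain ⟨v, hv⟩ := hν.isUnit
  have hc : ∀ h, h * (↑v⁻¹ : K) = ↑v⁻¹ * h := by
    intro h
    have := hν.central h
    rw [← hv] at this
    rw [Units.mul_inv_eq_iff_eq_mul, mul_assoc, ← this, Units.inv_mul_cancel_left]
  set u := drinfeldElement k R with hu
  have hgν : u * (↑v⁻¹ : K) * ν = u := by rw [← hv, Units.inv_mul_cancel_right]
  have hεu : ε u = 1 := by
    obtain ⟨n, a, b, hab⟩ := exists_sum_tmul R
    have e := congrArg ε (hR.sum_counit_left hab)
    rw [hu, drinfeldElement_eq_sum hab, map_sum]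
    simpa [mul_comm] using e
  -- This allows $R_{21}RΔ(ν) = ν ⊗ ν$ to be used inside $Δ(u)R_{21}R = u ⊗ u$.
  have hcomm : (flip k R * R) * δ ν = δ ν * (flip k R * R) := by
    have e := hR.mul_comul ν
    have e2 := congrArg (flip k) e
    rw [flip_mul, flip_mul, flip_flip] at e2
    rw [mul_assoc, e, ← mul_assoc, e2, mul_assoc]
  -- The element is $g = uν^{-1}$. Since $ν$ is central, $g$ implements $S^2$ just as $u$ does.
  refine ⟨u * ↑v⁻¹, ⟨?_, ?_⟩, ?_⟩
  · have e := congrArg ε hgν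
    rw [Bialgebra.counit_mul, hν.counit, mul_one] at e
    rw [e, hεu]
  · have e := hR.comul_drinfeldElement
    rw [← hu] at e
    conv_lhs at e => rw [← hgν]
    rw [Bialgebra.comul_mul, mul_assoc, ← hcomm, hν.comul] at e
    have e2 : (u ⊗ₜ[k] u) = ((u * ↑v⁻¹) ⊗ₜ[k] (u * ↑v⁻¹)) * (ν ⊗ₜ[k] ν) := by
      rw [Algebra.TensorProduct.tmul_mul_tmul, hgν]
    have hun : IsUnit (ν ⊗ₜ[k] ν) :=
      ⟨⟨ν ⊗ₜ[k] ν, (↑v⁻¹ : K) ⊗ₜ[k] (↑v⁻¹ : K), by simp [← hv, Algebra.TensorProduct.one_def],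
        by simp [← hv, Algebra.TensorProduct.one_def]⟩, rfl⟩
    exact hun.mul_right_cancel (e.trans e2)
  · intro h
    rw [← mul_assoc, hR.antipode_sq_mul_drinfeldElement, mul_assoc, mul_assoc, hc]

/-- Group-like elements of a finite-dimensional Hopf algebra have finite order. -/
theorem exists_pow_eq_one [Module.Finite k K] {g : K} (hg : IsGroupLikeElem k g) :
    ∃ N, 0 < N ∧ g ^ N = 1 := by
  -- Group-like elements are linearly independent, so there are finitely many and two powers of $g$
  -- coincide.
  have hfin : {a : K | IsGroupLikeElem k a}.Finite :=
    (linearIndepOn_isGroupLikeElem (R := k) (A := K)).linearIndependent.setFinite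
  have hmem : ∀ n : ℕ, g ^ n ∈ {a : K | IsGroupLikeElem k a} := fun n => hg.pow
  obtain ⟨m, n, hmn, h⟩ : ∃ m n : ℕ, m < n ∧ g ^ m = g ^ n := by
    obtain ⟨m, n, h1, h2⟩ := hfin.exists_lt_map_eq_of_forall_mem hmem
    exact ⟨m, n, h1, h2⟩
  refine ⟨n - m, by omega, ?_⟩
  have h1 : g ^ m * g ^ (n - m) = g ^ m * 1 := by
    rw [← pow_add, mul_one, h]; congr 1; omega
  exact (hg.isUnit.pow m).mul_left_cancel h1

end Drinfeld

/-! ### Sums of roots of unity and diagonalisation of operators of finite order. -/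

section RootsOfUnity

/-- The field $F$ itself need not embed into $ℂ$. A number field containing the relevant roots of
unity does, and it also has a norm to $ℚ$. -/
theorem exists_numberField_rootsOfUnity (F : Type*) [Field F] [CharZero F] {N : ℕ} (hN : 0 < N) :
    ∃ L : IntermediateField ℚ F, NumberField L ∧ ∀ x : F, x ^ N = 1 → x ∈ L := by
  have hfin : {x : F | x ^ N = 1}.Finite := by
    classical
    refine (Polynomial.nthRoots N (1 : F)).toFinset.finite_toSet.subset fun x hx => ?_
    simpa [Polynomial.mem_nthRoots hN] using hx
  have hint : ∀ x ∈ {x : F | x ^ N = 1}, IsIntegral ℚ x := fun x hx =>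
    IsIntegral.of_pow hN (by rw [hx]; exact isIntegral_one)
  have : Finite {x : F | x ^ N = 1} := hfin
  have : FiniteDimensional ℚ (IntermediateField.adjoin ℚ {x : F | x ^ N = 1}) :=
    IntermediateField.finiteDimensional_adjoin hint
  exact ⟨IntermediateField.adjoin ℚ {x : F | x ^ N = 1}, ⟨⟩,
    fun x hx => IntermediateField.subset_adjoin _ _ hx⟩

theorem norm_eq_one_of_map_pow {L : Type*} [Field L] (φ : L →+* ℂ) {N : ℕ} (hN : 0 < N) {x : L}
    (hx : x ^ N = 1) : ‖φ x‖ = 1 :=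
  Complex.norm_eq_one_of_pow_eq_one (by rw [← map_pow, hx, map_one]) hN.ne'

/-- If the mean value of finitely many roots of unity is a nonzero algebraic integer, then these
roots of unity are all equal. -/
theorem rootsOfUnity_eq_of_isIntegral_mean {F : Type*} [Field F] [CharZero F] {N : ℕ} (hN : 0 < N)
    {ι : Type*} [Fintype ι] (μ : ι → F) (hμ : ∀ i, μ i ^ N = 1) {τ : F}
    (hτ : IsIntegral ℤ τ) (hτ0 : τ ≠ 0) (hsum : (Fintype.card ι : F) * τ = ∑ i, μ i) (i j : ι) :
    μ i = μ j := by
  obtain ⟨L, hL, hmem⟩ := exists_numberField_rootsOfUnity F hN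
  have hn : (Fintype.card ι : F) ≠ 0 := by
    have : Nonempty ι := ⟨i⟩
    exact_mod_cast Fintype.card_ne_zero
  let m : ι → L := fun i => ⟨μ i, hmem _ (hμ i)⟩
  have hm : ∀ i, m i ^ N = 1 := fun i => Subtype.ext (by simpa [m] using hμ i)
  let t : L := (∑ i, m i) / (Fintype.card ι : L)
  have htF : (t : F) = τ := by
    have : (t : F) = (∑ i, μ i) / (Fintype.card ι : F) := by simp [t, m]
    rw [this, ← hsum, mul_div_cancel_left₀ _ hn]
  have ht : IsIntegral ℤ t := by
    rw [← isIntegral_algebraMap_iff (algebraMap L F).injective]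
    rw [← htF] at hτ
    exact hτ
  have ht0 : t ≠ 0 := by
    rintro h
    exact hτ0 (by rw [← htF, h]; rfl)
  have hnc : (0 : ℝ) < Fintype.card ι := by
    have : Nonempty ι := ⟨i⟩
    exact_mod_cast Fintype.card_pos
  have hmul : ∀ φ : L →+* ℂ, (Fintype.card ι : ℂ) * φ t = ∑ i, φ (m i) := by
    intro φ
    rw [← map_sum, ← map_natCast φ, ← map_mul]
    congr 1
    exact mul_div_cancel₀ _ (by
      have : (Fintype.card ι : ℝ) ≠ 0 := hnc.ne'
      exact_mod_cast this)
  -- Triangle inequality: each conjugate of the mean is again a mean of complex numbers of modulus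
  -- one.
  have hle : ∀ φ : L →+* ℂ, ‖φ t‖ ≤ 1 := by
    intro φ
    have h1 : ‖∑ i, φ (m i)‖ ≤ Fintype.card ι := by
      refine (norm_sum_le _ _).trans ?_
      simp [norm_eq_one_of_map_pow φ hN (hm _)]
    rw [← hmul, norm_mul] at h1
    simp only [Complex.norm_natCast] at h1
    exact le_of_mul_le_mul_left (by simpa using h1) hnc
  -- The norm of a nonzero algebraic integer is a nonzero rational integer. As no conjugate exceeds
  -- one in modulus, all have modulus one.
  have hprod : 1 ≤ ∏ φ : L →ₐ[ℚ] ℂ, ‖φ t‖ := by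
    have h1 := Algebra.norm_eq_prod_embeddings ℚ ℂ t
    obtain ⟨z, hz⟩ := IsIntegrallyClosed.isIntegral_iff.1 (Algebra.isIntegral_norm ℚ ht)
    rw [← norm_prod, ← h1, ← hz]
    have hz0 : z ≠ 0 := by
      rintro rfl
      rw [map_zero] at hz
      exact ht0 (Algebra.norm_eq_zero_iff.1 hz.symm)
    have : (1 : ℝ) ≤ |(z : ℝ)| := by exact_mod_cast Int.one_le_abs hz0
    simpa using this
  obtain ⟨φ⟩ : Nonempty (L →ₐ[ℚ] ℂ) :=
    (inferInstance : Nonempty (L →+* ℂ)).map fun φ => φ.toRatAlgHom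
  have heq : ‖φ t‖ = 1 := by
    classical
    refine le_antisymm (hle φ) ?_
    rw [← Finset.mul_prod_erase _ _ (Finset.mem_univ φ)] at hprod
    have h2 : ∏ ψ ∈ Finset.univ.erase φ, ‖ψ t‖ ≤ 1 :=
      Finset.prod_le_one (fun _ _ => norm_nonneg _) fun ψ _ => hle ψ
    nlinarith [norm_nonneg (φ t)]
  -- Equality in the triangle inequality: the nonnegative numbers $1 -
  -- \mathrm{Re}(φ(m_l)\overline{φ(t)})$ have sum zero.
  have hre : ∀ l, (φ (m l)) = φ t := by
    have hunit : ∀ l, ‖φ (m l)‖ = 1 := fun l => norm_eq_one_of_map_pow (φ : L →+* ℂ) hN (hm l)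
    have hs : ∑ l, (1 - (φ (m l) * star (φ t)).re) = 0 := by
      have h1 := congrArg (fun z => (z * star (φ t)).re) (hmul φ)
      have h2 : φ t * star (φ t) = 1 := by
        rw [Complex.star_def, Complex.mul_conj, Complex.normSq_eq_norm_sq, heq]; simp
      simp only [Finset.sum_mul, Complex.re_sum] at h1
      rw [Finset.sum_sub_distrib]
      simp only [Finset.sum_const, Finset.card_univ, nsmul_eq_mul, mul_one]
      rw [sub_eq_zero, ← AlgHom.coe_toRingHom] at *
      rw [← h1, mul_assoc]
      simp only [AlgHom.coe_toRingHom] at *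
      rw [h2]; simp
    have hnn : ∀ l ∈ Finset.univ, 0 ≤ 1 - (φ (m l) * star (φ t)).re := by
      intro l _
      have := Complex.re_le_norm (φ (m l) * star (φ t))
      rw [norm_mul, norm_star, hunit, heq] at this
      linarith
    intro l
    have h3 := (Finset.sum_eq_zero_iff_of_nonneg hnn).1 hs l (Finset.mem_univ l)
    have h4 : ‖φ (m l) - φ t‖ ^ 2 = 0 := by
      rw [← Complex.normSq_eq_norm_sq, Complex.normSq_sub, Complex.normSq_eq_norm_sq,
        Complex.normSq_eq_norm_sq, hunit, heq]
      rw [Complex.star_def] at h3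
      linarith
    have h5 := pow_eq_zero_iff (two_ne_zero) |>.1 h4
    exact sub_eq_zero.1 (norm_eq_zero.1 h5)
  have hij : m i = m j := φ.injective ((hre i).trans (hre j).symm)
  exact congrArg Subtype.val hij

/-- Under a complex embedding $μ^{N-1} = μ^{-1}$ becomes the conjugate of $μ$, so the hypothesis is
that a sum of squared absolute values vanishes. -/
theorem sum_rootsOfUnity_eq_zero {F : Type*} [Field F] [CharZero F] {N : ℕ} (hN : 0 < N)
    {B : Type*} [Fintype B] {ι : B → Type*} [∀ b, Fintype (ι b)] (μ : ∀ b, ι b → F)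
    (hμ : ∀ b i, μ b i ^ N = 1)
    (h0 : ∑ b, (∑ i, μ b i) * (∑ i, μ b i ^ (N - 1)) = 0) (b : B) : ∑ i, μ b i = 0 := by
  obtain ⟨L, hL, hmem⟩ := exists_numberField_rootsOfUnity F hN
  let m : ∀ b, ι b → L := fun b i => ⟨μ b i, hmem _ (hμ b i)⟩
  have hm : ∀ b i, m b i ^ N = 1 := fun b i => Subtype.ext (by simpa [m] using hμ b i)
  have h0' : ∑ b, (∑ i, m b i) * (∑ i, m b i ^ (N - 1)) = 0 :=
    Subtype.ext (by simpa [m] using h0)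
  obtain ⟨φ⟩ : Nonempty (L →ₐ[ℚ] ℂ) :=
    (inferInstance : Nonempty (L →+* ℂ)).map fun φ => φ.toRatAlgHom
  have hstar : ∀ b i, φ (m b i ^ (N - 1)) = star (φ (m b i)) := by
    intro b i
    have h1 : φ (m b i) * φ (m b i ^ (N - 1)) = 1 := by
      rw [← map_mul, ← pow_succ', Nat.sub_add_cancel hN, hm, map_one]
    have h2 : φ (m b i) * star (φ (m b i)) = 1 := by
      have h3 : ‖φ (m b i)‖ = 1 := norm_eq_one_of_map_pow (φ : L →+* ℂ) hN (hm b i)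
      rw [Complex.star_def, Complex.mul_conj, Complex.normSq_eq_norm_sq, h3]; simp
    exact mul_left_cancel₀ (left_ne_zero_of_mul_eq_one h1) (h1.trans h2.symm)
  have h1 := congrArg φ h0'
  have h2 : ∀ b, φ ((∑ i, m b i) * (∑ i, m b i ^ (N - 1))) =
      ((‖φ (∑ i, m b i)‖ ^ 2 : ℝ) : ℂ) := by
    intro b
    rw [map_mul, map_sum _ (fun i => m b i ^ (N - 1)), Finset.sum_congr rfl fun i _ => hstar b i,
      ← star_sum, ← map_sum, Complex.star_def, Complex.mul_conj, Complex.normSq_eq_norm_sq]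
  rw [map_sum, Finset.sum_congr rfl fun b _ => h2 b, map_zero, ← Complex.ofReal_sum,
    Complex.ofReal_eq_zero] at h1
  have h3 := (Finset.sum_eq_zero_iff_of_nonneg fun b _ => by positivity).1 h1 b (Finset.mem_univ b)
  have h4 := norm_eq_zero.1 ((pow_eq_zero_iff two_ne_zero).1 h3)
  have h5 : ∑ i, m b i = 0 := φ.injective (h4.trans (map_zero φ).symm)
  simpa [m] using congrArg Subtype.val h5

/-- An endomorphism of finite order of a finite-dimensional vector space over an algebraically
closed field of characteristic zero is diagonalisable. -/
theorem exists_eigenbasis_of_pow_eq_one {F V : Type*} [Field F] [CharZero F] [IsAlgClosed F]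
    [AddCommGroup V] [Module F V] [FiniteDimensional F V] (A : Module.End F V) {N : ℕ}
    (hN : 0 < N) (hA : A ^ N = 1) :
    ∃ (v : Module.Basis (Fin (Module.finrank F V)) F V) (μ : Fin (Module.finrank F V) → F),
      ∀ i, A (v i) = μ i • v i ∧ μ i ^ N = 1 := by
  have hss : A.IsSemisimple := by
    -- The polynomial $X^N - 1$ annihilates $A$ and is separable in characteristic zero.
    have hsep := Polynomial.separable_X_pow_sub_C (F := F) (n := N) 1
      (by exact_mod_cast hN.ne') one_ne_zero
    exact Module.End.isSemisimple_of_squarefree_aeval_eq_zero hsep.squarefree (by simp [hA])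
  have htop := hss.iSup_eigenspace_eq_top
  have hspan : ⊤ ≤ Submodule.span F {x : V | ∃ μ : F, A x = μ • x} := by
    rw [← htop]
    exact iSup_le fun μ x hx => Submodule.subset_span ⟨μ, Module.End.mem_eigenspace_iff.1 hx⟩
  let v0 := Module.Basis.ofSpan hspan
  have hv0 : ∀ i, ∃ μ : F, A (v0 i) = μ • v0 i := fun i =>
    Module.Basis.ofSpan_subset hspan ⟨i, rfl⟩
  have : Fintype _ := FiniteDimensional.fintypeBasisIndex v0
  let e := (Fintype.equivFinOfCardEq (Module.finrank_eq_card_basis v0).symm)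
  choose μ hμ using hv0
  refine ⟨v0.reindex e, fun i => μ (e.symm i), fun i => ⟨by simp [hμ], ?_⟩⟩
  have hp : ∀ m : ℕ, (A ^ m) (v0 (e.symm i)) = μ (e.symm i) ^ m • v0 (e.symm i) := by
    intro m
    induction m with
    | zero => simp
    | succ m ih => rw [pow_succ', Module.End.mul_apply, ih, map_smul, hμ, smul_smul, pow_succ]
  have h1 := hp N
  rw [hA, Module.End.one_apply] at h1
  have h2 : (μ (e.symm i) ^ N - 1) • v0 (e.symm i) = 0 := by rw [sub_smul, ← h1, one_smul, sub_self]
  exact sub_eq_zero.1 ((smul_eq_zero.1 h2).resolve_right (v0.ne_zero _))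

theorem trace_eq_sum_of_eigenbasis {F V ι : Type*} [Field F] [AddCommGroup V] [Module F V]
    [Fintype ι] (A : Module.End F V) (v : Module.Basis ι F V) (μ : ι → F)
    (h : ∀ i, A (v i) = μ i • v i) : LinearMap.trace F V A = ∑ i, μ i := by
  classical
  rw [LinearMap.trace_eq_matrix_trace F v, Matrix.trace]
  simp [LinearMap.toMatrix_apply, h]

end RootsOfUnity

/-! ### Traces of twisted operators and the regular character. -/

section TraceFormula

variable {k K : Type*} [Field k] [Ring K] [HopfAlgebra k K]

local notation "δ" => Coalgebra.comul (R := k) (A := K)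
local notation "ε" => Coalgebra.counit (R := k) (A := K)
local notation "𝑺" => HopfAlgebra.antipode k (A := K)

variable (k K) in
/-- The square of the antipode as an algebra homomorphism. -/
def antipodeSq : K →ₐ[k] K :=
  AlgHom.ofLinearMap (𝑺 ∘ₗ 𝑺) (by simp) (by simp [HopfAlgebra.antipode_mul_antidistrib])

@[simp]
theorem antipodeSq_apply (x : K) : antipodeSq k K x = 𝑺 (𝑺 x) := rfl

/-- The operator `x ↦ β(x₁) f(x₂)`. -/
def twistedBy (β : K →ₗ[k] k) (f : K →ₗ[k] K) : K →ₗ[k] K :=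
  TensorProduct.lift ((LinearMap.lsmul k K).compl₁₂ β f) ∘ₗ δ

theorem twistedBy_apply (β : K →ₗ[k] k) (f : K →ₗ[k] K) (x : K) :
    twistedBy β f x = ∑ p ∈ (ℛ k x).index, β ((ℛ k x).left p) • f ((ℛ k x).right p) := by
  simp only [twistedBy, LinearMap.comp_apply]
  conv_lhs => rw [← (ℛ k x).eq]
  simp

theorem twistedBy_eq_conv (β : K →ₗ[k] k) (f : K →ₗ[k] K) :
    toConv (twistedBy β f) =
      (toConv (Algebra.linearMap k K ∘ₗ β) * toConv f : WithConv (K →ₗ[k] K)) := by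
  ext x
  rw [(ℛ k x).convMul_apply]
  exact (twistedBy_apply β f x).trans (by simp [Algebra.smul_def])

theorem twistedBy_counit (f : K →ₗ[k] K) : twistedBy ε f = f := by
  apply WithConv.toConv_injective
  rw [twistedBy_eq_conv]
  exact one_mul _

theorem comp_twistedBy (g f : K →ₗ[k] K) (β : K →ₗ[k] k) :
    g ∘ₗ twistedBy β f = twistedBy β (g ∘ₗ f) := by
  ext x
  simp [twistedBy_apply]

/-- The convolution of linear forms. -/
def formConv (β γ : K →ₗ[k] k) : K →ₗ[k] k :=
  LinearMap.mul' k k ∘ₗ TensorProduct.map β γ ∘ₗ δ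

theorem twistedBy_twistedBy (β γ : K →ₗ[k] k) (f : K →ₗ[k] K) :
    twistedBy β (twistedBy γ f) = twistedBy (formConv β γ) f := by
  apply WithConv.toConv_injective
  rw [twistedBy_eq_conv, twistedBy_eq_conv, twistedBy_eq_conv, ← mul_assoc]
  congr 1
  have := LinearMap.algHom_comp_convMul_distrib (Algebra.ofId k K) (toConv β) (toConv γ)
  exact (congrArg toConv this).symm

/-- The product of the twisted operator and the left multiplications. -/
theorem twistedBy_antipode_mul (β : K →ₗ[k] k) (c x : K) :
    ∑ p ∈ (ℛ k c).index, antipodeSq k K ((ℛ k c).left p) *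
        twistedBy β (antipodeSq k K).toLinearMap (𝑺 ((ℛ k c).right p) * x) =
      twistedBy (β ∘ₗ LinearMap.mulLeft k (𝑺 c)) (antipodeSq k K).toLinearMap x := by
  set T := antipodeSq k K
  have hTS : (toConv T.toLinearMap * toConv (T.toLinearMap ∘ₗ 𝑺) : WithConv (K →ₗ[k] K)) = 1 := by
    have := LinearMap.algHom_comp_convMul_distrib T (toConv (LinearMap.id (M := K))) (toConv 𝑺)
    rw [LinearMap.id_mul_antipode] at this
    simp only [LinearMap.comp_id] at this
    apply WithConv.ofConv_injective
    rw [← this]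
    ext h
    simp [LinearMap.convOne_def]
  let f : K → (K →ₗ[k] K) := fun y => Algebra.linearMap k K ∘ₗ β ∘ₗ LinearMap.mulRight k y ∘ₗ 𝑺
  -- Since $Δ(S(d)) = S(d_2) ⊗ S(d_1)$, the value is $β(S(d_2)x_1)\,T(S(d_1))\,T(x_2)$; the middle
  -- factor is a convolution inverse of $T$ and cancels against $T(c_1)$.
  have key : ∀ d, twistedBy β T.toLinearMap (𝑺 d * x) = ∑ q ∈ (ℛ k x).index,
      (toConv (T.toLinearMap ∘ₗ 𝑺) * toConv (f ((ℛ k x).left q)) : WithConv (K →ₗ[k] K)) d *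
        T ((ℛ k x).right q) := by
    intro d
    simp only [twistedBy, LinearMap.comp_apply, Bialgebra.comul_mul, comul_antipode]
    conv_lhs => rw [← (ℛ k x).eq, ← (ℛ k d).eq]
    simp only [(ℛ k d).convMul_apply]
    simp only [map_sum, flip_tmul, TensorProduct.map_tmul, Finset.sum_mul_sum,
      Algebra.TensorProduct.tmul_mul_tmul, TensorProduct.lift.tmul]
    rw [Finset.sum_comm]
    refine Finset.sum_congr rfl fun q _ => ?_
    rw [Finset.sum_mul]
    refine Finset.sum_congr rfl fun p _ => ?_
    simp only [f, LinearMap.compl₁₂_apply, LinearMap.lsmul_apply, LinearMap.comp_apply,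
      LinearMap.mulRight_apply, Algebra.linearMap_apply, AlgHom.toLinearMap_apply, map_mul]
    rw [Algebra.smul_def, ← Algebra.commutes, mul_assoc]
  have h1 : ∀ q, ∑ p ∈ (ℛ k c).index, T ((ℛ k c).left p) *
      ((toConv (T.toLinearMap ∘ₗ 𝑺) * toConv (f ((ℛ k x).left q)) : WithConv (K →ₗ[k] K))
        ((ℛ k c).right p) * T ((ℛ k x).right q)) = f ((ℛ k x).left q) c * T ((ℛ k x).right q) := by
    intro q
    have e : (toConv T.toLinearMap * (toConv (T.toLinearMap ∘ₗ 𝑺) *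
        toConv (f ((ℛ k x).left q))) : WithConv (K →ₗ[k] K)) c = f ((ℛ k x).left q) c := by
      rw [← mul_assoc, hTS, one_mul]
    rw [← e, (ℛ k c).convMul_apply, Finset.sum_mul]
    simp only [mul_assoc]
    rfl
  simp only [key, Finset.mul_sum]
  rw [Finset.sum_comm]
  simp only [h1]
  rw [twistedBy_apply]
  simp [f, Algebra.smul_def]

variable [Module.Finite k K]

/-- By `twistedBy_antipode_mul` the left operator is $\sum L_{S^2(c_1)} W L_{S(c_2)}$. Cyclicity of
the trace brings together $\sum S(c_2)S^2(c_1) = S(\sum S(c_1)c_2) = ε(c)$. -/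
theorem trace_twistedBy_mulLeft (β : K →ₗ[k] k) (c : K) :
    LinearMap.trace k K (twistedBy (β ∘ₗ LinearMap.mulLeft k (𝑺 c)) (antipodeSq k K).toLinearMap) =
      ε c * LinearMap.trace k K (twistedBy β (antipodeSq k K).toLinearMap) := by
  set W := twistedBy β (antipodeSq k K).toLinearMap
  have h : twistedBy (β ∘ₗ LinearMap.mulLeft k (𝑺 c)) (antipodeSq k K).toLinearMap =
      ∑ p ∈ (ℛ k c).index, LinearMap.mulLeft k (antipodeSq k K ((ℛ k c).left p)) *
        (W * LinearMap.mulLeft k (𝑺 ((ℛ k c).right p))) := by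
    ext x
    rw [← twistedBy_antipode_mul]
    simp [W]
  have h2 : ∑ p ∈ (ℛ k c).index, 𝑺 ((ℛ k c).right p) * antipodeSq k K ((ℛ k c).left p) =
      ε c • 1 := by
    have := congrArg 𝑺 (HopfAlgebra.sum_antipode_mul_eq_smul (ℛ k c))
    simpa [HopfAlgebra.antipode_mul_antidistrib] using this
  rw [h, map_sum]
  have h3 : ∀ p, LinearMap.trace k K (LinearMap.mulLeft k (antipodeSq k K ((ℛ k c).left p)) *
        (W * LinearMap.mulLeft k (𝑺 ((ℛ k c).right p)))) = LinearMap.trace k K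
        (W * LinearMap.mulLeft k (𝑺 ((ℛ k c).right p) * antipodeSq k K ((ℛ k c).left p))) := by
    intro p
    rw [LinearMap.trace_mul_comm, mul_assoc, LinearMap.mulLeft_mul]
    rfl
  have h4 : ∑ p ∈ (ℛ k c).index, W * LinearMap.mulLeft k
      (𝑺 ((ℛ k c).right p) * antipodeSq k K ((ℛ k c).left p)) = ε c • W := by
    have := congrArg (fun y => W * LinearMap.mulLeft k y) h2
    ext x
    have := DFunLike.congr_fun this x
    simpa [Finset.sum_mul, mul_assoc] using this
  simp only [h3]
  rw [← map_sum, h4, map_smul, smul_eq_mul]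

/-- The trace of `x ↦ β(x₁) S²(x₂)` is `Tr(S²) β(ℓ)`. -/
theorem trace_twistedBy {ℓ : K} (hℓ : IsHaarIntegral k ℓ) (hS : Function.Surjective 𝑺)
    (β : K →ₗ[k] k) :
    LinearMap.trace k K (twistedBy β (antipodeSq k K).toLinearMap) =
      LinearMap.trace k K (antipodeSq k K).toLinearMap * β ℓ := by
  -- As a functional on $K^*$ the trace is evaluation at some $Λ ∈ K$. The previous lemma makes $Λ$
  -- a left integral, so $Λ = ε(Λ)ℓ$, and $β = ε$ shows $ε(Λ) = \mathrm{Tr}(S^2)$.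
  let tr : Module.Dual k (Module.Dual k K) :=
    { toFun := fun β => LinearMap.trace k K (twistedBy β (antipodeSq k K).toLinearMap)
      map_add' := fun a b => by
        rw [← map_add]; congr 1; ext x; simp [twistedBy_apply, add_smul, Finset.sum_add_distrib]
      map_smul' := fun r a => by
        rw [← map_smul]; congr 1; ext x; simp [twistedBy_apply, Finset.smul_sum, smul_smul] }
  obtain ⟨Λ, hΛ⟩ := (Module.evalEquiv k K).surjective tr
  have hΛ' : ∀ β : K →ₗ[k] k,
      β Λ = LinearMap.trace k K (twistedBy β (antipodeSq k K).toLinearMap) := fun β =>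
    DFunLike.congr_fun hΛ β
  have h1 : ∀ h, h * Λ = ε h • Λ := by
    intro h
    obtain ⟨c, rfl⟩ := hS h
    rw [← sub_eq_zero, ← Module.forall_dual_apply_eq_zero_iff k]
    intro β
    rw [map_sub, map_smul, hΛ' β, smul_eq_mul, HopfAlgebra.counit_antipode,
      ← trace_twistedBy_mulLeft, ← hΛ', sub_eq_zero]
    rfl
  have h2 : Λ = ε Λ • ℓ := by
    rw [← hℓ.mul_right, h1, hℓ.counit, one_smul]
  rw [← hΛ' β]
  conv_lhs => rw [h2]
  rw [map_smul, smul_eq_mul, hΛ' ε, twistedBy_counit]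

/-- The character of the regular representation. -/
def regChar : K →ₗ[k] k := LinearMap.trace k K ∘ₗ LinearMap.mul k K

theorem regChar_apply (x : K) : regChar (k := k) x = LinearMap.trace k K (LinearMap.mulLeft k x) :=
  rfl

/-- Left multiplication by $ℓ$ has rank one: it is $x ↦ ε(x)ℓ$. -/
theorem regChar_haar {ℓ : K} (hℓ : IsHaarIntegral k ℓ) : regChar (k := k) ℓ = 1 := by
  have : LinearMap.mulLeft k ℓ = LinearMap.smulRight ε ℓ := by
    ext x; simp [hℓ.mul_right]
  rw [regChar_apply, this, LinearMap.trace_smulRight, hℓ.counit]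

/-- The map $a ⊗ b ↦ Δ(a)(1 ⊗ b)$ is an isomorphism with inverse $a ⊗ b ↦ (\mathrm{id} ⊗ S)(Δ(a))(1
⊗ b)$, and it intertwines the action of $x$ on the first factor with the diagonal action. So the
tensor square of the regular module is free of rank $\dim K$. -/
theorem formConv_regChar :
    formConv (regChar (k := k) (K := K)) regChar = (Module.finrank k K : k) • regChar := by
  have hx : ∀ x, LinearMap.mulLeft k (δ x) = ∑ p ∈ (ℛ k x).index,
      TensorProduct.map (LinearMap.mulLeft k ((ℛ k x).left p))
        (LinearMap.mulLeft k ((ℛ k x).right p)) := by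
    intro x
    rw [← (ℛ k x).eq]
    ext a b
    simp [Finset.sum_mul]
  let Φ : Module.End k (K ⊗[k] K) :=
    TensorProduct.lift ((LinearMap.mul k (K ⊗[k] K)).compl₁₂ δ (TensorProduct.mk k K K 1))
  let Ψ : Module.End k (K ⊗[k] K) :=
    TensorProduct.lift ((LinearMap.mul k (K ⊗[k] K)).compl₁₂ (LinearMap.lTensor K 𝑺 ∘ₗ δ)
      (TensorProduct.mk k K K 1))
  have hΨΦ : Ψ * Φ = 1 := by
    let i1 := (Algebra.TensorProduct.includeLeft (R := k) (S := k) (A := K) (B := K))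
    let i2 := (Algebra.TensorProduct.includeRight (R := k) (A := K) (B := K))
    have e1 : (toConv (LinearMap.lTensor K 𝑺 ∘ₗ δ) : WithConv (K →ₗ[k] K ⊗[k] K)) =
        toConv i1.toLinearMap * toConv (i2.toLinearMap ∘ₗ 𝑺) := by
      ext x
      rw [(ℛ k x).convMul_apply]
      change LinearMap.lTensor K 𝑺 (δ x) = _
      rw [← (ℛ k x).eq]
      simp [i1, i2]
    have e2 : (toConv (LinearMap.lTensor K 𝑺 ∘ₗ δ) * toConv i2.toLinearMap :
        WithConv (K →ₗ[k] K ⊗[k] K)) = toConv i1.toLinearMap := by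
      rw [e1, mul_assoc, algHom_antipode_conv, mul_one]
    ext x y
    have e3 := LinearMap.congr_fun (congrArg ofConv e2) x
    rw [(ℛ k x).convMul_apply] at e3
    have e4 := congrArg (fun z => z * (1 : K) ⊗ₜ[k] y) e3
    simp only [Finset.sum_mul] at e4
    change Ψ (δ x * 1 ⊗ₜ[k] y) = x ⊗ₜ[k] y
    rw [← (ℛ k x).eq, Finset.sum_mul, map_sum]
    refine Eq.trans (Finset.sum_congr rfl fun p _ => ?_) (e4.trans ?_)
    · simp only [Algebra.TensorProduct.tmul_mul_tmul, mul_one, Ψ, TensorProduct.lift.tmul]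
      simp [i2, mul_assoc]
    · simp [i1]
  have hΦΨ : Φ * Ψ = 1 := mul_eq_one_comm.1 hΨΦ
  ext x
  have hint : Φ * TensorProduct.map (LinearMap.mulLeft k x) LinearMap.id =
      LinearMap.mulLeft k (δ x) * Φ := by
    ext a b
    simp [Φ, mul_assoc]
  have h1 : LinearMap.trace k _ (LinearMap.mulLeft k (δ x)) =
      LinearMap.trace k _ (TensorProduct.map (LinearMap.mulLeft k x) (LinearMap.id (M := K))) := by
    rw [← mul_one (LinearMap.mulLeft k (δ x)), ← hΦΨ, ← mul_assoc, ← hint, mul_assoc,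
      LinearMap.trace_mul_comm, mul_assoc, hΨΦ, mul_one]
  rw [hx, map_sum] at h1
  simp only [LinearMap.trace_tensorProduct', LinearMap.trace_id] at h1
  simp only [formConv, LinearMap.comp_apply, LinearMap.smul_apply, regChar_apply, smul_eq_mul]
  rw [mul_comm, ← h1]
  conv_lhs => rw [← (ℛ k x).eq]
  simp [regChar_apply]

end TraceFormula

/-! ### The Haar integral as a Casimir element; semisimplicity. -/

section HaarCasimir

variable {k K : Type*} [Field k] [Ring K] [HopfAlgebra k K]

local notation "δ" => Coalgebra.comul (R := k) (A := K)
local notation "ε" => Coalgebra.counit (R := k) (A := K)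
local notation "𝑺" => HopfAlgebra.antipode k (A := K)

/-- `h ℓ₁ ⊗ S(ℓ₂) = ℓ₁ ⊗ S(ℓ₂) h`. -/
theorem IsHaarIntegral.casimir {ℓ : K} (hℓ : IsHaarIntegral k ℓ) (h : K) :
    ∑ q ∈ (ℛ k ℓ).index, (h * (ℛ k ℓ).left q) ⊗ₜ[k] 𝑺 ((ℛ k ℓ).right q) =
      ∑ q ∈ (ℛ k ℓ).index, ((ℛ k ℓ).left q) ⊗ₜ[k] (𝑺 ((ℛ k ℓ).right q) * h) := by
  let i2 := (Algebra.TensorProduct.includeRight (R := k) (A := K) (B := K))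
  -- Applying $\mathrm{id} ⊗ S$ to $Δ(xℓ) = ε(x)Δ(ℓ)$ computes the convolution of $f$ with $x ↦ 1 ⊗
  -- S(x)$; convolving with $x ↦ 1 ⊗ x$ recovers $f$.
  let f : WithConv (K →ₗ[k] K ⊗[k] K) := toConv (∑ q ∈ (ℛ k ℓ).index,
    LinearMap.mulRight k ((ℛ k ℓ).left q ⊗ₜ[k] 𝑺 ((ℛ k ℓ).right q)) ∘ₗ
      (TensorProduct.mk k K K).flip 1)
  have hf : ∀ x, f x = ∑ q ∈ (ℛ k ℓ).index, (x * (ℛ k ℓ).left q) ⊗ₜ[k] 𝑺 ((ℛ k ℓ).right q) := by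
    intro x
    simp [f]
  have hfg : ∀ x, (f * toConv (i2.toLinearMap ∘ₗ 𝑺)) x =
      ε x • ∑ q ∈ (ℛ k ℓ).index, ((ℛ k ℓ).left q) ⊗ₜ[k] 𝑺 ((ℛ k ℓ).right q) := by
    intro x
    have e := congrArg (LinearMap.lTensor K 𝑺) (congrArg δ (hℓ.mul_left x))
    rw [Bialgebra.comul_mul, map_smul, map_smul] at e
    rw [← (ℛ k x).eq, ← (ℛ k ℓ).eq, Finset.sum_mul_sum] at e
    simp only [map_sum, Algebra.TensorProduct.tmul_mul_tmul, LinearMap.lTensor_tmul,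
      HopfAlgebra.antipode_mul_antidistrib] at e
    rw [← e, (ℛ k x).convMul_apply]
    refine Finset.sum_congr rfl fun p _ => ?_
    rw [hf, Finset.sum_mul]
    simp [i2]
  have h1 : f = (f * toConv (i2.toLinearMap ∘ₗ 𝑺)) * toConv i2.toLinearMap := by
    rw [mul_assoc, algHom_antipode_conv, mul_one]
  rw [← hf, h1, (ℛ k h).convMul_apply]
  simp only [hfg]
  conv_rhs => rw [← Coalgebra.sum_counit_smul (ℛ k h)]
  simp only [Finset.mul_sum, Finset.sum_mul, TensorProduct.tmul_sum, Finset.smul_sum]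
  rw [Finset.sum_comm]
  simp [i2]

/-- `ℓ₁ h ⊗ S(ℓ₂) = ℓ₁ ⊗ S²(h) S(ℓ₂)`. -/
theorem IsHaarIntegral.casimir_right {ℓ : K} (hℓ : IsHaarIntegral k ℓ) (h : K) :
    ∑ q ∈ (ℛ k ℓ).index, ((ℛ k ℓ).left q * h) ⊗ₜ[k] 𝑺 ((ℛ k ℓ).right q) =
      ∑ q ∈ (ℛ k ℓ).index, ((ℛ k ℓ).left q) ⊗ₜ[k] (𝑺 (𝑺 h) * 𝑺 ((ℛ k ℓ).right q)) := by
  -- Same cancellation as in `casimir`, for $ℓx = ε(x)ℓ$. In the opposite algebra the convolution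
  -- inverse of $S$ is $S^2$, which is why $S^2(h)$ appears.
  let o : K ⊗[k] K →ₗ[k] (K ⊗[k] K)ᵐᵒᵖ := (MulOpposite.opLinearEquiv k).toLinearMap
  let g : WithConv (K →ₗ[k] (K ⊗[k] K)ᵐᵒᵖ) := toConv (o ∘ₗ TensorProduct.mk k K K 1 ∘ₗ 𝑺)
  let g' : WithConv (K →ₗ[k] (K ⊗[k] K)ᵐᵒᵖ) := toConv (o ∘ₗ TensorProduct.mk k K K 1 ∘ₗ 𝑺 ∘ₗ 𝑺)
  let f : WithConv (K →ₗ[k] (K ⊗[k] K)ᵐᵒᵖ) := toConv (o ∘ₗ ∑ q ∈ (ℛ k ℓ).index,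
    LinearMap.mulLeft k ((ℛ k ℓ).left q ⊗ₜ[k] 𝑺 ((ℛ k ℓ).right q)) ∘ₗ
      (TensorProduct.mk k K K).flip 1)
  have hf : ∀ x, f x = MulOpposite.op
      (∑ q ∈ (ℛ k ℓ).index, ((ℛ k ℓ).left q * x) ⊗ₜ[k] 𝑺 ((ℛ k ℓ).right q)) := by
    intro x
    simp [f, o]
  have hgg : g * g' = 1 := by
    ext x
    rw [(ℛ k x).convMul_apply]
    have e := congrArg (fun y => MulOpposite.op ((1 : K) ⊗ₜ[k] (𝑺 y)))
      (HopfAlgebra.sum_mul_antipode_eq_smul (ℛ k x))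
    simp only [map_sum, HopfAlgebra.antipode_mul_antidistrib, map_smul, HopfAlgebra.antipode_one,
      TensorProduct.tmul_sum, TensorProduct.tmul_smul, MulOpposite.op_smul] at e
    rw [LinearMap.convOne_apply, Algebra.algebraMap_eq_smul_one]
    refine Eq.trans ?_ e
    simp [g, g', o, ← MulOpposite.op_mul]
  have hfg : ∀ x, (f * g) x = MulOpposite.op
      (ε x • ∑ q ∈ (ℛ k ℓ).index, ((ℛ k ℓ).left q) ⊗ₜ[k] 𝑺 ((ℛ k ℓ).right q)) := by
    intro x
    have e := congrArg (LinearMap.lTensor K 𝑺) (congrArg δ (hℓ.mul_right x))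
    rw [Bialgebra.comul_mul, map_smul, map_smul] at e
    rw [← (ℛ k x).eq, ← (ℛ k ℓ).eq, Finset.sum_mul_sum] at e
    simp only [map_sum, Algebra.TensorProduct.tmul_mul_tmul, LinearMap.lTensor_tmul,
      HopfAlgebra.antipode_mul_antidistrib] at e
    rw [← e, (ℛ k x).convMul_apply, Finset.sum_comm]
    simp [hf, g, o, ← MulOpposite.op_mul, Finset.sum_mul]
  have h1 : f = (f * g) * g' := by rw [mul_assoc, hgg, mul_one]
  apply MulOpposite.op_injective
  rw [← hf, h1, (ℛ k h).convMul_apply]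
  simp only [hfg]
  conv_rhs => rw [← Coalgebra.sum_counit_smul (ℛ k h)]
  simp only [map_sum, Finset.sum_mul, TensorProduct.tmul_sum, Finset.smul_sum]
  rw [Finset.sum_comm]
  simp [g', o, ← MulOpposite.op_mul, Finset.sum_mul, -MulOpposite.op_smul]

theorem IsHaarIntegral.sum_left_mul_antipode {ℓ : K} (hℓ : IsHaarIntegral k ℓ) :
    ∑ q ∈ (ℛ k ℓ).index, (ℛ k ℓ).left q * 𝑺 ((ℛ k ℓ).right q) = 1 := by
  rw [HopfAlgebra.sum_mul_antipode_eq_smul, hℓ.counit, one_smul]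

/-- A Hopf algebra with a Haar integral is semisimple after any extension of scalars. -/
theorem IsHaarIntegral.isSemisimpleRing_baseChange {ℓ : K} (hℓ : IsHaarIntegral k ℓ)
    (F : Type*) [Field F] [Algebra k F] : IsSemisimpleRing (F ⊗[k] K) := by
  refine (isSemisimpleModule_iff _ _).2 ⟨fun N => ?_⟩
  obtain ⟨p, hp⟩ := (N.restrictScalars F).subtype.exists_leftInverse_of_injective
    (LinearMap.ker_eq_bot.2 Subtype.val_injective)
  let p' : F ⊗[k] K →ₗ[F] F ⊗[k] K := (N.restrictScalars F).subtype ∘ₗ p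
  have hp1 : ∀ x, p' x ∈ N := fun x => (p x).2
  have hp2 : ∀ x ∈ N, p' x = x := fun x hx => congrArg Subtype.val (LinearMap.congr_fun hp ⟨x, hx⟩)
  let i2 := (Algebra.TensorProduct.includeRight (R := k) (A := F) (B := K))
  -- Maschke averaging: the Casimir property makes $x ↦ \sum ℓ_1p(S(ℓ_2)x)$ linear over $K$, and
  -- $\sum ℓ_1S(ℓ_2) = 1$ keeps it the identity on $N$.
  let P : F ⊗[k] K → F ⊗[k] K := fun x =>
    ∑ q ∈ (ℛ k ℓ).index, i2 ((ℛ k ℓ).left q) * p' (i2 (𝑺 ((ℛ k ℓ).right q)) * x)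
  have hPi : ∀ h x, P (i2 h * x) = i2 h * P x := by
    intro h x
    have e := congrArg (IsBilin.lift (k := k) (F := fun a b : K => i2 a * p' (i2 b * x))
      ⟨by simp [add_mul], by simp, by simp [add_mul, mul_add],
        by intro c x y
           rw [map_smul, smul_mul_assoc, ← algebraMap_smul F c, map_smul, algebraMap_smul,
             mul_smul_comm]⟩) (hℓ.casimir h)
    simp only [map_sum, IsBilin.lift_tmul] at e
    simp only [P, Finset.mul_sum]
    simpa [mul_assoc] using e.symm
  have hPadd : ∀ x y, P (x + y) = P x + P y := by
    intro x y; simp [P, mul_add, Finset.sum_add_distrib]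
  have hPsmul : ∀ (c : F) x, P (c • x) = c • P x := by
    intro c x; simp [P, Finset.smul_sum]
  let PL : F ⊗[k] K →ₗ[F ⊗[k] K] F ⊗[k] K :=
    { toFun := P
      map_add' := hPadd
      map_smul' := by
        intro y x
        simp only [RingHom.id_apply, smul_eq_mul]
        induction y with
        | zero => simpa using hPsmul 0 x
        | add y z hy hz => rw [add_mul, hPadd, hy, hz, add_mul]
        | tmul c h =>
          have : c ⊗ₜ[k] h = c • i2 h := by simp [i2, TensorProduct.smul_tmul']
          rw [this, smul_mul_assoc, hPsmul, hPi, smul_mul_assoc] }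
  have hPN : ∀ x, PL x ∈ N := fun x => N.sum_mem fun q _ => N.smul_mem _ (hp1 _)
  have hPid : ∀ x ∈ N, PL x = x := by
    intro x hx
    change P x = x
    have : ∀ q, p' (i2 (𝑺 ((ℛ k ℓ).right q)) * x) = i2 (𝑺 ((ℛ k ℓ).right q)) * x := fun q =>
      hp2 _ (N.smul_mem _ hx)
    simp only [P, this, ← mul_assoc, ← Finset.sum_mul, ← map_mul, ← map_sum,
      hℓ.sum_left_mul_antipode, map_one, one_mul]
  exact ⟨_, LinearMap.isCompl_of_proj (f := PL.codRestrict N hPN)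
    fun x => Subtype.ext (hPid x x.2)⟩

end HaarCasimir

/-! ### Traces of conjugations and the square of the antipode. -/

section MatrixTrace

/-- The coefficient of the matrix unit $E_{ij}$ in $XE_{ij}Y$ is $X_{ii}Y_{jj}$. -/
theorem trace_mulLeft_mulRight_pi {F B : Type*} [Field F] [Fintype B] [DecidableEq B] {d : B → ℕ}
    (X Y : ∀ b, Matrix (Fin (d b)) (Fin (d b)) F) :
    LinearMap.trace F _ (LinearMap.mulLeft F X * LinearMap.mulRight F Y) =
      ∑ b, (X b).trace * (Y b).trace := by
  rw [LinearMap.trace_eq_matrix_trace F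
    (Pi.basis fun b => Matrix.stdBasis F (Fin (d b)) (Fin (d b))), Matrix.trace,
    Fintype.sum_sigma]
  refine Finset.sum_congr rfl fun b _ => ?_
  rw [Fintype.sum_prod_type, Matrix.trace, Matrix.trace, Finset.sum_mul_sum]
  refine Finset.sum_congr rfl fun i _ => Finset.sum_congr rfl fun j _ => ?_
  have h : ∀ M : Matrix (Fin (d b)) (Fin (d b)) F,
      (Matrix.stdBasis F (Fin (d b)) (Fin (d b))).repr M (i, j) = M i j := fun M => rfl
  simp [LinearMap.toMatrix_apply, Pi.basis_repr, Matrix.stdBasis_eq_single, h]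
  simp [Matrix.mul_apply, Matrix.single_apply, ite_and]

end MatrixTrace

section AntipodeSquare

/-- Every eigenvalue in the algebraic closure is zero or an $N$-th root of unity. -/
theorem isIntegral_trace_of_pow_eq {k V : Type*} [Field k] [AddCommGroup V] [Module k V]
    [FiniteDimensional k V] (A : Module.End k V) {N : ℕ} (hN : 0 < N) (hA : A ^ (N + 1) = A) :
    IsIntegral ℤ (LinearMap.trace k V A) := by
  let F := AlgebraicClosure k
  rw [← isIntegral_algebraMap_iff (algebraMap k F).injective, ← LinearMap.trace_baseChange,
    Module.End.trace_eq_sum_roots_charpoly_of_splits (IsAlgClosed.splits _)]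
  refine IsIntegral.multiset_sum fun μ hμ => ?_
  have hA' : (A.baseChange F) ^ (N + 1) = A.baseChange F := by
    rw [← LinearMap.baseChange_pow, hA]
  have h1 := (Polynomial.mem_roots'.1 hμ).2
  obtain ⟨v, hv⟩ := ((Module.End.hasEigenvalue_iff_isRoot_charpoly _ _).2 h1).exists_hasEigenvector
  have h2 := hv.pow_apply (N + 1)
  rw [hA', hv.apply_eq_smul] at h2
  have h3 : μ ^ (N + 1) = μ := by
    have : (μ ^ (N + 1) - μ) • v = 0 :=
      (sub_smul (μ ^ (N + 1)) μ v).trans (sub_eq_zero.2 h2.symm)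
    exact sub_eq_zero.1 ((smul_eq_zero.1 this).resolve_right hv.2)
  by_cases h0 : μ = 0
  · rw [h0]; exact isIntegral_zero
  · have h4 : μ ^ N = 1 := by
      rw [pow_succ] at h3
      exact mul_right_cancel₀ h0 (h3.trans (one_mul μ).symm)
    exact IsIntegral.of_pow hN (by rw [h4]; exact isIntegral_one)

variable {k K : Type*} [Field k] [Ring K] [HopfAlgebra k K] [Module.Finite k K]

local notation "δ" => Coalgebra.comul (R := k) (A := K)
local notation "ε" => Coalgebra.counit (R := k) (A := K)
local notation "𝑺" => HopfAlgebra.antipode k (A := K)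

/-- Conjugation by an element of finite order has nonzero trace. -/
theorem IsHaarIntegral.trace_conj_ne_zero [CharZero k] {ℓ : K} (hℓ : IsHaarIntegral k ℓ) {g : K}
    {N : ℕ} (hN : 0 < N) (hg : g ^ N = 1) :
    LinearMap.trace k K (LinearMap.mulLeft k g * LinearMap.mulRight k (g ^ (N - 1))) ≠ 0 := by
  classical
  intro h0
  let F := AlgebraicClosure k
  have : IsSemisimpleRing (F ⊗[k] K) := hℓ.isSemisimpleRing_baseChange F
  obtain ⟨n, d, -, ⟨e⟩⟩ := IsSemisimpleRing.exists_algEquiv_pi_matrix_of_isAlgClosed F (F ⊗[k] K)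
  let i2 : K → ∀ b, Matrix (Fin (d b)) (Fin (d b)) F := fun x =>
    e (Algebra.TensorProduct.includeRight (R := k) (A := F) (B := K) x)
  -- After extension of scalars $K$ is a product of matrix algebras; the traces of the blocks are
  -- its irreducible characters.
  have htr : ∀ x y : K, algebraMap k F (LinearMap.trace k K
      (LinearMap.mulLeft k x * LinearMap.mulRight k y)) =
      ∑ b, (i2 x b).trace * (i2 y b).trace := by
    intro x y
    rw [← LinearMap.trace_baseChange, ← trace_mulLeft_mulRight_pi, ← LinearMap.trace_conj' _
      e.toLinearEquiv]
    congr 1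
    refine LinearMap.ext fun z => ?_
    obtain ⟨z, rfl⟩ := e.surjective z
    simp only [LinearEquiv.conj_apply, LinearMap.comp_apply, AlgEquiv.toLinearEquiv_toLinearMap,
      Module.End.mul_apply, LinearMap.mulLeft_apply, LinearMap.mulRight_apply, i2]
    have : (e.toLinearEquiv.symm) (e z) = z := e.symm_apply_apply z
    erw [this]
    simp only [AlgEquiv.toLinearMap_apply, ← map_mul]
    congr 1
    clear this
    induction z with
    | zero => simp
    | add z w hz hw => rw [map_add, hz, hw, add_mul, mul_add]
    | tmul c z => simp
  have hpow : ∀ m b, (i2 (g ^ m) b) = (i2 g b) ^ m := by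
    intro m b; simp only [i2, map_pow, Pi.pow_apply]
  have hone : ∀ b, (i2 g b) ^ N = 1 := by
    intro b; rw [← hpow, hg]; simp only [i2, map_one, Pi.one_apply]
  have hdiag : ∀ b, ∃ μ : Fin (Module.finrank F (Fin (d b) → F)) → F,
      (∀ i, μ i ^ N = 1) ∧ ∀ m, ((i2 g b) ^ m).trace = ∑ i, μ i ^ m := by
    intro b
    obtain ⟨v, μ, hv⟩ := exists_eigenbasis_of_pow_eq_one (Matrix.toLin' (i2 g b)) hN
      (by rw [← Matrix.toLin'_pow, hone, Matrix.toLin'_one]; rfl)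
    refine ⟨μ, fun i => (hv i).2, fun m => ?_⟩
    rw [← Matrix.trace_toLin'_eq, Matrix.toLin'_pow]
    refine trace_eq_sum_of_eigenbasis _ v _ fun i => ?_
    induction m with
    | zero => simp
    | succ m ih => rw [pow_succ', Module.End.mul_apply, ih, map_smul, (hv i).1, smul_smul, pow_succ]
  choose μ hμ1 hμ2 using hdiag
  have h1 := htr g (g ^ (N - 1))
  rw [h0, map_zero] at h1
  -- A vanishing trace reads $\sum_b χ_b(g)χ_b(g^{-1}) = 0$, which is a sum of squared absolute
  -- values under a complex embedding.
  have h2 : ∀ b, (i2 g b).trace = 0 := by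
    intro b
    have hμ3 : ∀ b, (i2 g b).trace = ∑ i, μ b i := by
      intro b; simpa using hμ2 b 1
    rw [hμ3]
    refine sum_rootsOfUnity_eq_zero hN μ hμ1 ?_ b
    rw [h1]
    refine Finset.sum_congr rfl fun b _ => ?_
    rw [hμ3, hpow, hμ2]
  -- The contradiction: $x ↦ gxℓ$ would have trace zero, but it is the rank one operator $x ↦
  -- ε(x)ε(g)ℓ$ with trace $ε(g) ≠ 0$.
  have h3 := htr g ℓ
  simp only [h2, zero_mul, Finset.sum_const_zero] at h3
  have h4 : LinearMap.mulLeft k g * LinearMap.mulRight k ℓ = LinearMap.smulRight ε (ε g • ℓ) := by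
    ext x
    simp [hℓ.mul_left, smul_smul, mul_comm]
  have hεg : (ε g) ^ N = 1 := by rw [← Bialgebra.counit_pow, hg, Bialgebra.counit_one]
  rw [h4, LinearMap.trace_smulRight, map_smul, hℓ.counit, smul_eq_mul, mul_one,
    map_eq_zero] at h3
  rw [h3, zero_pow hN.ne'] at hεg
  exact zero_ne_one hεg

/-- In characteristic zero, the antipode of a ribbon Hopf algebra with a Haar integral is an
involution. -/
theorem IsHaarIntegral.antipode_antipode [CharZero k] (hK : IsRibbon k K) {ℓ : K}
    (hℓ : IsHaarIntegral k ℓ) (x : K) : 𝑺 (𝑺 x) = x := by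
  obtain ⟨R, ν, hR, hν⟩ := hK
  obtain ⟨g, hg, hSg⟩ := hR.exists_isGroupLikeElem hν
  obtain ⟨N, hN, hgN⟩ := exists_pow_eq_one hg
  have hgi : g * g ^ (N - 1) = 1 := by rw [← pow_succ', Nat.sub_add_cancel hN, hgN]
  have hgi' : g ^ (N - 1) * g = 1 := by rw [← pow_succ, Nat.sub_add_cancel hN, hgN]
  have hS2 : ∀ h, 𝑺 (𝑺 h) = g * h * g ^ (N - 1) := by
    intro h; rw [← hSg, mul_assoc, hgi, mul_one]
  have hsurj : Function.Surjective 𝑺 := by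
    intro h
    refine ⟨𝑺 (g ^ (N - 1) * h * g), ?_⟩
    rw [hS2, mul_assoc, mul_assoc, mul_assoc, hgi, mul_one, ← mul_assoc, hgi, one_mul]
  set T := (antipodeSq k K).toLinearMap with hT
  have hTa : ∀ h, T h = 𝑺 (𝑺 h) := fun h => rfl
  have hTLR : T = LinearMap.mulLeft k g * LinearMap.mulRight k (g ^ (N - 1)) := by
    ext h; simp [hTa, hS2, mul_assoc]
  have hTN : T ^ N = 1 := by
    have hc : Commute (LinearMap.mulLeft k g) (LinearMap.mulRight k (g ^ (N - 1))) :=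
      LinearMap.commute_mulLeft_right _ _
    rw [hTLR, hc.mul_pow, LinearMap.pow_mulLeft, LinearMap.pow_mulRight, hgN, ← pow_mul,
      mul_comm, pow_mul, hgN, one_pow]
    ext; simp
  set t := LinearMap.trace k K T with ht
  have ht0 : t ≠ 0 := by
    rw [ht, hTLR]; exact hℓ.trace_conj_ne_zero hN hgN
  set n := Module.finrank k K with hn
  have : Nontrivial K := by
    refine nontrivial_of_ne ℓ 0 fun h => ?_
    have := hℓ.counit
    rw [h, map_zero] at this
    exact zero_ne_one this
  have hn0 : (n : k) ≠ 0 := by exact_mod_cast (Module.finrank_pos (R := k) (M := K)).ne'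
  have hχT : (regChar (k := k) (K := K)) ∘ₗ T = regChar := by
    ext h
    rw [LinearMap.comp_apply, hTa, hS2, regChar_apply, regChar_apply, LinearMap.mulLeft_mul,
      LinearMap.mulLeft_mul, LinearMap.trace_comp_comm', ← LinearMap.comp_assoc,
      ← LinearMap.mulLeft_mul, hgi']
    simp
  -- Normalised so that $χ$ is idempotent for convolution; then $Q$ below is a projection, and it
  -- commutes with $T$ because $χ ∘ T = χ$ and $T$ is a coalgebra map.
  let χ : K →ₗ[k] k := (n : k)⁻¹ • regChar
  have hχχ : formConv χ χ = χ := by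
    have h1 : formConv χ χ = ((n : k)⁻¹ * (n : k)⁻¹) • formConv (regChar (k := k) (K := K)) regChar := by
      simp [formConv, χ, TensorProduct.map_smul_left, TensorProduct.map_smul_right,
        LinearMap.smul_comp, LinearMap.comp_smul, smul_smul]
    rw [h1, formConv_regChar, smul_smul, ← hn, mul_assoc, inv_mul_cancel₀ hn0, mul_one]
  let Q : Module.End k K := twistedBy χ LinearMap.id
  have hQQ : Q * Q = Q := by
    change Q ∘ₗ Q = Q
    simp only [Q]
    rw [comp_twistedBy, LinearMap.comp_id, twistedBy_twistedBy, hχχ]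
  have hTQ : T * Q = Q * T := by
    have h1 : T * Q = twistedBy χ T := comp_twistedBy _ _ _
    rw [h1]
    ext h
    have hc : δ (T h) = TensorProduct.map T T (δ h) := by
      rw [hTa, comul_antipode, comul_antipode]
      conv_lhs => rw [← (ℛ k h).eq]
      conv_rhs => rw [← (ℛ k h).eq]
      simp [hTa]
    have h2 : ∀ y, χ (T y) = χ y := fun y => by
      have := DFunLike.congr_fun hχT y
      simp only [χ, LinearMap.smul_apply]
      rw [← this]; rfl
    simp only [Q, Module.End.mul_apply, twistedBy, LinearMap.comp_apply, hc]
    conv_lhs => rw [← (ℛ k h).eq]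
    conv_rhs => rw [← (ℛ k h).eq]
    simp [h2]
  have htQ : LinearMap.trace k K (T * Q) = t * (n : k)⁻¹ := by
    have h1 : T * Q = twistedBy χ T := comp_twistedBy _ _ _
    rw [h1, trace_twistedBy hℓ hsurj]
    simp [χ, regChar_haar hℓ, ← hT, ht]
  -- $T$ has order dividing $N$ and $Q$ is idempotent, so $(TQ)^{N+1} = TQ$.
  have hint : IsIntegral ℤ (t * (n : k)⁻¹) := by
    rw [← htQ]
    refine isIntegral_trace_of_pow_eq _ hN ?_
    have hQ : Q ^ (N + 1) = Q := (show IsIdempotentElem Q from hQQ).pow_succ_eq N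
    rw [(show Commute T Q from hTQ).mul_pow, hQ, pow_succ, hTN, one_mul]
  let F := AlgebraicClosure k
  have hTF : (T.baseChange F) ^ N = 1 := by
    rw [← LinearMap.baseChange_pow, hTN]; exact LinearMap.baseChange_one ..
  obtain ⟨v, μ, hv⟩ := exists_eigenbasis_of_pow_eq_one (T.baseChange F) hN hTF
  -- The same number $t/n$ is the mean of the eigenvalues of $T$, so these are all equal and $T$ is
  -- a scalar.
  have hsum : (Fintype.card (Fin (Module.finrank F (F ⊗[k] K))) : F) *
      algebraMap k F (t * (n : k)⁻¹) = ∑ i, μ i := by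
    rw [← trace_eq_sum_of_eigenbasis _ v μ fun i => (hv i).1, LinearMap.trace_baseChange,
      Fintype.card_fin, Module.finrank_baseChange, ← hn, ← ht, ← map_natCast (algebraMap k F),
      ← map_mul]
    congr 1
    rw [mul_comm, mul_assoc, inv_mul_cancel₀ hn0, mul_one]
  have hall := rootsOfUnity_eq_of_isIntegral_mean hN μ (fun i => (hv i).2)
    ((isIntegral_algebraMap_iff (algebraMap k F).injective).2 hint)
    (by simpa using ⟨ht0, by simpa using hn0⟩) hsum
  have hpos : 0 < Module.finrank F (F ⊗[k] K) := by
    rw [Module.finrank_baseChange]; exact Module.finrank_pos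
  let i0 : Fin (Module.finrank F (F ⊗[k] K)) := ⟨0, hpos⟩
  have hTs : T.baseChange F = μ i0 • LinearMap.id := by
    refine v.ext fun i => ?_
    rw [(hv i).1, hall i i0]; rfl
  -- The scalar is determined on the unit, which $S^2$ fixes.
  have hT1 : (μ i0 - 1) • ((1 : F) ⊗ₜ[k] (1 : K)) = 0 := by
    have h1 := DFunLike.congr_fun hTs ((1 : F) ⊗ₜ[k] (1 : K))
    rw [LinearMap.baseChange_tmul, hTa, HopfAlgebra.antipode_one, HopfAlgebra.antipode_one] at h1
    rw [sub_smul, one_smul, sub_eq_zero]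
    exact h1.symm
  have hinj : Function.Injective
      (Algebra.TensorProduct.includeRight (R := k) (A := F) (B := K)) :=
    Algebra.TensorProduct.includeRight_injective (algebraMap k F).injective
  have h11 : (1 : F) ⊗ₜ[k] (1 : K) ≠ 0 := by
    intro h
    have := hinj (a₁ := (1 : K)) (a₂ := 0) (by rw [map_zero]; exact h)
    exact one_ne_zero this
  have hμ1 : μ i0 = 1 := sub_eq_zero.1 ((smul_eq_zero.1 hT1).resolve_right h11)
  have h2 := DFunLike.congr_fun hTs ((1 : F) ⊗ₜ[k] x)
  rw [LinearMap.baseChange_tmul, hμ1, one_smul] at h2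
  exact hinj h2

/-- Apply $S$ to $\sum S(ℓ_1)ℓ_2 = 1$. Involutivity of $S$ is what turns $S^2(ℓ_1)$ back into $ℓ_1$.
-/
theorem IsHaarIntegral.sum_antipode_mul [CharZero k] (hK : IsRibbon k K) {ℓ : K}
    (hℓ : IsHaarIntegral k ℓ) :
    ∑ q ∈ (ℛ k ℓ).index, 𝑺 ((ℛ k ℓ).right q) * (ℛ k ℓ).left q = 1 := by
  have h1 : ∀ q, 𝑺 ((ℛ k ℓ).right q) * (ℛ k ℓ).left q =
      𝑺 (𝑺 ((ℛ k ℓ).left q) * (ℛ k ℓ).right q) := by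
    intro q
    rw [HopfAlgebra.antipode_mul_antidistrib, hℓ.antipode_antipode hK]
  simp only [h1]
  rw [← map_sum, HopfAlgebra.sum_antipode_mul_eq_smul, hℓ.counit, one_smul,
    HopfAlgebra.antipode_one]

end AntipodeSquare

/-! ### The products on one copy of $K^*$ and the two regular actions. -/

section DualAlgebra

variable {k K : Type*} [Field k] [Ring K] [HopfAlgebra k K]

local notation "δ" => Coalgebra.comul (R := k) (A := K)
local notation "ε" => Coalgebra.counit (R := k) (A := K)
local notation "𝑺" => HopfAlgebra.antipode k (A := K)

/-- The action `o` of a coalgebra is compatible with the product `m`: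
`o h (m x y) = m (o h₁ x) (o h₂ y)`. -/
def IsModuleAlgebraAct {C A : Type*} [AddCommGroup C] [Module k C] [Coalgebra k C]
    [AddCommMonoid A] [Module k A] (o : C →ₗ[k] Module.End k A) (m : A →ₗ[k] A →ₗ[k] A) : Prop :=
  ∀ h x y, o h (m x y) = ∑ p ∈ (ℛ k h).index, m (o ((ℛ k h).left p) x) (o ((ℛ k h).right p) y)

/-- The underlying space of the co-opposite coalgebra. -/
def Cop (K : Type*) : Type _ := K

instance : AddCommGroup (Cop K) := inferInstanceAs (AddCommGroup K)
instance : Module k (Cop K) := inferInstanceAs (Module k K)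

variable (k K) in
/-- The identity map from the co-opposite coalgebra. -/
def ofCop : Cop K →ₗ[k] K := LinearMap.id (R := k) (M := K)

/-- Makes Sweedler sums independent of the representation, for instance when comparing the chosen
ones of $K$ and `Cop K`. -/
theorem sum_repr_eq {C P : Type*} [AddCommGroup C] [Module k C] [Coalgebra k C] [AddCommMonoid P]
    [Module k P] {ι : Type*} (f : C ⊗[k] C →ₗ[k] P) (x : C) (r : Coalgebra.Repr k x ι) :
    ∑ p ∈ r.index, f (r.left p ⊗ₜ r.right p) = f (Coalgebra.comul x) := by
  rw [← map_sum, r.eq]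

theorem dualMul_apply (α β : D k K) (h : K) :
    dualMul k K α β h = ∑ p ∈ (ℛ k h).index, α ((ℛ k h).left p) * β ((ℛ k h).right p) := by
  change LinearMap.mul' k k (TensorProduct.map α β (Coalgebra.comul h)) = _
  conv_lhs => rw [← (ℛ k h).eq]
  simp

theorem dualMul_eq_convMul (α β : D k K) :
    dualMul k K α β = (toConv α * toConv β).ofConv := by
  ext h
  rw [dualMul_apply, (ℛ k h).convMul_apply]

theorem dualMul_assoc (α β γ : D k K) :
    dualMul k K (dualMul k K α β) γ = dualMul k K α (dualMul k K β γ) := by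
  simp [dualMul_eq_convMul, mul_assoc]

theorem toConv_counit_eq_one : (toConv ε : WithConv (K →ₗ[k] k)) = 1 := by
  ext h; simp [LinearMap.convOne_def]

@[simp]
theorem counit_dualMul (α : D k K) : dualMul k K ε α = α := by
  rw [dualMul_eq_convMul, toConv_counit_eq_one, one_mul]

@[simp]
theorem dualMul_counit (α : D k K) : dualMul k K α ε = α := by
  rw [dualMul_eq_convMul, toConv_counit_eq_one, mul_one]

@[simp]
theorem regRight_apply (h : K) (α : D k K) (x : K) : regRight k K h α x = α (h * x) := rfl

@[simp]
theorem regLeft_apply (h : K) (α : D k K) (x : K) : regLeft k K h α x = α (x * h) := rfl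

@[simp]
theorem regRight_counit (h : K) : regRight k K h ε = ε h • ε := by
  ext; simp

@[simp]
theorem regLeft_counit (h : K) : regLeft k K h ε = ε h • ε := by
  ext; simp [mul_comm]

theorem regRight_mul (h h' : K) : regRight k K (h * h') = regRight k K h' * regRight k K h := by
  ext; simp [mul_assoc]

theorem regLeft_mul (h h' : K) : regLeft k K (h * h') = regLeft k K h * regLeft k K h' := by
  ext; simp [mul_assoc]

theorem regRight_regRight (h h' : K) (α : D k K) :
    regRight k K h (regRight k K h' α) = regRight k K (h' * h) α := by
  rw [regRight_mul]; rfl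

@[simp]
theorem regRight_one : regRight k K 1 = 1 := by ext; simp

@[simp]
theorem regLeft_one : regLeft k K 1 = 1 := by ext; simp

theorem regLeft_regRight (h h' : K) (α : D k K) :
    regLeft k K h (regRight k K h' α) = regRight k K h' (regLeft k K h α) := by
  ext; simp [mul_assoc]

theorem dualMul_mul_apply (α β : D k K) (h x : K) :
    dualMul k K α β (h * x) =
      LinearMap.mul' k k (TensorProduct.map α β (δ h * δ x)) := by
  rw [← Bialgebra.comul_mul]; rfl

theorem isModuleAlgebraAct_regRight : IsModuleAlgebraAct (regRight k K) (dualMul k K) := by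
  intro h α β
  ext x
  rw [regRight_apply, dualMul_mul_apply]
  simp only [LinearMap.sum_apply, dualMul_apply]
  conv_lhs => rw [← (ℛ k h).eq, ← (ℛ k x).eq]
  simp [Finset.sum_mul_sum]

theorem isModuleAlgebraAct_regLeft : IsModuleAlgebraAct (regLeft k K) (dualMul k K) := by
  intro h α β
  ext x
  rw [regLeft_apply, dualMul_mul_apply]
  simp only [LinearMap.sum_apply, dualMul_apply]
  conv_lhs => rw [← (ℛ k h).eq, ← (ℛ k x).eq]
  simp [Finset.sum_mul_sum]
  rw [Finset.sum_comm]

instance : Coalgebra k (Cop K) where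
  comul := (flip k ∘ₗ δ : K →ₗ[k] K ⊗[k] K)
  counit := (ε : K →ₗ[k] k)
  coassoc := by
    refine LinearMap.ext fun (x : K) => ?_
    have e := congrArg (IsTrilin.lift (k := k) (F := fun (a b c : K) => c ⊗ₜ[k] (b ⊗ₜ[k] a)) {})
      (Coalgebra.coassoc_apply (R := k) x)
    change TensorProduct.assoc k K K K (LinearMap.rTensor K (flip k ∘ₗ δ) (flip k (δ x))) =
      LinearMap.lTensor K (flip k ∘ₗ δ) (flip k (δ x))
    rw [← (ℛ k x).eq] at e ⊢
    simp only [map_sum, LinearMap.rTensor_tmul, LinearMap.lTensor_tmul, flip_tmul,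
      LinearMap.comp_apply] at e ⊢
    convert e.symm using 2 with p _ p _
    · rw [← (ℛ k ((ℛ k x).right p)).eq]
      simp [TensorProduct.sum_tmul, TensorProduct.tmul_sum]
    · rw [← (ℛ k ((ℛ k x).left p)).eq]
      simp [TensorProduct.sum_tmul, TensorProduct.tmul_sum]
  rTensor_counit_comp_comul := by
    refine LinearMap.ext fun (x : K) => ?_
    have e := congrArg (TensorProduct.comm k K k) (Coalgebra.lTensor_counit_comul (R := k) x)
    change LinearMap.rTensor K ε (flip k (δ x)) = (1 : k) ⊗ₜ[k] x
    rw [← (ℛ k x).eq] at e ⊢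
    simpa only [map_sum, LinearMap.lTensor_tmul, LinearMap.rTensor_tmul, flip_tmul,
      TensorProduct.comm_tmul] using e
  lTensor_counit_comp_comul := by
    refine LinearMap.ext fun (x : K) => ?_
    have e := congrArg (TensorProduct.comm k k K) (Coalgebra.rTensor_counit_comul (R := k) x)
    change LinearMap.lTensor K ε (flip k (δ x)) = x ⊗ₜ[k] (1 : k)
    rw [← (ℛ k x).eq] at e ⊢
    simpa only [map_sum, LinearMap.lTensor_tmul, LinearMap.rTensor_tmul, flip_tmul,
      TensorProduct.comm_tmul] using e

/-- Compatibility of `o` with a product, for the co-opposite comultiplication. -/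
theorem isModuleAlgebraAct_cop {A : Type*} [AddCommMonoid A] [Module k A]
    {o : K →ₗ[k] Module.End k A} {m : A →ₗ[k] A →ₗ[k] A} :
    IsModuleAlgebraAct (o ∘ₗ ofCop k K) m ↔ ∀ h x y, o h (m x y) =
      ∑ p ∈ (ℛ k h).index, m (o ((ℛ k h).right p) x) (o ((ℛ k h).left p) y) := by
  refine forall_congr' fun h => forall₂_congr fun x y => ?_
  let F : K ⊗[k] K →ₗ[k] A := TensorProduct.lift (m.compl₁₂ (o.flip x) (o.flip y))
  let F' : Cop K ⊗[k] Cop K →ₗ[k] A :=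
    TensorProduct.lift (m.compl₁₂ ((o ∘ₗ ofCop k K).flip x) ((o ∘ₗ ofCop k K).flip y))
  have h1 := sum_repr_eq F' h (ℛ k (A := Cop K) h)
  have h2 := sum_repr_eq (C := K) (F ∘ₗ flip k) h (ℛ k (A := K) h)
  exact Eq.congr_right (h1.trans h2.symm)

theorem IsModuleAlgebraAct.flip_cop {A : Type*} [AddCommMonoid A] [Module k A]
    {o : K →ₗ[k] Module.End k A} {m : A →ₗ[k] A →ₗ[k] A} (h : IsModuleAlgebraAct o m) :
    IsModuleAlgebraAct (o ∘ₗ ofCop k K) m.flip :=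
  isModuleAlgebraAct_cop.2 fun x a b => h x b a

variable {R : K ⊗[k] K} {n : ℕ} {a b : Fin n → K} (hab : R = ∑ i, a i ⊗ₜ[k] b i)

include hab in
theorem endMul_false_false (α β : D k K) : endMul R false false α β =
    ∑ i, dualMul k K (regRight k K (a i) β) (regRight k K (b i) α) := by
  simp [endMul, hab]

include hab in
theorem endMul_false_true (α β : D k K) : endMul R false true α β =
    ∑ i, dualMul k K (regLeft k K (b i) α) (regLeft k K (a i) β) := by
  simp [endMul, hab]

/-- The two products which involve the `R`-matrix agree. -/
theorem IsRMatrix.endMul_false (hR : IsRMatrix k R) (τ τ' : Bool) :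
    endMul R false τ = endMul R false τ' := by
  suffices h : endMul R false false = endMul R false true by
    cases τ <;> cases τ' <;> simp [h]
  obtain ⟨n, a, b, hab⟩ := exists_sum_tmul R
  ext α β x
  rw [endMul_false_false hab, endMul_false_true hab]
  -- The two formulas, evaluated at $x$, are the two sides of $RΔ(x) = Δ^{op}(x)R$.
  have h1 := hR.sum_mul_comul hab (F := fun y z => β y * α z)
    ⟨by simp [add_mul], by simp [mul_assoc], by simp [mul_add], by simp [mul_left_comm]⟩ x
  simp only [LinearMap.sum_apply, dualMul_apply, regRight_apply, regLeft_apply, h1]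
  simp only [mul_comm]

include hab in
theorem IsRMatrix.endMul_false_eq_regRight (hR : IsRMatrix k R) (τ : Bool) (α β : D k K) :
    endMul R false τ α β =
      ∑ i, dualMul k K (regRight k K (a i) β) (regRight k K (b i) α) := by
  rw [hR.endMul_false τ false, endMul_false_false hab]

include hab in
theorem IsRMatrix.endMul_false_eq_regLeft (hR : IsRMatrix k R) (τ : Bool) (α β : D k K) :
    endMul R false τ α β =
      ∑ i, dualMul k K (regLeft k K (b i) α) (regLeft k K (a i) β) := by
  rw [hR.endMul_false τ true, endMul_false_true hab]

-- The twist condition $R_{23}(\mathrm{id} ⊗ Δ)(R) = R_{12}(Δ ⊗ \mathrm{id})(R)$: both hexagon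
-- axioms reduce it to the Yang-Baxter equation.
include hab in
theorem IsRMatrix.sum_hexagon (hR : IsRMatrix k R) {P : Type*} [AddCommMonoid P] [Module k P]
    {F : K → K → K → P} (hF : IsTrilin k F) :
    ∑ j, ∑ i, ∑ p ∈ (ℛ k (b i)).index,
      F (a i) (a j * (ℛ k (b i)).left p) (b j * (ℛ k (b i)).right p) =
    ∑ i, ∑ j, ∑ p ∈ (ℛ k (a i)).index,
      F (a j * (ℛ k (a i)).left p) (b j * (ℛ k (a i)).right p) (b i) := by
  have h1 := fun l => hR.sum_comul_right hab (F := fun x y z => F x (a l * y) (b l * z))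
    ⟨by simp [hF.add₁], by simp [hF.smul₁], by simp [mul_add, hF.add₂], by simp [hF.smul₂],
      by simp [mul_add, hF.add₃], by simp [hF.smul₃]⟩
  have h2 := fun l => hR.sum_comul_left hab (F := fun x y z => F (a l * x) (b l * y) z)
    ⟨by simp [mul_add, hF.add₁], by simp [hF.smul₁], by simp [mul_add, hF.add₂],
      by simp [hF.smul₂], by simp [hF.add₃], by simp [hF.smul₃]⟩
  conv_rhs => rw [Finset.sum_comm]
  simp only [h1, h2]
  have h3 := hR.yangBaxter hab hF
  exact h3.symm.trans Finset.sum_comm_cycle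

/-- For $σ = 0$ this is associativity of a product twisted by $R$, hence the twist condition
`sum_hexagon`. -/
theorem IsRMatrix.endMul_assoc (hR : IsRMatrix k R) (σ τ : Bool) (α β γ : D k K) :
    endMul R σ τ (endMul R σ τ α β) γ = endMul R σ τ α (endMul R σ τ β γ) := by
  cases σ with
  | true => cases τ <;> simp [endMul, dualMul_assoc]
  | false =>
    obtain ⟨n, a, b, hab⟩ := exists_sum_tmul R
    simp only [hR.endMul_false_eq_regRight hab, map_sum, LinearMap.sum_apply,
      isModuleAlgebraAct_regRight _ (regRight k K _ _) _, regRight_regRight, dualMul_assoc]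
    exact hR.sum_hexagon hab (F := fun x y z => dualMul k K (regRight k K x γ)
      (dualMul k K (regRight k K y β) (regRight k K z α))) {}

@[simp]
theorem IsRMatrix.counit_endMul (hR : IsRMatrix k R) (σ τ : Bool) (α : D k K) :
    endMul R σ τ ε α = α := by
  obtain ⟨n, a, b, hab⟩ := exists_sum_tmul R
  cases σ with
  | true => cases τ <;> simp [endMul]
  | false =>
    rw [hR.endMul_false_eq_regRight hab]
    have h : ∀ i, dualMul k K (regRight k K (a i) α) (regRight k K (b i) ε) =
        regRight k K (ε (b i) • a i) α := by intro i; simp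
    simp only [h, ← LinearMap.sum_apply, ← map_sum, hR.sum_counit_right hab]
    simp

@[simp]
theorem IsRMatrix.endMul_counit (hR : IsRMatrix k R) (σ τ : Bool) (α : D k K) :
    endMul R σ τ α ε = α := by
  obtain ⟨n, a, b, hab⟩ := exists_sum_tmul R
  cases σ with
  | true => cases τ <;> simp [endMul]
  | false =>
    rw [hR.endMul_false_eq_regRight hab]
    have h : ∀ i, dualMul k K (regRight k K (a i) ε) (regRight k K (b i) α) =
        regRight k K (ε (a i) • b i) α := by intro i; simp
    simp only [h, ← LinearMap.sum_apply, ← map_sum, hR.sum_counit_left hab]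
    simp

theorem endAct_mul (τ : Bool) (h h' : K) :
    endAct k K τ (h * h') = endAct k K τ h' * endAct k K τ h := by
  cases τ with
  | false => exact regRight_mul h h'
  | true => simp [endAct, HopfAlgebra.antipode_mul_antidistrib, regLeft_mul]

@[simp]
theorem endAct_one (τ : Bool) : endAct k K τ 1 = 1 := by
  cases τ <;> simp [endAct]

@[simp]
theorem endAct_counit (τ : Bool) (h : K) : endAct k K τ h ε = ε h • ε := by
  cases τ <;> simp [endAct]

/-- The regular action of `K` on the copy of `K*` at an edge end which commutes with `endAct`. -/
def otherAct : Bool → (K →ₗ[k] Module.End k (D k K))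
  | false => regLeft k K
  | true => regRight k K

theorem commute_endAct_otherAct (τ : Bool) (h h' : K) :
    Commute (endAct k K τ h) (otherAct (k := k) τ h') := by
  cases τ <;> refine LinearMap.ext fun α => ?_
  · exact (regLeft_regRight h' h α).symm
  · exact regLeft_regRight (𝑺 h) h' α

@[simp]
theorem otherAct_counit (τ : Bool) (h : K) : otherAct (k := k) τ h ε = ε h • ε := by
  cases τ <;> simp [otherAct]

@[simp]
theorem otherAct_one (τ : Bool) : otherAct (k := k) (K := K) τ 1 = 1 := by
  cases τ <;> simp [otherAct]

/-- The antipode reverses the coproduct, which is compensated by reversing the product. -/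
theorem isModuleAlgebraAct_regLeft_antipode :
    IsModuleAlgebraAct (regLeft k K ∘ₗ 𝑺) (dualMul k K).flip := by
  intro h α β
  let F : K ⊗[k] K →ₗ[k] D k K :=
    TensorProduct.lift ((dualMul k K).compl₁₂ ((regLeft k K).flip β) ((regLeft k K).flip α))
  have h1 := congrArg F (comul_antipode (k := k) h)
  have h2 := sum_repr_eq F _ (ℛ k (𝑺 h))
  have h3 := sum_repr_eq (F ∘ₗ TensorProduct.map 𝑺 𝑺 ∘ₗ flip k) _ (ℛ k h)
  exact (isModuleAlgebraAct_regLeft (𝑺 h) β α).trans (h2.trans (h1.trans h3.symm))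

/-- Of the two formulas for the product with $R$, choose the one in which $R$ acts by the regular
action commuting with `endAct`. -/
theorem IsRMatrix.isModuleAlgebraAct_endAct (hR : IsRMatrix k R) (σ τ : Bool) :
    IsModuleAlgebraAct (endAct k K τ) (endMul R σ τ) := by
  obtain ⟨n, a, b, hab⟩ := exists_sum_tmul R
  cases σ <;> cases τ
  · intro h α β
    simp only [hR.endMul_false_eq_regLeft hab, endAct, map_sum,
      isModuleAlgebraAct_regRight _ (regLeft k K _ _) _, regLeft_regRight]
    rw [Finset.sum_comm]
  · intro h α β
    simp only [hR.endMul_false_eq_regRight hab, endAct, map_sum]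
    rw [Finset.sum_comm]
    refine Finset.sum_congr rfl fun i _ => ?_
    have := isModuleAlgebraAct_regLeft_antipode h (regRight k K (b i) α) (regRight k K (a i) β)
    simpa [regLeft_regRight] using this
  · exact isModuleAlgebraAct_regRight
  · exact isModuleAlgebraAct_regLeft_antipode

/-- The edge ends with `σ ≠ τ`: the other regular action is compatible with the product. -/
theorem IsRMatrix.isModuleAlgebraAct_otherAct (hR : IsRMatrix k R) (τ : Bool) :
    IsModuleAlgebraAct (otherAct τ) (endMul R (!τ) τ) := by
  obtain ⟨n, a, b, hab⟩ := exists_sum_tmul R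
  cases τ
  · exact isModuleAlgebraAct_regLeft
  · intro h α β
    simp only [Bool.not_true, hR.endMul_false_eq_regLeft hab, otherAct, map_sum,
      isModuleAlgebraAct_regRight _ (regLeft k K _ _) _, regLeft_regRight]
    rw [Finset.sum_comm]

/-- The edge ends with `σ = τ`. -/
theorem IsRMatrix.isModuleAlgebraAct_otherAct_cop (hR : IsRMatrix k R) (τ : Bool) :
    IsModuleAlgebraAct (otherAct τ ∘ₗ ofCop k K) (endMul R τ τ) := by
  obtain ⟨n, a, b, hab⟩ := exists_sum_tmul R
  cases τ
  · rw [isModuleAlgebraAct_cop]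
    intro h α β
    simp only [hR.endMul_false_eq_regRight hab, otherAct, map_sum,
      isModuleAlgebraAct_regLeft _ (regRight k K _ _) _, regLeft_regRight]
    rw [Finset.sum_comm]
  · exact isModuleAlgebraAct_regRight.flip_cop

/-- The products for `σ = 0` are twists of those for `σ = 1`. -/
theorem IsRMatrix.endMul_false_eq (hR : IsRMatrix k R)  (hab : R = ∑ i, a i ⊗ₜ[k] b i)
    (τ : Bool) (α β : D k K) :
    endMul R false τ α β = ∑ i, endMul R true τ (otherAct τ (b i) α) (otherAct τ (a i) β) := by
  cases τ
  · rw [hR.endMul_false_eq_regLeft hab]; rfl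
  · rw [hR.endMul_false_eq_regRight hab]; rfl

end DualAlgebra

/-! ### Operators as constants in the convolution algebra. -/

section Convolution

variable {k C A : Type*} [Field k] [AddCommGroup C] [Module k C] [Coalgebra k C]
  [Semiring A] [Algebra k A]

variable (k C) in
/-- The constants `h ↦ ε(h) X` in the convolution algebra. -/
def convConst (X : A) : WithConv (C →ₗ[k] A) :=
  toConv (LinearMap.smulRight (Coalgebra.counit : C →ₗ[k] k) X)

/-- The counit absorbs one leg of $Δ(h)$. Thus a relation $o(h)X = \sum X'(h_1)o(h_2)$ becomes an
equation in an associative algebra and can be composed factor by factor. -/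
theorem convMul_convConst_apply (f : WithConv (C →ₗ[k] A)) (X : A) (h : C) :
    (f * convConst k C X).ofConv h = f.ofConv h * X := by
  rw [(ℛ k h).convMul_apply]
  simp only [convConst, LinearMap.smulRight_apply, mul_smul_comm, ← smul_mul_assoc, ← map_smul]
  rw [← Finset.sum_mul, ← map_sum]
  have e := congrArg (TensorProduct.rid k C) (Coalgebra.sum_tmul_counit_eq (ℛ k h))
  simp only [map_sum, TensorProduct.rid_tmul, one_smul] at e
  rw [e]

theorem convConst_convMul_apply (f : WithConv (C →ₗ[k] A)) (X : A) (h : C) :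
    (convConst k C X * f).ofConv h = X * f.ofConv h := by
  rw [(ℛ k h).convMul_apply]
  simp only [convConst, LinearMap.smulRight_apply, smul_mul_assoc, ← mul_smul_comm, ← map_smul]
  rw [← Finset.mul_sum, ← map_sum, Coalgebra.sum_counit_smul]

theorem convConst_mul (X Y : A) : convConst k C (X * Y) = convConst k C X * convConst k C Y := by
  ext h
  rw [convConst_convMul_apply]
  simp [convConst]

theorem convConst_sum {ι : Type*} (s : Finset ι) (X : ι → A) :
    convConst k C (∑ i ∈ s, X i) = ∑ i ∈ s, convConst k C (X i) := by
  apply WithConv.ofConv_injective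
  ext h
  rw [WithConv.ofConv_sum]
  simp [convConst, Finset.smul_sum]

theorem commute_convConst_iff (f : WithConv (C →ₗ[k] A)) (X : A) :
    Commute f (convConst k C X) ↔ ∀ h, Commute (f.ofConv h) X := by
  constructor
  · intro e h
    have := LinearMap.congr_fun (congrArg ofConv e.eq) h
    rwa [convMul_convConst_apply, convConst_convMul_apply] at this
  · intro e
    apply WithConv.ofConv_injective
    ext h
    rw [convMul_convConst_apply, convConst_convMul_apply]
    exact e h

end Convolution

section AntiHom

variable {k K A : Type*} [Field k] [Ring K] [HopfAlgebra k K] [Semiring A] [Algebra k A]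

/-- Multiplicativity of $Δ$, together with the commutation of the two ranges to reorder the middle
factors. -/
theorem convMul_anti (f g : WithConv (K →ₗ[k] A))
    (hf : ∀ x y, f.ofConv (x * y) = f.ofConv y * f.ofConv x)
    (hg : ∀ x y, g.ofConv (x * y) = g.ofConv y * g.ofConv x)
    (hfg : ∀ x y, Commute (f.ofConv x) (g.ofConv y)) (x y : K) :
    (f * g).ofConv (x * y) = (f * g).ofConv y * (f * g).ofConv x := by
  have h1 : (f * g).ofConv (x * y) = LinearMap.mul' k A (TensorProduct.map f.ofConv g.ofConv
      (Coalgebra.comul (R := k) x * Coalgebra.comul y)) := by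
    rw [← Bialgebra.comul_mul]; rfl
  rw [h1, (ℛ k x).convMul_apply, (ℛ k y).convMul_apply]
  conv_lhs => rw [← (ℛ k x).eq, ← (ℛ k y).eq]
  simp only [Finset.sum_mul_sum, map_sum, Algebra.TensorProduct.tmul_mul_tmul,
    TensorProduct.map_tmul, LinearMap.mul'_apply, hf, hg]
  rw [Finset.sum_comm]
  refine Finset.sum_congr rfl fun p _ => Finset.sum_congr rfl fun q _ => ?_
  rw [mul_assoc, ← mul_assoc (f.ofConv _) (g.ofConv _), (hfg _ _).eq]
  simp only [mul_assoc]

theorem convMul_one_apply (f g : WithConv (K →ₗ[k] A)) :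
    (f * g).ofConv 1 = f.ofConv 1 * g.ofConv 1 := by
  rw [LinearMap.convMul_apply]
  simp [Bialgebra.comul_one, Algebra.TensorProduct.one_def]

variable {W : Type*} [AddCommMonoid W] [Module k W]

theorem convMul_apply_of_counit {C : Type*} [AddCommGroup C] [Module k C] [Coalgebra k C]
    (f g : WithConv (C →ₗ[k] Module.End k W)) (w : W)
    (hf : ∀ h, f.ofConv h w = Coalgebra.counit (R := k) h • w)
    (hg : ∀ h, g.ofConv h w = Coalgebra.counit (R := k) h • w) (h : C) :
    (f * g).ofConv h w = Coalgebra.counit (R := k) h • w := by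
  rw [(ℛ k h).convMul_apply]
  simp only [LinearMap.sum_apply, Module.End.mul_apply, hg, map_smul, hf, ← smul_assoc,
    ← Finset.sum_smul]
  congr 1
  have e := congrArg (Coalgebra.counit (R := k)) (Coalgebra.sum_counit_smul (ℛ k h))
  simpa only [map_sum, map_smul, smul_eq_mul, mul_comm] using e

end AntiHom

/-! ### Operators on single tensor factors and the iterated action on several of them. -/

section Factors

variable {k : Type*} [Field k] {ι M : Type*} [AddCommGroup M] [Module k M]

theorem atFactor_tprod [DecidableEq ι] (i : ι) (f : Module.End k M) (m : ι → M) :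
    atFactor k i f (PiTensorProduct.tprod k m) =
      PiTensorProduct.tprod k (Function.update m i (f (m i))) := by
  classical
  simp only [atFactor, MultilinearMap.toLinearMap_apply, PiTensorProduct.mapMultilinear_apply,
    PiTensorProduct.map_tprod]
  congr 1
  ext j
  by_cases h : j = i
  · subst h; simp
  · simp [h]

theorem atFactor_mul (i : ι) (f g : Module.End k M) :
    atFactor k i (f * g) = atFactor k i f * atFactor k i g := by
  classical
  ext m
  simp [atFactor_tprod]

@[simp]
theorem atFactor_one (i : ι) : atFactor k i (1 : Module.End k M) = 1 := by
  classical
  ext m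
  simp [atFactor_tprod]

theorem atFactor_commute {i j : ι} (h : i ≠ j) (f g : Module.End k M) :
    Commute (atFactor k i f) (atFactor k j g) := by
  classical
  refine PiTensorProduct.ext (MultilinearMap.ext fun m => ?_)
  simp [atFactor_tprod, h, h.symm, Function.update_comm h]

end Factors

section TensorAct

variable {k K : Type*} [Field k] [Ring K] [HopfAlgebra k K] {ι : Type*} (τ : ι → Bool)

local notation "ε" => Coalgebra.counit (R := k) (A := K)

theorem factorAct_apply (i : ι) (h : K) :
    factorAct τ i h = atFactor k i (endAct k K (τ i) h) := rfl

theorem factorAct_mul (i : ι) (h h' : K) :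
    factorAct (k := k) τ i (h * h') = factorAct τ i h' * factorAct τ i h := by
  simp only [factorAct_apply, endAct_mul, atFactor_mul]

theorem factorAct_commute_atFactor {i j : ι} (hij : i ≠ j) (h : K) (f : Module.End k (D k K)) :
    Commute (factorAct τ i h) (atFactor k j f) := by
  rw [factorAct_apply]; exact atFactor_commute hij _ _

theorem factorAct_commute {i j : ι} (hij : i ≠ j) (h h' : K) :
    Commute (factorAct (k := k) τ i h) (factorAct τ j h') := by
  rw [factorAct_apply τ j]; exact factorAct_commute_atFactor τ hij h _

@[simp]
theorem factorAct_one (i : ι) : factorAct (k := k) (K := K) τ i 1 = 1 := by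
  simp [factorAct_apply]

theorem factorAct_tprod_of_eq_counit (i : ι) (h : K) {β : ι → D k K} (hβ : β i = ε) :
    factorAct τ i h (PiTensorProduct.tprod k β) = ε h • PiTensorProduct.tprod k β := by
  classical
  rw [factorAct_apply, atFactor_tprod, hβ, endAct_counit, MultilinearMap.map_update_smul, ← hβ,
    Function.update_eq_self]

variable (k K) in
/-- The operators by which `K` acts on the factors in the list `l`, in this order. -/
def listAct (l : List ι) : WithConv (K →ₗ[k] Module.End k (⨂[k] _ : ι, D k K)) :=
  (l.map fun i => toConv (factorAct (k := k) (K := K) τ i)).prod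

@[simp]
theorem listAct_nil : listAct k K τ [] = 1 := rfl

@[simp]
theorem listAct_cons (i : ι) (l : List ι) :
    listAct k K τ (i :: l) = toConv (factorAct τ i) * listAct k K τ l := rfl

theorem listAct_append (l l' : List ι) :
    listAct k K τ (l ++ l') = listAct k K τ l * listAct k K τ l' := by
  simp [listAct]

variable {τ}

theorem listAct_commute {l : List ι} {X : Module.End k (⨂[k] _ : ι, D k K)}
    (hX : ∀ i ∈ l, ∀ h : K, Commute (factorAct τ i h) X) (h : K) :
    Commute ((listAct k K τ l).ofConv h) X := by
  revert h
  rw [← commute_convConst_iff]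
  refine Commute.list_prod_left _ _ fun f hf => ?_
  obtain ⟨i, hi, rfl⟩ := List.mem_map.1 hf
  exact (commute_convConst_iff _ _).2 (hX i hi)

theorem listAct_commute_atFactor {l : List ι} {i : ι} (hi : i ∉ l) (X : Module.End k (D k K))
    (h : K) : Commute ((listAct k K τ l).ofConv h) (atFactor k i X) :=
  listAct_commute (fun j hj _ =>
    factorAct_commute_atFactor τ (fun e : j = i => hi (e ▸ hj)) _ _) h

/-- Distinct factors carry commuting right actions; a repeated index would destroy the commutation
needed in `convMul_anti`. -/
theorem listAct_mul {l : List ι} (hl : l.Nodup) (h h' : K) : (listAct k K τ l).ofConv (h * h') =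
    (listAct k K τ l).ofConv h' * (listAct k K τ l).ofConv h := by
  induction l generalizing h h' with
  | nil => simp [LinearMap.convOne_def, Algebra.algebraMap_eq_smul_one, smul_smul]
  | cons i l ih =>
    rw [List.nodup_cons] at hl
    exact convMul_anti _ _ (factorAct_mul τ i) (ih hl.2)
      (fun x y => (listAct_commute_atFactor hl.1 _ y).symm) h h'

@[simp]
theorem listAct_apply_one (l : List ι) : (listAct k K τ l).ofConv 1 = 1 := by
  induction l with
  | nil => simp [LinearMap.convOne_def]
  | cons i l ih => rw [listAct_cons, convMul_one_apply, ih]; simp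

theorem listAct_apply_of_counit {l : List ι} {w : ⨂[k] _ : ι, D k K}
    (hw : ∀ i ∈ l, ∀ h : K, factorAct τ i h w = ε h • w) (h : K) :
    (listAct k K τ l).ofConv h w = ε h • w := by
  induction l generalizing h with
  | nil => simp [LinearMap.convOne_def, Algebra.algebraMap_eq_smul_one]
  | cons i l ih =>
    exact convMul_apply_of_counit _ _ w (hw i (by simp)) (ih fun j hj => hw j (by simp [hj])) h

variable [LinearOrder ι]

theorem toConv_tensorAct (s : Finset ι) :
    (toConv (tensorAct (k := k) (K := K) τ s)) = listAct k K τ (s.sort (· ≤ ·)) := rfl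

/-- Splits the iterated action into its parts below, at and above $i$. -/
theorem sort_eq_append {s : Finset ι} {i : ι} (hi : i ∈ s) :
    s.sort (· ≤ ·) = (s.filter (· < i)).sort (· ≤ ·) ++ i :: (s.filter (i < ·)).sort (· ≤ ·) := by
  refine List.Perm.eq_of_pairwise' (r := (· ≤ ·)) (Finset.pairwise_sort _ _) ?_ ?_
  · rw [List.pairwise_append]
    refine ⟨Finset.pairwise_sort _ _, List.pairwise_cons.2 ⟨fun j hj => ?_,
      Finset.pairwise_sort _ _⟩, fun a ha b hb => ?_⟩
    · simp at hj; exact hj.2.le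
    · simp at ha hb
      rcases hb with rfl | hb
      · exact ha.2.le
      · exact (ha.2.trans hb.2).le
  · rw [List.perm_ext_iff_of_nodup (Finset.sort_nodup _ _)]
    · intro a
      simp
      rcases lt_trichotomy a i with h | rfl | h
      · simp [h, h.ne, h.not_gt]
      · simp [hi]
      · simp [h, h.ne', h.not_gt]
    · rw [List.nodup_append]
      refine ⟨Finset.sort_nodup _ _, List.nodup_cons.2 ⟨by simp, Finset.sort_nodup _ _⟩, ?_⟩
      intro a ha b hb
      simp at ha hb
      rcases hb with rfl | hb
      · exact ha.2.ne
      · exact (ha.2.trans hb.2).ne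

variable (τ)

theorem tensorAct_mul (s : Finset ι) (h h' : K) :
    tensorAct (k := k) τ s (h * h') = tensorAct τ s h' * tensorAct τ s h :=
  listAct_mul (Finset.sort_nodup _ _) h h'

@[simp]
theorem tensorAct_one (s : Finset ι) : tensorAct (k := k) (K := K) τ s 1 = 1 :=
  listAct_apply_one _

variable {τ}

theorem tensorAct_commute {s : Finset ι} {X : Module.End k (⨂[k] _ : ι, D k K)}
    (hX : ∀ i ∈ s, ∀ h : K, Commute (factorAct τ i h) X) (h : K) :
    Commute (tensorAct τ s h) X :=
  listAct_commute (fun i hi => hX i (by simpa using hi)) h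

theorem tensorAct_apply_of_counit {s : Finset ι} {w : ⨂[k] _ : ι, D k K}
    (hw : ∀ i ∈ s, ∀ h : K, factorAct τ i h w = ε h • w) (h : K) :
    tensorAct τ s h w = ε h • w :=
  listAct_apply_of_counit (fun i hi => hw i (by simpa using hi)) h

end TensorAct

/-! ### Abstract exchange relations for operators twisted by an R-matrix. -/

section Exchange

variable {k K N B : Type*} [Field k] [Ring K] [HopfAlgebra k K] [AddCommMonoid N] [Module k N]
  [Semiring B] [Algebra k B] {R : K ⊗[k] K} {n : ℕ} {a b : Fin n → K}

/-- In the application $t$ acts on the factors below $i$, $A$ on factor $i$, and $M$ multiplies into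
factor $i$. Moving $A$ past $M$ puts the legs of $Δ(h)$ in the wrong order relative to $R$; $RΔ =
Δ^{op}R$ corrects this. -/
theorem IsRMatrix.exchange (hR : IsRMatrix k R) (hab : R = ∑ r, a r ⊗ₜ[k] b r)
    {o : K →ₗ[k] Module.End k N} (ho : ∀ h h', o (h * h') = o h' * o h)
    {t A : K →ₗ[k] B} (ht : ∀ h h', t (h * h') = t h' * t h) {M L : N →ₗ[k] B}
    (hL : ∀ x, L x = ∑ r, M (o (b r) x) * t (a r)) (htM : ∀ h x, Commute (t h) (M x))
    (hA : ∀ x, toConv A * convConst k K (M x) = toConv (M ∘ₗ o.flip x) * toConv A)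
    (hAt : ∀ h h', Commute (A h) (t h')) (x : N) :
    toConv t * toConv A * convConst k K (L x) =
      toConv (L ∘ₗ o.flip x) * (toConv t * toConv A) := by
  have hA' : toConv A * convConst k K (L x) =
      (∑ q, toConv (M ∘ₗ o.flip (o (b q) x)) * convConst k K (t (a q))) * toConv A := by
    rw [hL, convConst_sum, Finset.mul_sum, Finset.sum_mul]
    refine Finset.sum_congr rfl fun q _ => ?_
    have hAt' : Commute (toConv A) (convConst k K (t (a q))) := by
      rw [commute_convConst_iff]
      exact fun h => hAt _ _
    rw [convConst_mul, ← mul_assoc, hA, mul_assoc, hAt'.eq, mul_assoc]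
  have ht' : toConv t * (∑ q, toConv (M ∘ₗ o.flip (o (b q) x)) * convConst k K (t (a q))) =
      toConv (L ∘ₗ o.flip x) * toConv t := by
    rw [Finset.mul_sum]
    apply WithConv.ofConv_injective
    ext h : 1
    rw [WithConv.ofConv_sum, LinearMap.sum_apply, (ℛ k h).convMul_apply]
    simp only [← mul_assoc, convMul_convConst_apply]
    simp only [(ℛ k h).convMul_apply, LinearMap.comp_apply, LinearMap.flip_apply, hL,
      Finset.sum_mul]
    have h1 := hR.sum_mul_comul hab (F := fun y z => M (o z x) * t y) {} h
    rw [Finset.sum_comm (s := (ℛ k h).index)]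
    refine Eq.trans ?_ (h1.trans ?_)
    · refine Finset.sum_congr rfl fun q _ => Finset.sum_congr rfl fun p _ => ?_
      rw [(htM _ _).eq, mul_assoc, ← ht, ho, Module.End.mul_apply]
    · refine Finset.sum_congr rfl fun q _ => Finset.sum_congr rfl fun p _ => ?_
      rw [ht, ho, Module.End.mul_apply, mul_assoc]
  rw [mul_assoc, hA', ← mul_assoc, ht', mul_assoc]

/-- Two copies of $R$ appear on the left; $(\mathrm{id} ⊗ Δ)(R) = R_{13}R_{12}$ merges them into one
acting on the product $m(x, y)$. -/
theorem IsRMatrix.exchange_same (hR : IsRMatrix k R) (hab : R = ∑ r, a r ⊗ₜ[k] b r)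
    {o : K →ₗ[k] Module.End k N} {m : N →ₗ[k] N →ₗ[k] N} (ho : IsModuleAlgebraAct o m)
    {t : K →ₗ[k] B} (ht : ∀ h h', t (h * h') = t h' * t h) {M L : N →ₗ[k] B}
    (hM : ∀ x y, M x * M y = M (m x y))
    (hL : ∀ x, L x = ∑ r, M (o (b r) x) * t (a r)) (htM : ∀ h x, Commute (t h) (M x)) (x y : N) :
    L x * L y = L (m x y) := by
  simp only [hL, Finset.sum_mul_sum]
  have h1 := hR.sum_comul_right hab (F := fun u v w => M (m (o v x) (o w y)) * t u) {}
  rw [Finset.sum_comm]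
  refine Eq.trans ?_ (h1.symm.trans ?_)
  · refine Finset.sum_congr rfl fun q _ => Finset.sum_congr rfl fun p _ => ?_
    rw [mul_assoc, ← mul_assoc (t _), (htM _ _).eq, ht, ← hM]
    simp only [mul_assoc]
  · refine Finset.sum_congr rfl fun q _ => ?_
    rw [ho, map_sum, Finset.sum_mul]

/-- Moving $t(R_1)$ past $L'$ splits $R_1$ by $Δ$; by $(Δ ⊗ \mathrm{id})(R) = R_{13}R_{23}$ one copy
of $R$ becomes the exchange factor and the other reconstitutes $L$. -/
theorem IsRMatrix.exchange_lt (hR : IsRMatrix k R) (hab : R = ∑ r, a r ⊗ₜ[k] b r)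
    {o o' : K →ₗ[k] Module.End k N} (ho : ∀ h h', o (h * h') = o h' * o h)
    {t : K →ₗ[k] B} {M L L' : N →ₗ[k] B}
    (hL : ∀ x, L x = ∑ r, M (o (b r) x) * t (a r))
    (ht : ∀ x, toConv t * convConst k K (L' x) = toConv (L' ∘ₗ o'.flip x) * toConv t)
    (hML : ∀ x y, Commute (M x) (L' y)) (x y : N) :
    L x * L' y = ∑ r, L' (o' (a r) y) * L (o (b r) x) := by
  have h0 : ∀ u v, M (o v x) * t u * L' y = ∑ p ∈ (ℛ k u).index,
      L' (o' ((ℛ k u).left p) y) * M (o v x) * t ((ℛ k u).right p) := by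
    intro u v
    have e := LinearMap.congr_fun (congrArg ofConv (ht y)) u
    rw [convMul_convConst_apply, (ℛ k u).convMul_apply] at e
    rw [mul_assoc, e, Finset.mul_sum]
    refine Finset.sum_congr rfl fun p _ => ?_
    rw [← mul_assoc]
    exact congrArg (· * _) (hML _ _).eq
  have h1 := hR.sum_comul_left hab (F := fun u v w => L' (o' u y) * M (o w x) * t v) {}
  conv_lhs => rw [hL, Finset.sum_mul]
  simp only [h0]
  rw [h1]
  refine Finset.sum_congr rfl fun r _ => ?_
  rw [hL, Finset.mul_sum]
  refine Finset.sum_congr rfl fun q _ => ?_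
  rw [ho, mul_assoc]
  rfl

end Exchange

/-! ### Generators of the vertex algebra and their relations. -/

section GenMul

variable {k K : Type*} [Field k] [Ring K] [HopfAlgebra k K] {ι : Type*} [Finite ι] [LinearOrder ι]
  {R : K ⊗[k] K} {n : ℕ} {a b : Fin n → K} {σ τ : ι → Bool}

local notation "ε" => Coalgebra.counit (R := k) (A := K)

/-- The indices less than `i`. -/
def below (i : ι) : Finset ι :=
  haveI := Fintype.ofFinite ι
  Finset.univ.filter (· < i)

@[simp]
theorem mem_below {i j : ι} : j ∈ below i ↔ j < i := by simp [below]

variable (R σ τ) in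
/-- The product with `α` in the `i`th factor. -/
def factorMul (i : ι) : D k K →ₗ[k] Module.End k (⨂[k] _ : ι, D k K) :=
  atFactor k i ∘ₗ endMul R (σ i) (τ i)

omit [Finite ι] [LinearOrder ι] in
theorem factorMul_apply (i : ι) (α : D k K) :
    factorMul R σ τ i α = atFactor k i (endMul R (σ i) (τ i) α) := rfl

theorem genMul_apply (hab : R = ∑ r, a r ⊗ₜ[k] b r) (i : ι) (α : D k K) :
    genMul R σ τ i α =
      ∑ r, factorMul R σ τ i (endAct k K (τ i) (b r) α) * tensorAct τ (below i) (a r) := by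
  have h := fun f : K ⊗[k] K →ₗ[k] D k K →ₗ[k] Module.End k (⨂[k] _ : ι, D k K) =>
    (congrArg f hab).trans (map_sum f _ _)
  exact (LinearMap.congr_fun (h _) α).trans (LinearMap.sum_apply _ _ _)

omit [Finite ι] [LinearOrder ι] in
theorem factorMul_mul (hR : IsRMatrix k R) (i : ι) (α β : D k K) :
    factorMul R σ τ i α * factorMul R σ τ i β =
      factorMul R σ τ i (endMul R (σ i) (τ i) α β) := by
  simp only [factorMul_apply, ← atFactor_mul]
  congr 1
  ext γ : 1
  exact (hR.endMul_assoc _ _ _ _ _).symm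

omit [Finite ι] [LinearOrder ι] in
theorem factorAct_mul_factorMul (hR : IsRMatrix k R) (i : ι) (α : D k K) :
    toConv (factorAct (k := k) τ i) * convConst k K (factorMul R σ τ i α) =
      toConv (factorMul R σ τ i ∘ₗ (endAct k K (τ i)).flip α) * toConv (factorAct τ i) := by
  ext h : 2
  rw [convMul_convConst_apply, (ℛ k h).convMul_apply]
  simp only [factorAct_apply, factorMul_apply, LinearMap.comp_apply, LinearMap.flip_apply,
    ← atFactor_mul, ← map_sum]
  congr 1
  ext β : 1
  simpa using hR.isModuleAlgebraAct_endAct (σ i) (τ i) h α β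

omit [Finite ι] in
theorem commute_tensorAct_factorMul {s : Finset ι} {i : ι} (hi : i ∉ s) (h : K) (α : D k K) :
    Commute (tensorAct τ s h) (factorMul R σ τ i α) :=
  tensorAct_commute (fun j hj _ =>
    factorAct_commute_atFactor τ (fun e : j = i => hi (e ▸ hj)) _ _) h

theorem commute_genMul {i : ι} {X : Module.End k (⨂[k] _ : ι, D k K)}
    (h1 : ∀ f : Module.End k (D k K), Commute X (atFactor k i f))
    (h2 : ∀ j < i, ∀ h : K, Commute (factorAct τ j h) X) (α : D k K) :
    Commute X (genMul R σ τ i α) := by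
  obtain ⟨n, a, b, hab⟩ := exists_sum_tmul R
  rw [genMul_apply hab]
  refine Commute.sum_right _ _ _ fun r _ => (h1 _).mul_right ?_
  exact (tensorAct_commute (fun j hj => h2 j (mem_below.1 hj)) _).symm

/-- The set $s$ has to contain everything below $i$, since `genMul` acts there. It is applied to all
indices, for the module algebra property, and to the indices below a larger one, for the exchange
relation. -/
theorem tensorAct_mul_genMul (hR : IsRMatrix k R) {s : Finset ι} {i : ι} (hi : i ∈ s)
    (hs : ∀ j < i, j ∈ s) (α : D k K) :
    toConv (tensorAct (k := k) τ s) * convConst k K (genMul R σ τ i α) =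
      toConv (genMul R σ τ i ∘ₗ (endAct k K (τ i)).flip α) * toConv (tensorAct τ s) := by
  obtain ⟨n, a, b, hab⟩ := exists_sum_tmul R
  have hbelow : s.filter (· < i) = below i := by
    ext j; simpa using fun h => hs j h
  have hT : toConv (tensorAct (k := k) (K := K) τ s) = toConv (tensorAct τ (below i)) *
      (toConv (factorAct τ i) * listAct k K τ ((s.filter (i < ·)).sort (· ≤ ·))) := by
    rw [toConv_tensorAct, sort_eq_append hi, listAct_append, listAct_cons, hbelow]
    rfl
  set r := listAct k K τ ((s.filter (i < ·)).sort (· ≤ ·))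
  -- The factors above $i$ are untouched by `genMul R σ τ i α`.
  have hr : Commute r (convConst k K (genMul R σ τ i α)) := by
    rw [commute_convConst_iff]
    refine listAct_commute fun j hj h => ?_
    have hij : i < j := by simpa using (Finset.mem_filter.1 ((Finset.mem_sort _).1 hj)).2
    exact commute_genMul (fun f => factorAct_commute_atFactor τ hij.ne' _ _)
      (fun l hl h' => factorAct_commute τ (hl.trans hij).ne _ _) α
  rw [hT, ← mul_assoc, mul_assoc, hr.eq, ← mul_assoc, hR.exchange hab (endAct_mul (τ i))
    (tensorAct_mul τ (below i)) (genMul_apply hab i)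
    (fun h x => commute_tensorAct_factorMul (by simp) h x) (factorAct_mul_factorMul hR i)
    (fun h h' => (tensorAct_commute (fun j hj h' =>
      factorAct_commute τ (mem_below.1 hj).ne _ _) _).symm), mul_assoc]

theorem genMul_mul_genMul_same (hR : IsRMatrix k R) (i : ι) (α β : D k K) :
    genMul R σ τ i α * genMul R σ τ i β = genMul R σ τ i (endMul R (σ i) (τ i) α β) := by
  obtain ⟨n, a, b, hab⟩ := exists_sum_tmul R
  exact hR.exchange_same hab (hR.isModuleAlgebraAct_endAct (σ i) (τ i)) (tensorAct_mul τ (below i))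
    (factorMul_mul hR i) (genMul_apply hab i)
    (fun h x => commute_tensorAct_factorMul (by simp) h x) α β

omit [Finite ι] [LinearOrder ι] in
theorem factorMul_commute_atFactor {i j : ι} (hij : i ≠ j) (x : D k K)
    (f : Module.End k (D k K)) : Commute (factorMul R σ τ i x) (atFactor k j f) := by
  rw [factorMul_apply]
  exact atFactor_commute hij _ f

omit [Finite ι] [LinearOrder ι] in
theorem factorAct_commute_factorMul {i j : ι} (hij : i ≠ j) (x : K) (y : D k K) :
    Commute (factorAct τ j x) (factorMul R σ τ i y) := by
  rw [factorMul_apply]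
  exact factorAct_commute_atFactor τ hij.symm x _

theorem factorMul_commute_genMul {i j : ι} (hij : j < i) (x y : D k K) :
    Commute (factorMul R σ τ i x) (genMul R σ τ j y) := by
  have h1 := fun f => factorMul_commute_atFactor (R := R) (σ := σ) (τ := τ) hij.ne' x f
  have h2 := fun l (hl : l < j) h =>
    factorAct_commute_factorMul (R := R) (σ := σ) (τ := τ) (hl.trans hij).ne' h x
  exact commute_genMul h1 h2 y

/-- The action on the factors below $i$ contained in the first operator includes factor $j$ and all
below it, so it passes the second operator as an action passes an element of a module algebra. -/
theorem genMul_mul_genMul (hR : IsRMatrix k R) (hab : R = ∑ r, a r ⊗ₜ[k] b r) {i j : ι}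
    (hij : j < i) (α β : D k K) :
    genMul R σ τ i α * genMul R σ τ j β =
      ∑ r, genMul R σ τ j (endAct k K (τ j) (a r) β) *
        genMul R σ τ i (endAct k K (τ i) (b r) α) := by
  have ht := tensorAct_mul_genMul (σ := σ) (τ := τ) hR (s := below i) (mem_below.2 hij)
    fun l hl => mem_below.2 (hl.trans hij)
  exact hR.exchange_lt hab (endAct_mul (τ i)) (genMul_apply hab i) ht
    (factorMul_commute_genMul hij) α β

omit [Finite ι] in
theorem tensorAct_tprod_of_eq_counit {s : Finset ι} (h : K) {β : ι → D k K}
    (hβ : ∀ j ∈ s, β j = ε) : tensorAct τ s h (PiTensorProduct.tprod k β) =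
      ε h • PiTensorProduct.tprod k β :=
  tensorAct_apply_of_counit (fun j hj h' => factorAct_tprod_of_eq_counit τ j h' (hβ j hj)) h

/-- On units $R_1$ acts by the counit, and $(ε ⊗ \mathrm{id})(R) = 1$ removes $R$. -/
theorem genMul_tprod (hR : IsRMatrix k R) (i : ι) (α : D k K) {β : ι → D k K}
    (hβ : ∀ j ≤ i, β j = ε) : genMul R σ τ i α (PiTensorProduct.tprod k β) =
      PiTensorProduct.tprod k (Function.update β i α) := by
  obtain ⟨n, a, b, hab⟩ := exists_sum_tmul R
  rw [genMul_apply hab]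
  have h1 : ∀ r, (factorMul R σ τ i (endAct k K (τ i) (b r) α) * tensorAct τ (below i) (a r) :
      Module.End k (⨂[k] _ : ι, D k K))
      (PiTensorProduct.tprod k β) =
      factorMul R σ τ i (endAct k K (τ i) (ε (a r) • b r) α) (PiTensorProduct.tprod k β) := by
    intro r
    rw [Module.End.mul_apply, tensorAct_tprod_of_eq_counit _
      fun j hj => hβ j (mem_below.1 hj).le]
    simp
  simp only [LinearMap.sum_apply, h1]
  simp only [← LinearMap.sum_apply, ← map_sum, hR.sum_counit_left hab]
  rw [endAct_one, Module.End.one_apply, factorMul_apply, atFactor_tprod, hβ i le_rfl,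
    hR.endMul_counit]

theorem genMul_counit (hR : IsRMatrix k R) (i : ι) : genMul R σ τ i ε = 1 := by
  obtain ⟨n, a, b, hab⟩ := exists_sum_tmul R
  have h1 : factorMul R σ τ i ε = 1 := by
    rw [factorMul_apply, ← atFactor_one i]
    congr 1
    ext γ : 1
    exact hR.counit_endMul _ _ γ
  have h2 : ∀ r, factorMul R σ τ i (endAct k K (τ i) (b r) ε) * tensorAct τ (below i) (a r) =
      tensorAct τ (below i) (ε (b r) • a r) := by
    intro r; rw [endAct_counit, map_smul, h1, smul_one_mul, map_smul]
  rw [genMul_apply hab]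
  simp only [h2]
  rw [← map_sum, hR.sum_counit_right hab, tensorAct_one]

end GenMul

/-! ### The multiplication of the vertex algebra as a regular representation. -/

section Single

variable {k K : Type*} [Field k] [Ring K] [HopfAlgebra k K] {ι : Type*} [DecidableEq ι]

local notation "ε" => Coalgebra.counit (R := k) (A := K)

theorem single_eq (i : ι) (α : D k K) :
    single i α = PiTensorProduct.tprod k (Function.update (fun _ => ε) i α) := by
  rw [single]; congr!

theorem pairAt_eq (i j : ι) (α β : D k K) : pairAt i j α β =
    PiTensorProduct.tprod k (Function.update (Function.update (fun _ => ε) i α) j β) := by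
  rw [pairAt]; congr!

theorem pairAt_comm {i j : ι} (hij : i ≠ j) (α β : D k K) : pairAt i j α β = pairAt j i β α := by
  rw [pairAt_eq, pairAt_eq, Function.update_comm hij]

end Single

section VertexMul

variable {k K : Type*} [Field k] [Ring K] [HopfAlgebra k K] {ι : Type*} [Finite ι] [LinearOrder ι]
  {R : K ⊗[k] K} {σ τ : ι → Bool}

local notation "ε" => Coalgebra.counit (R := k) (A := K)

variable (ι) in
/-- The increasing list of all indices. -/
def idxList : List ι :=
  haveI := Fintype.ofFinite ι
  List.ofFn (monoEquivOfFin ι rfl)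

theorem pairwise_idxList : (idxList ι).Pairwise (· < ·) := by
  rw [idxList, List.pairwise_ofFn]
  intro i j hij
  simpa using hij

theorem mem_idxList (i : ι) : i ∈ idxList ι := by
  rw [idxList, List.mem_ofFn]
  exact (OrderIso.surjective _) i

variable (R σ τ) in
/-- The product of the operators of left multiplication by `(α i)ᵢ` for `i` in the list `l`. -/
def monomial (l : List ι) (α : ι → D k K) : Module.End k (⨂[k] _ : ι, D k K) :=
  (l.map fun i => genMul R σ τ i (α i)).prod

@[simp]
theorem monomial_nil (α : ι → D k K) : monomial R σ τ [] α = 1 := rfl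

@[simp]
theorem monomial_cons (i : ι) (l : List ι) (α : ι → D k K) :
    monomial R σ τ (i :: l) α = genMul R σ τ i (α i) * monomial R σ τ l α := rfl

theorem vertexMul_tprod (α : ι → D k K) :
    vertexMul R σ τ (PiTensorProduct.tprod k α) = monomial R σ τ (idxList ι) α := by
  rw [vertexMul, PiTensorProduct.lift.tprod]
  simp [monomial, idxList, MultilinearMap.mkPiAlgebraFin_apply, List.map_ofFn, Function.comp_def]

theorem monomial_congr {l : List ι} {α β : ι → D k K} (h : ∀ i ∈ l, α i = β i) :
    monomial R σ τ l α = monomial R σ τ l β := by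
  rw [monomial, monomial, List.map_congr_left fun i hi => by rw [h i hi]]

/-- In an increasing product each operator meets a tensor with units up to its own place, so it
simply inserts its entry. -/
theorem monomial_apply_one (hR : IsRMatrix k R) {l : List ι} (hl : l.Pairwise (· < ·))
    (α : ι → D k K) : monomial R σ τ l α (fnOne k K ι) =
      PiTensorProduct.tprod k (fun i => if i ∈ l then α i else ε) := by
  induction l with
  | nil => simp [fnOne]
  | cons i l ih =>
    rw [List.pairwise_cons] at hl
    rw [monomial_cons, Module.End.mul_apply, ih hl.2, genMul_tprod hR]
    · congr 1
      ext j : 1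
      by_cases h : j = i
      · subst h; simp
      · simp [h]
    · intro j hj
      rw [if_neg fun h => (hl.1 j h).not_ge hj]

theorem vertexMul_apply_one (hR : IsRMatrix k R) (x : ⨂[k] _ : ι, D k K) :
    vertexMul R σ τ x (fnOne k K ι) = x := by
  induction x using PiTensorProduct.induction_on with
  | smul_tprod c α =>
    rw [map_smul, LinearMap.smul_apply, vertexMul_tprod, monomial_apply_one hR pairwise_idxList]
    simp [mem_idxList]
  | add x y hx hy => rw [map_add, LinearMap.add_apply, hx, hy]

theorem vertexMul_one (hR : IsRMatrix k R) : vertexMul R σ τ (fnOne k K ι) = 1 := by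
  rw [fnOne, vertexMul_tprod]
  generalize idxList ι = l
  induction l with
  | nil => rfl
  | cons i l ih => rw [monomial_cons, ih, genMul_counit hR, one_mul]

/-- The unit is cyclic: ordered monomials applied to it give all pure tensors. -/
theorem vertex_induction (hR : IsRMatrix k R) {p : Submodule k (⨂[k] _ : ι, D k K)}
    (h1 : fnOne k K ι ∈ p) (hp : ∀ i α, ∀ x ∈ p, genMul R σ τ i α x ∈ p)
    (x : ⨂[k] _ : ι, D k K) : x ∈ p := by
  induction x using PiTensorProduct.induction_on with
  | smul_tprod c α =>
    refine p.smul_mem c ?_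
    rw [← vertexMul_apply_one (σ := σ) (τ := τ) hR (PiTensorProduct.tprod k α), vertexMul_tprod]
    generalize idxList ι = l
    induction l with
    | nil => exact h1
    | cons i l ih => exact hp i _ _ ih
  | add x y hx hy => exact p.add_mem hx hy

/-- Normal ordering: a generator on the left moves through the ordered product to its own place by
the relations for $i > j$ and is absorbed there by the relation for equal indices. -/
theorem range_genMul_mul_le (hR : IsRMatrix k R) {l : List ι} (hl : l.Pairwise (· < ·)) {i : ι}
    (hi : i ∈ l) : LinearMap.range (genMul R σ τ i) *
      (l.map fun j => LinearMap.range (genMul R σ τ j)).prod ≤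
      (l.map fun j => LinearMap.range (genMul R σ τ j)).prod := by
  induction l with
  | nil => simp at hi
  | cons j l ih =>
    rw [List.pairwise_cons] at hl
    rw [List.map_cons, List.prod_cons, ← mul_assoc]
    by_cases hij : i = j
    · subst hij
      refine mul_le_mul' ?_ le_rfl
      rw [Submodule.mul_le]
      rintro _ ⟨α, rfl⟩ _ ⟨β, rfl⟩
      rw [genMul_mul_genMul_same hR]
      exact LinearMap.mem_range_self _ _
    · have hil : i ∈ l := (List.mem_cons.1 hi).resolve_left hij
      have h1 : LinearMap.range (genMul R σ τ i) * LinearMap.range (genMul R σ τ j) ≤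
          LinearMap.range (genMul R σ τ j) * LinearMap.range (genMul R σ τ i) := by
        rw [Submodule.mul_le]
        rintro _ ⟨α, rfl⟩ _ ⟨β, rfl⟩
        obtain ⟨n, a, b, hab⟩ := exists_sum_tmul R
        rw [genMul_mul_genMul hR hab (hl.1 i hil)]
        exact Submodule.sum_mem _ fun r _ =>
          Submodule.mul_mem_mul (LinearMap.mem_range_self _ _) (LinearMap.mem_range_self _ _)
      refine (mul_le_mul' h1 le_rfl).trans ?_
      rw [mul_assoc]
      exact mul_le_mul' le_rfl (ih hl.2 hil)

/-- Without repetitions the entries of a monomial can be prescribed independently. -/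
theorem prod_range_genMul_le {l : List ι} (hl : l.Nodup) :
    (l.map fun j => LinearMap.range (genMul R σ τ j)).prod ≤
      Submodule.span k (Set.range (monomial R σ τ l)) := by
  induction l with
  | nil =>
    rw [List.map_nil, List.prod_nil, Submodule.one_eq_span, Submodule.span_le]
    rintro _ rfl
    exact Submodule.subset_span ⟨fun _ => 0, rfl⟩
  | cons i l ih =>
    rw [List.nodup_cons] at hl
    rw [List.map_cons, List.prod_cons, Submodule.mul_le]
    rintro _ ⟨α, rfl⟩ y hy
    have hy' := ih hl.2 hy
    clear hy
    induction hy' using Submodule.span_induction with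
    | mem y hy =>
      obtain ⟨β, rfl⟩ := hy
      refine Submodule.subset_span ⟨Function.update β i α, ?_⟩
      rw [monomial_cons, Function.update_self, monomial_congr (β := β)]
      intro j hj
      exact Function.update_of_ne (fun h : j = i => hl.1 (h ▸ hj)) _ _
    | zero => rw [mul_zero]; exact Submodule.zero_mem _
    | add y z _ _ hy hz => rw [mul_add]; exact Submodule.add_mem _ hy hz
    | smul c y _ hy => rw [mul_smul_comm]; exact Submodule.smul_mem _ c hy

theorem vertexMul_mem (x : ⨂[k] _ : ι, D k K) : vertexMul R σ τ x ∈
    ((idxList ι).map fun j => LinearMap.range (genMul R σ τ j)).prod := by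
  induction x using PiTensorProduct.induction_on with
  | smul_tprod c α =>
    rw [map_smul, vertexMul_tprod]
    refine Submodule.smul_mem _ c ?_
    generalize idxList ι = l
    induction l with
    | nil => exact Submodule.one_le.1 le_rfl
    | cons i l ih => exact Submodule.mul_mem_mul (LinearMap.mem_range_self _ _) ih
  | add x y hx hy => rw [map_add]; exact Submodule.add_mem _ hx hy

/-- Left multiplication by `(α)ᵢ x` is the composite of those by `(α)ᵢ` and by `x`. -/
theorem vertexMul_genMul (hR : IsRMatrix k R) (i : ι) (α : D k K) (x : ⨂[k] _ : ι, D k K) :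
    vertexMul R σ τ (genMul R σ τ i α x) = genMul R σ τ i α * vertexMul R σ τ x := by
  have h1 := range_genMul_mul_le (σ := σ) (τ := τ) hR pairwise_idxList (mem_idxList i)
    (Submodule.mul_mem_mul (LinearMap.mem_range_self (genMul R σ τ i) α)
      (vertexMul_mem (R := R) (σ := σ) (τ := τ) x))
  have h2 : Submodule.span k (Set.range (monomial R σ τ (idxList ι))) ≤
      LinearMap.range (vertexMul R σ τ) := by
    rw [Submodule.span_le]
    rintro _ ⟨β, rfl⟩
    exact ⟨PiTensorProduct.tprod k β, vertexMul_tprod β⟩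
  -- Normal ordering shows that the right-hand operator is left multiplication by some $y$;
  -- evaluation at the unit identifies $y$.
  obtain ⟨y, hy⟩ := h2 (prod_range_genMul_le pairwise_idxList.nodup h1)
  rw [← hy]
  congr 1
  rw [← vertexMul_apply_one (σ := σ) (τ := τ) hR y, hy, Module.End.mul_apply,
    vertexMul_apply_one hR]

theorem vertexMul_assoc (hR : IsRMatrix k R) (x y : ⨂[k] _ : ι, D k K) :
    vertexMul R σ τ (vertexMul R σ τ x y) = vertexMul R σ τ x * vertexMul R σ τ y := by
  let p : Submodule k (⨂[k] _ : ι, D k K) := LinearMap.eqLocus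
    (vertexMul R σ τ ∘ₗ (vertexMul R σ τ).flip y)
    (LinearMap.mulRight k (vertexMul R σ τ y) ∘ₗ vertexMul R σ τ)
  refine vertex_induction (p := p) (σ := σ) (τ := τ) hR ?_ ?_ x
  · change vertexMul R σ τ (vertexMul R σ τ (fnOne k K ι) y) = vertexMul R σ τ (fnOne k K ι) * vertexMul R σ τ y
    rw [vertexMul_one hR, one_mul, Module.End.one_apply]
  · intro i α z hz
    change vertexMul R σ τ (vertexMul R σ τ (genMul R σ τ i α z) y) =
      vertexMul R σ τ (genMul R σ τ i α z) * vertexMul R σ τ y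
    rw [vertexMul_genMul hR, Module.End.mul_apply, vertexMul_genMul hR, mul_assoc]
    exact congrArg _ hz

theorem genMul_apply_one (hR : IsRMatrix k R) (i : ι) (α : D k K) :
    genMul R σ τ i α (fnOne k K ι) = single i α := by
  rw [fnOne, genMul_tprod hR i α fun _ _ => rfl, single_eq]

theorem vertexMul_single (hR : IsRMatrix k R) (i : ι) (α : D k K) :
    vertexMul R σ τ (single i α) = genMul R σ τ i α := by
  rw [← genMul_apply_one (σ := σ) (τ := τ) hR, vertexMul_genMul hR, vertexMul_one hR, mul_one]

theorem genMul_single_of_lt (hR : IsRMatrix k R) {i j : ι} (hij : i < j) (α β : D k K) :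
    genMul R σ τ i α (single j β) = pairAt i j α β := by
  rw [single_eq, genMul_tprod hR, pairAt_eq]
  · rw [Function.update_comm hij.ne]
  · intro l hl
    rw [Function.update_of_ne (hl.trans_lt hij).ne]

theorem vertexRelations (hR : IsRMatrix k R) :
    VertexRelations R σ τ (vertexMul R σ τ) where
  same i α β := by
    rw [vertexMul_single hR, ← genMul_apply_one (σ := σ) (τ := τ) hR, ← Module.End.mul_apply,
      genMul_mul_genMul_same hR, genMul_apply_one hR]
  lt i j α β hij := by rw [vertexMul_single hR, genMul_single_of_lt hR hij]
  gt i j α β hij := by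
    obtain ⟨n, a, b, hab⟩ := exists_sum_tmul R
    rw [vertexMul_single hR, ← genMul_apply_one (σ := σ) (τ := τ) hR j, ← Module.End.mul_apply,
      genMul_mul_genMul hR hab hij]
    have h1 := fun f : K ⊗[k] K →ₗ[k] Module.End k (⨂[k] _ : ι, D k K) =>
      (congrArg f hab).trans (map_sum f _ _)
    rw [h1]
    simp only [LinearMap.sum_apply]
    refine Finset.sum_congr rfl fun r _ => ?_
    rw [Module.End.mul_apply, genMul_apply_one hR, genMul_single_of_lt hR hij,
      TensorProduct.lift.tmul, LinearMap.compl₁₂_apply, LinearMap.mul_apply', Module.End.mul_apply]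
    simp only [pairAt_eq, factorAct_apply, atFactor_tprod]
    congr 1
    ext l : 1
    by_cases h1 : l = i
    · subst h1; simp [hij.ne']
    · by_cases h2 : l = j
      · subst h2; simp [hij.ne]
      · simp [h1, h2]
  ordered i α β hβ := by
    rw [vertexMul_single hR, genMul_tprod hR i α hβ]

end VertexMul

/-! ### Compatibility with products, checked on generators. -/

section Generators

variable {k C N W ι : Type*} [Field k] [AddCommGroup C] [Module k C] [Coalgebra k C]
  [AddCommMonoid N] [Module k N] [AddCommMonoid W] [Module k W]

theorem IsModuleAlgebraAct.mul_eq {o : C →ₗ[k] Module.End k W} {m : W →ₗ[k] W →ₗ[k] W}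
    (ho : IsModuleAlgebraAct o m) (h : C) (x : W) : (o h * m x : Module.End k W) =
      ∑ p ∈ (ℛ k h).index, m (o ((ℛ k h).left p) x) * o ((ℛ k h).right p) := by
  ext y : 1
  simpa using ho h x y

theorem IsModuleAlgebraAct.mul_eq_cop {K : Type*} [Ring K] [HopfAlgebra k K]
    {o : K →ₗ[k] Module.End k W} {m : W →ₗ[k] W →ₗ[k] W}
    (ho : IsModuleAlgebraAct (o ∘ₗ ofCop k K) m) (h : K) (x : W) :
    (o h * m x : Module.End k W) =
      ∑ p ∈ (ℛ k h).index, m (o ((ℛ k h).right p) x) * o ((ℛ k h).left p) := by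
  ext y : 1
  simpa using isModuleAlgebraAct_cop.1 ho h x y

theorem isModuleAlgebraAct_iff_conv {o : C →ₗ[k] Module.End k W} {m : W →ₗ[k] W →ₗ[k] W} :
    IsModuleAlgebraAct o m ↔
      ∀ x, toConv o * convConst k C (m x) = toConv (m ∘ₗ o.flip x) * toConv o := by
  have key : ∀ x h, (toConv o * convConst k C (m x)).ofConv h =
      (toConv (m ∘ₗ o.flip x) * toConv o).ofConv h ↔
      ∀ y, o h (m x y) =
        ∑ p ∈ (ℛ k h).index, m (o ((ℛ k h).left p) x) (o ((ℛ k h).right p) y) := by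
    intro x h
    rw [convMul_convConst_apply, (ℛ k h).convMul_apply, LinearMap.ext_iff]
    simp
  constructor
  · intro H x
    ext h : 2
    exact (key x h).2 (H h x)
  · intro H h x
    exact (key x h).1 (by rw [H x])

/-- Compatibility with a product can be checked on generators. -/
theorem isModuleAlgebraAct_of_generators {o : C →ₗ[k] Module.End k W} {m : W →ₗ[k] W →ₗ[k] W}
    {e : W} {L : ι → N →ₗ[k] Module.End k W} {c : ι → C →ₗ[k] Module.End k N}
    (ind : ∀ p : Submodule k W, e ∈ p → (∀ i α, ∀ x ∈ p, L i α x ∈ p) → ∀ x, x ∈ p)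
    (he : m e = 1) (hL : ∀ i α x, m (L i α x) = L i α * m x)
    (ho : ∀ h, o h e = Coalgebra.counit (R := k) h • e)
    (hoL : ∀ i α, toConv o * convConst k C (L i α) =
      toConv (L i ∘ₗ (c i).flip α) * toConv o) : IsModuleAlgebraAct o m := by
  rw [isModuleAlgebraAct_iff_conv]
  -- The elements $x$ whose left multiplications satisfy the convolution identity form a subspace;
  -- it contains the unit and is stable under generators.
  let p : Submodule k W :=
    { carrier := {x | toConv o * convConst k C (m x) = toConv (m ∘ₗ o.flip x) * toConv o}
      zero_mem' := by
        simp [convConst]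
      add_mem' := by
        intro x y hx hy
        have h1 : convConst k C (m (x + y)) = convConst k C (m x) + convConst k C (m y) := by
          ext; simp [convConst]
        have h2 : toConv (m ∘ₗ o.flip (x + y)) =
            toConv (m ∘ₗ o.flip x) + toConv (m ∘ₗ o.flip y) := by
          ext; simp
        simp only [Set.mem_ofPred_eq] at hx hy ⊢
        rw [h1, h2, mul_add, hx, hy, add_mul]
      smul_mem' := by
        intro r x hx
        have h1 : convConst k C (m (r • x)) = r • convConst k C (m x) := by
          ext; simp [convConst, smul_comm r]
        have h2 : toConv (m ∘ₗ o.flip (r • x)) = r • toConv (m ∘ₗ o.flip x) := by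
          ext; simp
        simp only [Set.mem_ofPred_eq] at hx ⊢
        rw [h1, h2, mul_smul_comm, hx, smul_mul_assoc] }
  refine ind p ?_ fun i α x hx => ?_
  · have h1 : toConv (m ∘ₗ o.flip e) = convConst k C (1 : Module.End k W) := by
      ext h : 2
      simp [convConst, ho, he]
    change _ = _
    rw [h1, he]
    ext h : 2
    rw [convMul_convConst_apply, convConst_convMul_apply, one_mul, mul_one]
  · have h1 : toConv (m ∘ₗ o.flip (L i α x)) =
        toConv (L i ∘ₗ (c i).flip α) * toConv (m ∘ₗ o.flip x) := by
      ext h : 2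
      have h2 := LinearMap.congr_fun (LinearMap.congr_fun (congrArg ofConv (hoL i α)) h) x
      rw [convMul_convConst_apply, (ℛ k h).convMul_apply] at h2
      simp only [LinearMap.sum_apply, Module.End.mul_apply, LinearMap.comp_apply,
        LinearMap.flip_apply] at h2
      rw [(ℛ k h).convMul_apply]
      simp only [LinearMap.comp_apply, LinearMap.flip_apply, h2, map_sum, hL]
    have hx' : toConv o * convConst k C (m x) = toConv (m ∘ₗ o.flip x) * toConv o := hx
    change _ = _
    rw [hL, convConst_mul, ← mul_assoc, hoL, mul_assoc, hx', ← mul_assoc, ← h1]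

end Generators

/-! ### Twisting a product by an R-matrix. -/

section Twist

variable {k K N W : Type*} [Field k] [Ring K] [HopfAlgebra k K] [AddCommMonoid N] [Module k N]
  [AddCommMonoid W] [Module k W] {R : K ⊗[k] K} {n : ℕ} {a b : Fin n → K}

/-- The twisted left multiplication of a twisted generator applied to $x$ is the composite of the
two twisted operators. As in `sum_hexagon` this is the twist condition, here for a left action, so
the legs of $R$ multiply in the opposite order and the two hexagon axioms are used separately around
Yang-Baxter. -/
theorem IsRMatrix.twist_step (hR : IsRMatrix k R) (hab : R = ∑ r, a r ⊗ₜ[k] b r)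
    {m : W →ₗ[k] W →ₗ[k] W} {C : K →ₗ[k] Module.End k W} {c : K →ₗ[k] Module.End k N}
    {L : N →ₗ[k] Module.End k W} (hL : ∀ α x, m (L α x) = L α * m x)
    (hC : ∀ h h', C (h * h') = C h * C h') (hc : ∀ h h', c (h * h') = c h * c h')
    (hCm : IsModuleAlgebraAct C m)
    (hCL : ∀ h α, C h * L α =
      ∑ p ∈ (ℛ k h).index, L (c ((ℛ k h).left p) α) * C ((ℛ k h).right p)) (α : N) (x : W) :
    ∑ r, m (C (b r) ((∑ s, L (c (b s) α) * C (a s) : Module.End k W) x)) * C (a r) =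
      (∑ s, L (c (b s) α) * C (a s)) * ∑ r, m (C (b r) x) * C (a r) := by
  have h1 := fun s => hR.sum_comul_right hab
    (F := fun u v w => L (c (v * b s) α) * m (C (w * a s) x) * C u) {}
  have h2 := fun r => hR.sum_comul_left hab
    (F := fun u v w => L (c w α) * m (C (u * b r) x) * C (v * a r)) {}
  have h3 := hR.yangBaxter hab (F := fun u v w => L (c w α) * m (C v x) * C u) {}
  trans ∑ s, ∑ r, ∑ p ∈ (ℛ k (b r)).index, L (c ((ℛ k (b r)).left p * b s) α) *
      m (C ((ℛ k (b r)).right p * a s) x) * C (a r)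
  · rw [Finset.sum_comm]
    refine Finset.sum_congr rfl fun r _ => ?_
    simp only [LinearMap.sum_apply, map_sum, Finset.sum_mul]
    refine Finset.sum_congr rfl fun s _ => ?_
    have h2 := LinearMap.congr_fun (hCL (b r) (c (b s) α)) (C (a s) x)
    rw [Module.End.mul_apply] at h2 ⊢
    rw [h2]
    simp only [LinearMap.sum_apply, map_sum, Finset.sum_mul, Module.End.mul_apply, hL, hC, hc]
  trans ∑ r, ∑ s, ∑ p ∈ (ℛ k (a s)).index, L (c (b s) α) *
      m (C ((ℛ k (a s)).left p * b r) x) * C ((ℛ k (a s)).right p * a r)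
  · simp only [h1, h2]
    exact Finset.sum_comm_cycle.trans (h3.trans Finset.sum_comm_cycle)
  · rw [Finset.sum_mul_sum, Finset.sum_comm]
    refine Finset.sum_congr rfl fun s _ => Finset.sum_congr rfl fun r _ => ?_
    have h2 := hCm.mul_eq (a s) (C (b r) x)
    rw [mul_assoc, ← mul_assoc (C (a s)), h2, Finset.sum_mul, Finset.mul_sum]
    refine Finset.sum_congr rfl fun p _ => ?_
    simp only [hC, Module.End.mul_apply, mul_assoc]

/-- Version for right actions compatible through $Δ^{op}$. Both reversals together lead exactly to
`sum_hexagon`. -/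
theorem IsRMatrix.twist_step_cop (hR : IsRMatrix k R) (hab : R = ∑ r, a r ⊗ₜ[k] b r)
    {m : W →ₗ[k] W →ₗ[k] W} {C : K →ₗ[k] Module.End k W} {c : K →ₗ[k] Module.End k N}
    {L : N →ₗ[k] Module.End k W} (hL : ∀ α x, m (L α x) = L α * m x)
    (hC : ∀ h h', C (h * h') = C h' * C h) (hc : ∀ h h', c (h * h') = c h' * c h)
    (hCm : ∀ h x, C h * m x =
      ∑ p ∈ (ℛ k h).index, m (C ((ℛ k h).right p) x) * C ((ℛ k h).left p))
    (hCL : ∀ h α, C h * L α =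
      ∑ p ∈ (ℛ k h).index, L (c ((ℛ k h).right p) α) * C ((ℛ k h).left p)) (α : N) (x : W) :
    ∑ r, m (C (b r) ((∑ s, L (c (b s) α) * C (a s) : Module.End k W) x)) * C (a r) =
      (∑ s, L (c (b s) α) * C (a s)) * ∑ r, m (C (b r) x) * C (a r) := by
  have h1 := hR.sum_hexagon hab (F := fun u v w => L (c w α) * m (C v x) * C u) {}
  refine Eq.trans ?_ (h1.trans ?_)
  · rw [Finset.sum_comm]
    refine Finset.sum_congr rfl fun r _ => ?_
    simp only [LinearMap.sum_apply, map_sum, Finset.sum_mul]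
    refine Finset.sum_congr rfl fun s _ => ?_
    have h2 := LinearMap.congr_fun (hCL (b r) (c (b s) α)) (C (a s) x)
    rw [Module.End.mul_apply] at h2 ⊢
    rw [h2]
    simp only [LinearMap.sum_apply, map_sum, Finset.sum_mul, Module.End.mul_apply, hL, hC, hc]
  · rw [Finset.sum_mul_sum]
    refine Finset.sum_congr rfl fun s _ => Finset.sum_congr rfl fun r _ => ?_
    have h2 := hCm (a s) (C (b r) x)
    rw [mul_assoc, ← mul_assoc (C (a s)), h2, Finset.sum_mul, Finset.mul_sum]
    refine Finset.sum_congr rfl fun p _ => ?_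
    simp only [hC, Module.End.mul_apply, mul_assoc]

end Twist

/-! ### Gauge transformations and the commuting regular actions on a vertex algebra. -/

section VertexActions

variable {k K : Type*} [Field k] [Ring K] [HopfAlgebra k K] {ι : Type*} [Finite ι] [LinearOrder ι]
  {R : K ⊗[k] K} {σ τ : ι → Bool}

local notation "ε" => Coalgebra.counit (R := k) (A := K)

omit [Finite ι] in
theorem tensorAct_fnOne (s : Finset ι) (h : K) :
    tensorAct τ s h (fnOne k K ι) = ε h • fnOne k K ι :=
  tensorAct_tprod_of_eq_counit h fun _ _ => rfl

/-- The vertex algebra is a module algebra. -/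
theorem isModuleAlgebraAct_vertexAct (hR : IsRMatrix k R) :
    IsModuleAlgebraAct (vertexAct τ) (vertexMul R σ τ) := by
  refine isModuleAlgebraAct_of_generators (fun p => vertex_induction (R := R) (σ := σ) (τ := τ) hR)
    (vertexMul_one hR) (vertexMul_genMul hR) (fun h => tensorAct_fnOne _ h)
    (c := fun i => endAct k K (τ i)) fun i α => ?_
  let := Fintype.ofFinite ι
  exact tensorAct_mul_genMul hR (Finset.mem_univ _) (fun _ _ => Finset.mem_univ _) α

omit [Finite ι] in
theorem commute_tensorAct_atFactor {i : ι} {f : Module.End k (D k K)}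
    (hf : ∀ h, Commute f (endAct k K (τ i) h)) (s : Finset ι) (h : K) :
    Commute (tensorAct τ s h) (atFactor k i f) := by
  refine tensorAct_commute (fun j _ h' => ?_) h
  by_cases hij : j = i
  · subst hij
    rw [factorAct_apply]
    rw [commute_iff_eq, ← atFactor_mul, ← atFactor_mul, (hf h').eq]
  · exact factorAct_commute_atFactor τ hij h' f

omit [Finite ι] [LinearOrder ι] in
theorem atFactor_fnOne {i : ι} {f : Module.End k (D k K)} {c : k} (hf : f ε = c • ε) :
    atFactor k i f (fnOne k K ι) = c • fnOne k K ι := by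
  classical
  rw [fnOne, atFactor_tprod, hf, MultilinearMap.map_update_smul,
    Function.update_eq_self (f := fun _ => ε)]

theorem commute_atFactor_genMul {i j : ι} (hij : j ≠ i) {f : Module.End k (D k K)}
    (hf : ∀ h, Commute f (endAct k K (τ i) h)) (α : D k K) :
    Commute (atFactor k i f) (genMul R σ τ j α) := by
  obtain ⟨n, a, b, hab⟩ := exists_sum_tmul R
  rw [genMul_apply hab]
  exact Commute.sum_right _ _ _ fun r _ => (factorMul_commute_atFactor hij _ f).symm.mul_right
    (commute_tensorAct_atFactor hf _ _).symm

/-- An action on the copy of `K*` at an edge end which commutes with gauge transformations and is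
compatible with the product of this copy is compatible with the product of the vertex algebra. -/
theorem isModuleAlgebraAct_atFactor (hR : IsRMatrix k R) {C : Type*} [AddCommGroup C] [Module k C]
    [Coalgebra k C] {i : ι} {f : C →ₗ[k] Module.End k (D k K)}
    (hf : ∀ x h, Commute (f x) (endAct k K (τ i) h))
    (hf1 : ∀ x, f x ε = Coalgebra.counit (R := k) x • ε)
    (hfm : IsModuleAlgebraAct f (endMul R (σ i) (τ i))) :
    IsModuleAlgebraAct (atFactor k i ∘ₗ f) (vertexMul R σ τ) := by
  classical
  obtain ⟨n, a, b, hab⟩ := exists_sum_tmul R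
  refine isModuleAlgebraAct_of_generators (fun p => vertex_induction (R := R) (σ := σ) (τ := τ) hR)
    (vertexMul_one hR) (vertexMul_genMul hR) (fun h => atFactor_fnOne (hf1 h))
    -- The action at factor $i$ leaves the entries of the other generators alone, so there it is
    -- given by the counit.
    (c := fun j => if j = i then f else
      LinearMap.smulRight (Coalgebra.counit : C →ₗ[k] k) LinearMap.id) fun j α => ?_
  by_cases hij : j = i
  · subst hij
    have h1 : ∀ β, toConv (atFactor k j ∘ₗ f) * convConst k C (factorMul R σ τ j β) =
        toConv (factorMul R σ τ j ∘ₗ f.flip β) * toConv (atFactor k j ∘ₗ f) := by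
      intro β
      ext h : 2
      rw [convMul_convConst_apply, (ℛ k h).convMul_apply]
      simp only [factorMul_apply, LinearMap.comp_apply, LinearMap.flip_apply, ← atFactor_mul,
        ← map_sum]
      rw [hfm.mul_eq]
    have h2 : ∀ x, Commute (toConv (atFactor k j ∘ₗ f))
        (convConst k C (tensorAct τ (below j) x)) := by
      intro x
      rw [commute_convConst_iff]
      exact fun h => (commute_tensorAct_atFactor (hf h) _ _).symm
    have h3 : toConv (genMul R σ τ j ∘ₗ f.flip α) =
        ∑ r, toConv (factorMul R σ τ j ∘ₗ f.flip (endAct k K (τ j) (b r) α)) *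
          convConst k C (tensorAct τ (below j) (a r)) := by
      apply WithConv.ofConv_injective
      ext h : 1
      rw [WithConv.ofConv_sum, LinearMap.sum_apply]
      simp only [convMul_convConst_apply, LinearMap.comp_apply, LinearMap.flip_apply,
        genMul_apply hab, ← Module.End.mul_apply, (hf h _).eq]
    simp only [if_true]
    rw [h3, genMul_apply hab, convConst_sum, Finset.mul_sum, Finset.sum_mul]
    refine Finset.sum_congr rfl fun r _ => ?_
    rw [convConst_mul, ← mul_assoc, h1, mul_assoc, (h2 _).eq, mul_assoc]
  · have h1 : toConv (genMul R σ τ j ∘ₗ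
        (LinearMap.smulRight (Coalgebra.counit : C →ₗ[k] k)
          (LinearMap.id : D k K →ₗ[k] D k K)).flip α) =
        convConst k C (genMul R σ τ j α) := by
      ext h : 2
      simp [convConst]
    simp only [hij, if_false]
    rw [h1]
    exact (commute_convConst_iff _ _).2 fun h => commute_atFactor_genMul hij (hf h) α

variable (k K τ) in
/-- The regular action on the `i`th factor which commutes with gauge transformations. -/
def otherAt (i : ι) : K →ₗ[k] Module.End k (⨂[k] _ : ι, D k K) :=
  atFactor k i ∘ₗ otherAct (τ i)

omit [Finite ι] [LinearOrder ι] in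
theorem otherAt_apply (i : ι) (h : K) : otherAt k K τ i h = atFactor k i (otherAct (τ i) h) := rfl

omit [Finite ι] [LinearOrder ι] in
theorem otherAt_fnOne (i : ι) (h : K) : otherAt k K τ i h (fnOne k K ι) = ε h • fnOne k K ι :=
  atFactor_fnOne (otherAct_counit (k := k) (τ i) h)

theorem commute_vertexAct_otherAt (i : ι) (h h' : K) :
    Commute (vertexAct τ h) (otherAt k K τ i h') :=
  commute_tensorAct_atFactor (fun h => (commute_endAct_otherAct _ h h').symm) _ _

theorem isModuleAlgebraAct_otherAt (hR : IsRMatrix k R) {i : ι} (hi : σ i = !τ i) :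
    IsModuleAlgebraAct (otherAt k K τ i) (vertexMul R σ τ) :=
  isModuleAlgebraAct_atFactor hR (fun x h => (commute_endAct_otherAct _ h x).symm)
    (otherAct_counit _) (by rw [hi]; exact hR.isModuleAlgebraAct_otherAct _)

theorem isModuleAlgebraAct_otherAt_cop (hR : IsRMatrix k R) {i : ι} (hi : σ i = τ i) :
    IsModuleAlgebraAct (otherAt k K τ i ∘ₗ ofCop k K) (vertexMul R σ τ) :=
  isModuleAlgebraAct_atFactor hR (f := otherAct (τ i) ∘ₗ ofCop k K)
    (fun (x : K) h => (commute_endAct_otherAct _ h x).symm)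
    (fun x : K => otherAct_counit (K := K) (τ i) x)
    (by rw [hi]; exact hR.isModuleAlgebraAct_otherAct_cop _)

theorem genMul_congr {σ' : ι → Bool} {i : ι} (h : σ i = σ' i) :
    genMul R σ τ i = genMul R σ' τ i := by
  ext α : 1
  obtain ⟨n, a, b, hab⟩ := exists_sum_tmul R
  simp only [genMul_apply hab, factorMul_apply, h]

/-- The twist on one copy of $K^*$ passes to generators because the other action commutes with the
gauge action contained in `genMul`. -/
theorem genMul_false_eq (hR : IsRMatrix k R) {n : ℕ} {a b : Fin n → K}
    (hab : R = ∑ r, a r ⊗ₜ[k] b r) {σ' : ι → Bool} {i : ι} (h : σ i = false) (h' : σ' i = true)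
    (α : D k K) : genMul R σ τ i α =
      ∑ r, genMul R σ' τ i (otherAct (τ i) (b r) α) * otherAt k K τ i (a r) := by
  have h1 : ∀ β, factorMul R σ τ i β =
      ∑ r, factorMul R σ' τ i (otherAct (τ i) (b r) β) * otherAt k K τ i (a r) := by
    intro β
    simp only [factorMul_apply, otherAt_apply, ← atFactor_mul, ← map_sum, h, h']
    congr 1
    ext γ : 1
    simpa using hR.endMul_false_eq hab (τ i) β γ
  simp only [genMul_apply hab, h1, Finset.sum_mul]
  rw [Finset.sum_comm]
  refine Finset.sum_congr rfl fun r _ => Finset.sum_congr rfl fun q _ => ?_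
  have h2 : Commute (otherAt k K τ i (a r)) (tensorAct τ (below i) (a q)) :=
    (commute_tensorAct_atFactor (fun h => (commute_endAct_otherAct _ h _).symm) _ _).symm
  have h3 := LinearMap.congr_fun (commute_endAct_otherAct (k := k) (τ i) (b q) (b r)).eq α
  rw [Module.End.mul_apply, Module.End.mul_apply] at h3
  rw [mul_assoc, h2.eq, ← mul_assoc, h3]

omit [Finite ι] [LinearOrder ι] in
theorem otherAt_single (i : ι) (h : K) (α : D k K) :
    otherAt k K τ i h (single i α) = single i (otherAct (τ i) h α) := by
  classical
  rw [otherAt_apply, single_eq, atFactor_tprod, single_eq]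
  simp

omit [Finite ι] [LinearOrder ι] in
theorem otherAt_mul_of_false {i : ι} (hi : τ i = false) (h h' : K) :
    otherAt k K τ i (h * h') = otherAt k K τ i h * otherAt k K τ i h' := by
  simp only [otherAt_apply, hi, otherAct, regLeft_mul, atFactor_mul]

omit [Finite ι] [LinearOrder ι] in
theorem otherAt_mul_of_true {i : ι} (hi : τ i = true) (h h' : K) :
    otherAt k K τ i (h * h') = otherAt k K τ i h' * otherAt k K τ i h := by
  simp only [otherAt_apply, hi, otherAct, regRight_mul, atFactor_mul]

/-- The product for `σ i = 0` is a twist of the product for `σ i = 1`. -/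
theorem vertexMul_twist (hR : IsRMatrix k R) {n : ℕ} {a b : Fin n → K}
    (hab : R = ∑ r, a r ⊗ₜ[k] b r) {σ' : ι → Bool} {i : ι} (hi : σ i = false) (hi' : σ' i = true)
    (hσ : ∀ j, j ≠ i → σ j = σ' j) (x : ⨂[k] _ : ι, D k K) :
    vertexMul R σ τ x =
      ∑ r, vertexMul R σ' τ (otherAt k K τ i (b r) x) * otherAt k K τ i (a r) := by
  -- Both sides are compared by induction on generators; only generators at $i$ interact with the
  -- twist.
  let Ψ : (⨂[k] _ : ι, D k K) →ₗ[k] Module.End k (⨂[k] _ : ι, D k K) :=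
    ∑ r, LinearMap.mulRight k (otherAt k K τ i (a r)) ∘ₗ vertexMul R σ' τ ∘ₗ otherAt k K τ i (b r)
  have hΨ : ∀ x, Ψ x =
      ∑ r, vertexMul R σ' τ (otherAt k K τ i (b r) x) * otherAt k K τ i (a r) := by
    intro x; simp only [Ψ, LinearMap.sum_apply]; rfl
  rw [← hΨ]
  have hm := fun α => vertexMul_single (σ := σ') (τ := τ) hR i α
  have hstep : ∀ α x, Ψ (genMul R σ τ i α x) = genMul R σ τ i α * Ψ x := by
    intro α x
    rw [hΨ, hΨ, genMul_false_eq hR hab hi hi']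
    -- With $σ' = 1$ at $i$, the other action is a left action compatible through $Δ$ for $τ = 0$,
    -- and a right action compatible through $Δ^{op}$ for $τ = 1$.
    cases hτ : τ i with
    | false =>
      have hC := isModuleAlgebraAct_otherAt (τ := τ) hR (hi'.trans (by rw [hτ]; rfl))
      rw [← hτ]
      refine hR.twist_step hab (vertexMul_genMul hR i) (otherAt_mul_of_false hτ)
        (by rw [hτ]; exact regLeft_mul) hC (fun h β => ?_) α x
      rw [← hm, hC.mul_eq]
      simp only [otherAt_single, hm]
    | true =>
      have hC := (isModuleAlgebraAct_otherAt_cop (τ := τ) hR (hi'.trans hτ.symm)).mul_eq_cop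
      rw [← hτ]
      refine hR.twist_step_cop hab (vertexMul_genMul hR i) (otherAt_mul_of_true hτ)
        (by rw [hτ]; exact regRight_mul) hC (fun h β => ?_) α x
      rw [← hm, hC]
      simp only [otherAt_single, hm]
  have h1 : fnOne k K ι ∈ LinearMap.eqLocus (vertexMul R σ τ) Ψ := by
    rw [LinearMap.mem_eqLocus, hΨ, vertexMul_one hR]
    simp only [otherAt_fnOne, map_smul, vertexMul_one hR, smul_one_mul]
    simp only [← map_smul]
    rw [← map_sum, hR.sum_counit_right hab, otherAt_apply, otherAct_one, atFactor_one]
  refine vertex_induction (p := LinearMap.eqLocus _ Ψ) (σ := σ) (τ := τ) hR h1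
    (fun j α x hx => ?_) x
  rw [LinearMap.mem_eqLocus] at hx ⊢
  rw [vertexMul_genMul hR, hx]
  by_cases hij : j = i
  · subst hij
    exact (hstep α x).symm
  · rw [hΨ, hΨ, Finset.mul_sum]
    refine Finset.sum_congr rfl fun r _ => ?_
    have h2 := LinearMap.congr_fun (commute_atFactor_genMul (R := R) (σ := σ) hij
      (fun h => (commute_endAct_otherAct (τ i) h (b r)).symm) α).eq x
    rw [Module.End.mul_apply, Module.End.mul_apply] at h2
    rw [otherAt_apply, h2, genMul_congr (hσ j hij), vertexMul_genMul hR, mul_assoc]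

end VertexActions

/-! ### Duality between operators on connections and on functions. -/

section Transpose

variable {k K : Type*} [Field k] [Ring K] [HopfAlgebra k K] [Module.Finite k K]
  {ι : Type*} [Finite ι]

local notation "ε" => Coalgebra.counit (R := k) (A := K)

theorem dualDistrib_transpose (f : Module.End k (⨂[k] _ : ι, K)) (x : ⨂[k] _ : ι, D k K)
    (y : ⨂[k] _ : ι, K) : PiTensorProduct.dualDistrib (transpose ι f x) y =
      PiTensorProduct.dualDistrib x (f y) := by
  have h : PiTensorProduct.dualDistribEquiv (R := k) (M := fun _ : ι => K) (transpose ι f x) =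
      Module.Dual.transpose f (PiTensorProduct.dualDistribEquiv (R := k) (M := fun _ : ι => K) x) :=
    LinearEquiv.apply_symm_apply _ _
  exact LinearMap.congr_fun h y

theorem dualDistrib_injective :
    Function.Injective (PiTensorProduct.dualDistrib (R := k) (M := fun _ : ι => K)) :=
  (PiTensorProduct.dualDistribEquiv (R := k) (M := fun _ : ι => K)).injective

theorem eq_of_dualDistrib {y y' : ⨂[k] _ : ι, K}
    (h : ∀ x, PiTensorProduct.dualDistrib x y = PiTensorProduct.dualDistrib x y') : y = y' := by
  refine (Module.evalEquiv k _).injective (LinearMap.ext fun φ => ?_)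
  obtain ⟨x, rfl⟩ := (PiTensorProduct.dualDistribEquiv (R := k) (M := fun _ : ι => K)).surjective φ
  exact h x

theorem transpose_mul (f g : Module.End k (⨂[k] _ : ι, K)) :
    transpose ι (f * g) = transpose ι g * transpose ι f := by
  refine LinearMap.ext fun x => dualDistrib_injective (LinearMap.ext fun y => ?_)
  simp only [Module.End.mul_apply, dualDistrib_transpose]

theorem transpose_one : transpose ι (1 : Module.End k (⨂[k] _ : ι, K)) = 1 := by
  refine LinearMap.ext fun x => dualDistrib_injective (LinearMap.ext fun y => ?_)
  simp only [Module.End.one_apply, dualDistrib_transpose]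

theorem transpose_injective : Function.Injective (transpose (k := k) (K := K) ι) := by
  intro f g h
  refine LinearMap.ext fun y => eq_of_dualDistrib fun x => ?_
  rw [← dualDistrib_transpose, ← dualDistrib_transpose, h]

/-- Finite-dimensionality allows a right module structure on functions to be turned back into an
action on connections. -/
theorem transpose_bijective : Function.Bijective (transpose (k := k) (K := K) ι) := by
  refine ⟨transpose_injective, fun g => ?_⟩
  let e := PiTensorProduct.dualDistribEquiv (R := k) (M := fun _ : ι => K)
  let φ : Module.End k (Module.Dual k (⨂[k] _ : ι, K)) := e.toLinearMap ∘ₗ g ∘ₗ e.symm.toLinearMap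
  refine ⟨(Module.evalEquiv k _).symm.toLinearMap ∘ₗ φ.dualMap ∘ₗ
    (Module.evalEquiv k (⨂[k] _ : ι, K)).toLinearMap, LinearMap.ext fun x =>
      dualDistrib_injective (LinearMap.ext fun y => ?_)⟩
  rw [dualDistrib_transpose]
  refine (LinearMap.congr_fun (LinearEquiv.apply_symm_apply (Module.evalEquiv k (⨂[k] _ : ι, K))
    (φ.dualMap (Module.evalEquiv k _ y))) (e x)).trans ?_
  change e (g (e.symm (e x))) y = e (g x) y
  rw [LinearEquiv.symm_apply_apply]

variable (k K) in
/-- The linear map `α ↦ (α)ᵢ`. -/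
def singleLin (i : ι) : D k K →ₗ[k] ⨂[k] _ : ι, D k K :=
  open scoped Classical in (PiTensorProduct.tprod k).toLinearMap (fun _ => ε) i

omit [Module.Finite k K] [Finite ι] in
@[simp]
theorem singleLin_apply (i : ι) (α : D k K) : singleLin k K i α = single i α := rfl

variable (k K) in
/-- The component of a connection at the edge `e`. -/
def component (e : ι) : (⨂[k] _ : ι, K) →ₗ[k] K :=
  (Module.evalEquiv k K).symm.toLinearMap ∘ₗ (singleLin k K e).dualMap ∘ₗ
    (PiTensorProduct.dualDistrib (R := k) (M := fun _ : ι => K)).flip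

theorem dual_component (e : ι) (α : D k K) (y : ⨂[k] _ : ι, K) :
    α (component k K e y) = PiTensorProduct.dualDistrib (single e α) y := by
  have h : Module.evalEquiv k K (component k K e y) =
      (singleLin k K e).dualMap (PiTensorProduct.dualDistrib.flip y) :=
    LinearEquiv.apply_symm_apply _ _
  exact LinearMap.congr_fun h α

theorem component_tprod [Fintype ι] [DecidableEq ι] (e : ι) (y : ι → K) :
    component k K e (PiTensorProduct.tprod k y) = (∏ f ∈ Finset.univ.erase e, ε (y f)) • y e := by
  refine (Module.evalEquiv k K).injective (LinearMap.ext fun α => ?_)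
  change α _ = α _
  rw [dual_component, single_eq, PiTensorProduct.dualDistrib_apply,
    ← Finset.mul_prod_erase _ _ (Finset.mem_univ e), map_smul, smul_eq_mul, mul_comm]
  congr 1
  · exact Finset.prod_congr rfl fun f hf => by rw [Function.update_of_ne (Finset.ne_of_mem_erase hf)]
  · simp

omit [Module.Finite k K] [Finite ι] in
theorem incl_eq [DecidableEq ι] (i : ι) (h : K) :
    incl k i h = PiTensorProduct.tprod k (Function.update (fun _ => (1 : K)) i h) := by
  refine congrArg (PiTensorProduct.tprod k) (funext fun j => ?_)
  by_cases hj : j = i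
  · subst hj; simp
  · simp [hj]

theorem edgePart_eq (e : ι) (y : ⨂[k] _ : ι, K) :
    edgePart k e y = incl k e (component k K e y) := by
  classical
  have := Fintype.ofFinite ι
  induction y using PiTensorProduct.induction_on with
  | smul_tprod c y =>
    rw [map_smul, map_smul, map_smul, component_tprod, map_smul, incl_eq, edgePart,
      PiTensorProduct.map_tprod]
    congr 1
    -- Distributes the scalar $\prod_{f ≠ e} ε(y_f)$ over the factors different from $e$.
    have h1 := (PiTensorProduct.tprod k).map_smul_univ (fun f => if f = e then 1 else ε (y f))
      (Function.update (fun _ => (1 : K)) e (y e))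
    rw [← Finset.mul_prod_erase _ _ (Finset.mem_univ e), if_pos rfl, one_mul,
      Finset.prod_congr rfl fun f hf => if_neg (Finset.ne_of_mem_erase hf)] at h1
    rw [← h1]
    congr 1
    ext f
    by_cases hf : f = e
    · subst hf; simp
    · simp [hf, Algebra.algebraMap_eq_smul_one]
  | add x y hx hy => simp only [map_add, hx, hy]

/-- The action of a gauge transformation on the component of a connection is dual to its action on
functions of this component. -/
theorem edgePart_of_transpose {f : Module.End k (⨂[k] _ : ι, K)} {g : K →ₗ[k] K} {e : ι}
    (h : ∀ α, transpose ι f (single e α) = single e (α ∘ₗ g)) (y : ⨂[k] _ : ι, K) :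
    edgePart k e (f y) = incl k e (g (component k K e y)) := by
  rw [edgePart_eq]
  congr 1
  refine (Module.evalEquiv k K).injective (LinearMap.ext fun α => ?_)
  change α _ = α _
  rw [dual_component, ← dualDistrib_transpose, h, ← dual_component]
  rfl

variable (k K ι) in
/-- The transpose as a linear isomorphism. -/
def transposeEquiv : Module.End k (⨂[k] _ : ι, K) ≃ₗ[k] Module.End k (⨂[k] _ : ι, D k K) :=
  LinearEquiv.ofBijective (transpose ι) transpose_bijective

/-- The left module structure on `K^{⊗ι}` which is dual to a right module structure on
`K*^{⊗ι}`. -/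
def actOfDual {A : Type*} [Semiring A] [Algebra k A] (d : A →ₗ[k] Module.End k (⨂[k] _ : ι, D k K))
    (d_one : d 1 = 1) (d_mul : ∀ h h', d (h * h') = d h' * d h) :
    A →ₐ[k] Module.End k (⨂[k] _ : ι, K) :=
  AlgHom.ofLinearMap ((transposeEquiv k K ι).symm.toLinearMap ∘ₗ d)
    ((transposeEquiv k K ι).symm_apply_eq.2 (d_one.trans transpose_one.symm))
    fun h h' => (transposeEquiv k K ι).symm_apply_eq.2 <| by
      refine (d_mul h h').trans (Eq.trans ?_ (transpose_mul _ _).symm)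
      exact congrArg₂ (· * ·) ((transposeEquiv k K ι).apply_symm_apply _).symm
        ((transposeEquiv k K ι).apply_symm_apply _).symm

@[simp]
theorem transpose_actOfDual {A : Type*} [Semiring A] [Algebra k A]
    (d : A →ₗ[k] Module.End k (⨂[k] _ : ι, D k K))
    (d_one : d 1 = 1) (d_mul : ∀ h h', d (h * h') = d h' * d h) (h : A) :
    transpose ι (actOfDual d d_one d_mul h) = d h :=
  (transposeEquiv k K ι).apply_symm_apply _

end Transpose

/-! ### Tensor powers of $K$ and gauge theories given by dual data. -/

section TensorPowers

variable {k K : Type*} [Field k] [Ring K] [HopfAlgebra k K] {ι : Type*}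

local notation "ε" => Coalgebra.counit (R := k) (A := K)

theorem tensorComul_tprod [Fintype ι] [DecidableEq ι] (h : ι → K) :
    tensorComul k K ι (PiTensorProduct.tprod k h) =
      ∑ p ∈ Fintype.piFinset fun i => (ℛ k (h i)).index,
        (PiTensorProduct.tprod k fun i => (ℛ k (h i)).left (p i)) ⊗ₜ[k]
          PiTensorProduct.tprod k fun i => (ℛ k (h i)).right (p i) := by
  rw [tensorComul, LinearMap.comp_apply, LinearEquiv.coe_coe, LinearEquiv.symm_apply_eq, map_sum]
  have h1 : ∀ x y : ι → K, interchange k ι K K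
      (PiTensorProduct.tprod k x ⊗ₜ[k] PiTensorProduct.tprod k y) =
      PiTensorProduct.tprod k fun i => x i ⊗ₜ[k] y i := by
    intro x y
    change interchangeMap k ι K K _ = _
    rw [interchangeMap, TensorProduct.lift.tmul, PiTensorProduct.map₂_tprod_tprod]
    rfl
  simp only [h1, PiTensorProduct.map_tprod]
  conv_lhs => enter [2, i]; rw [← (ℛ k (h i)).eq]
  exact MultilinearMap.map_sum_finset _ _ _

theorem tensorCounit_tprod [Fintype ι] (h : ι → K) :
    tensorCounit k K ι (PiTensorProduct.tprod k h) = ∏ i, ε (h i) := by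
  rw [tensorCounit, PiTensorProduct.dualDistrib_apply]

theorem tensorComul_unit (h : K) :
    tensorComul k K Unit (PiTensorProduct.tprod k fun _ => h) =
      ∑ p ∈ (ℛ k h).index, (PiTensorProduct.tprod k fun _ => (ℛ k h).left p) ⊗ₜ[k]
          PiTensorProduct.tprod k fun _ => (ℛ k h).right p := by
  rw [tensorComul_tprod]
  refine Finset.sum_nbij' (fun p => p ()) (fun p _ => p) (fun p hp => ?_) ?_ ?_ ?_ ?_
  · exact Fintype.mem_piFinset.1 hp ()
  all_goals simp [Fintype.mem_piFinset]

theorem incl_unit (h : K) : incl k () h = PiTensorProduct.tprod k fun _ : Unit => h := by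
  rw [incl_eq]
  congr 1

end TensorPowers

section OfDual

variable {k K : Type*} [Field k] [Ring K] [HopfAlgebra k K] [Module.Finite k K]
  {V E U : Type*} [Finite E] [Finite U] {Γ : DirectedGraph V E} {vert : U → V}

/-- A Hopf algebra gauge theory is determined by its multiplication and the right module structure
on functions. -/
def HopfGaugeTheory.ofDual
    (mul : (⨂[k] _ : E, D k K) →ₗ[k] (⨂[k] _ : E, D k K) →ₗ[k] ⨂[k] _ : E, D k K)
    (d : (⨂[k] _ : U, K) →ₗ[k] Module.End k (⨂[k] _ : E, D k K))
    (d_one : d 1 = 1) (d_mul : ∀ h h', d (h * h') = d h' * d h)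
    (mul_assoc : ∀ a b c, mul (mul a b) c = mul a (mul b c))
    (one_mul : ∀ a, mul (fnOne k K E) a = a)
    (mul_one : ∀ a, mul a (fnOne k K E) = a)
    (mul_same : ∀ (e : E) (α β : D k K), ∃ γ, mul (single e α) (single e β) = single e γ)
    (mul_pair : ∀ (e f : E) (α β : D k K), e ≠ f → mul (single e α) (single f β) ∈
      Submodule.span k (Set.range fun p : D k K × D k K => pairAt e f p.1 p.2))
    (mul_disjoint : ∀ (e f : E) (α β : D k K),
      Disjoint ({Γ.src e, Γ.tgt e} : Set V) {Γ.src f, Γ.tgt f} →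
        mul (single e α) (single f β) = pairAt e f α β ∧
        mul (single f β) (single e α) = pairAt e f α β)
    (mul_act : ∀ (h : ⨂[k] _ : U, K) (a b : ⨂[k] _ : E, D k K), d h (mul a b) =
      TensorProduct.lift (mul.compl₁₂ (d.flip a) (d.flip b)) (tensorComul k K U h))
    (one_act : ∀ h : ⨂[k] _ : U, K, d h (fnOne k K E) = tensorCounit k K U h • fnOne k K E)
    (act_far : ∀ (e : E) (u : U), Γ.src e ≠ Γ.tgt e → vert u ≠ Γ.src e → vert u ≠ Γ.tgt e →
      ∀ (h : K) α, d (incl k u h) (single e α) = Coalgebra.counit (R := k) h • single e α)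
    (act_tgt : ∀ (e : E) (u : U), Γ.src e ≠ Γ.tgt e → vert u = Γ.tgt e →
      ∀ (h : K) α, d (incl k u h) (single e α) = single e (endAct k K false h α))
    (act_src : ∀ (e : E) (u : U), Γ.src e ≠ Γ.tgt e → vert u = Γ.src e →
      ∀ (h : K) α, d (incl k u h) (single e α) = single e (endAct k K true h α)) :
    HopfGaugeTheory k K Γ vert where
  mul := mul
  act := actOfDual d d_one d_mul
  mul_assoc := mul_assoc
  one_mul := one_mul
  mul_one := mul_one
  mul_same := mul_same
  mul_pair := mul_pair
  mul_disjoint := mul_disjoint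
  mul_act h a b := by
    have h1 : transpose E ∘ₗ (actOfDual d d_one d_mul).toLinearMap = d :=
      LinearMap.ext fun h => transpose_actOfDual d d_one d_mul h
    rw [h1, transpose_actOfDual, mul_act]
  one_act h := by rw [transpose_actOfDual, one_act]
  act_far e u he h1 h2 h x := by
    rw [edgePart_of_transpose (g := Coalgebra.counit (R := k) h • LinearMap.id) (fun α => ?_),
      edgePart_eq]
    · simp
    · rw [transpose_actOfDual, act_far e u he h1 h2, ← singleLin_apply, ← singleLin_apply,
        ← map_smul]
      exact congrArg _ (by ext; simp)
  act_tgt e u he h1 h x := by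
    rw [edgePart_of_transpose (g := LinearMap.mulLeft k h) (fun α => ?_), edgePart_eq]
    · simp
    · rw [transpose_actOfDual, act_tgt e u he h1]
      rfl
  act_src e u he h1 h x := by
    rw [edgePart_of_transpose (g := LinearMap.mulRight k (HopfAlgebra.antipode k h)) (fun α => ?_),
      edgePart_eq]
    · simp
    · rw [transpose_actOfDual, act_src e u he h1]
      rfl

end OfDual

/-! ### The gauge theory on a vertex neighbourhood. -/

section VertexTheory

variable {k K : Type*} [Field k] [Ring K] [HopfAlgebra k K] {ι : Type*} [Finite ι] [LinearOrder ι]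
  {R : K ⊗[k] K} {σ τ : ι → Bool}

local notation "ε" => Coalgebra.counit (R := k) (A := K)

/-- Apply the exchange of the action with `genMul` to the invariant unit. The action does not
involve $R$ or $σ$, so any choice serves in the proof. -/
theorem vertexAct_single (hR : IsRMatrix k R) (i : ι) (h : K) (α : D k K) :
    vertexAct τ h (single i α) = single i (endAct k K (τ i) h α) := by
  let := Fintype.ofFinite ι
  have h1 := LinearMap.congr_fun (LinearMap.congr_fun (congrArg ofConv
    (tensorAct_mul_genMul (σ := fun _ => false) (τ := τ) hR (Finset.mem_univ i)
      (fun _ _ => Finset.mem_univ _) α)) h) (fnOne k K ι)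
  rw [convMul_convConst_apply, (ℛ k h).convMul_apply] at h1
  simp only [Module.End.mul_apply, LinearMap.sum_apply, LinearMap.comp_apply, tensorAct_fnOne,
    genMul_apply_one hR, map_smul] at h1
  have h2 := congrArg (TensorProduct.rid k K) (Coalgebra.sum_tmul_counit_eq (ℛ k h))
  simp only [map_sum, TensorProduct.rid_tmul, one_smul] at h2
  have h3 := congrArg (singleLin k K i ∘ₗ (endAct k K (τ i)).flip α) h2
  simp only [map_sum, map_smul] at h3
  exact h1.trans h3

/-- For $i < j$ the pair is the product $(α)_i(β)_j$, so the module algebra property splits $h$ in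
the order of the ends. -/
theorem vertexAct_pairAt (hR : IsRMatrix k R) {i j : ι} (hij : i < j) (h : K) (α β : D k K) :
    vertexAct τ h (pairAt i j α β) = ∑ p ∈ (ℛ k h).index,
      pairAt i j (endAct k K (τ i) ((ℛ k h).left p) α) (endAct k K (τ j) ((ℛ k h).right p) β) := by
  have hm := (vertexRelations (σ := fun _ => false) (τ := τ) hR).lt i j
  simp only [← hm _ _ hij, isModuleAlgebraAct_vertexAct hR h _ _, vertexAct_single hR]

theorem vertexMul_single_single_mem (hR : IsRMatrix k R) {i j : ι} (hij : i ≠ j) (α β : D k K) :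
    vertexMul R σ τ (single i α) (single j β) ∈
      Submodule.span k (Set.range fun p : D k K × D k K => pairAt i j p.1 p.2) := by
  obtain hij | hij := hij.lt_or_gt
  · rw [(vertexRelations hR).lt i j α β hij]
    exact Submodule.subset_span ⟨(α, β), rfl⟩
  · rw [(vertexRelations hR).gt i j α β hij]
    obtain ⟨n, a, b, hab⟩ := exists_sum_tmul R
    rw [hab, map_sum, LinearMap.sum_apply]
    refine Submodule.sum_mem _ fun r _ => Submodule.subset_span
      ⟨(endAct k K (τ i) (b r) α, endAct k K (τ j) (a r) β), ?_⟩
    change _ = factorAct τ j (a r) (factorAct τ i (b r) (pairAt i j α β))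
    simp only [factorAct_apply, pairAt_eq, atFactor_tprod]
    congr 1
    ext l : 1
    by_cases h1 : l = j
    · subst h1; simp [hij.ne]
    · by_cases h2 : l = i
      · subst h2; simp [h1]
      · simp [h1, h2]

end VertexTheory

section VertexGaugeTheory

variable {k K : Type*} [Field k] [Ring K] [HopfAlgebra k K]

local notation "ε" => Coalgebra.counit (R := k) (A := K)

variable (k K) in
/-- The Hopf algebra `K^{⊗Unit}` is `K`. -/
def unitEquiv : (⨂[k] _ : Unit, K) ≃ₗ[k] K := PiTensorProduct.subsingletonEquiv ()

@[simp]
theorem unitEquiv_tprod (h : Unit → K) : unitEquiv k K (PiTensorProduct.tprod k h) = h () :=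
  PiTensorProduct.subsingletonEquiv_apply_tprod _ _

theorem unit_eq_tprod (h : ⨂[k] _ : Unit, K) :
    h = PiTensorProduct.tprod k fun _ => unitEquiv k K h :=
  (unitEquiv k K).injective (unitEquiv_tprod fun _ => unitEquiv k K h).symm

variable [Module.Finite k K] {V E : Type*} [Finite E] {R : V → K ⊗[k] K}

theorem exists_vertexGaugeTheory (Γ : CiliatedRibbonGraph V E) (hR : ∀ v, IsRMatrix k (R v))
    (ρ : E → E ⊕ E) (v : V) :
    ∃ A : VertexGaugeTheory k K Γ.toDirectedGraph v, A.mul = ribbonMul Γ R ρ v ∧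
      A.dualAct ∘ₗ (incl k ()).toLinearMap = ribbonAct k K Γ v := by
  let := Γ.endOrder v
  let d : (⨂[k] _ : Unit, K) →ₗ[k] Module.End k (⨂[k] _ : Γ.EndsAt v, D k K) :=
    ribbonAct k K Γ v ∘ₗ (unitEquiv k K).toLinearMap
  have hd : ∀ h, d (PiTensorProduct.tprod k fun _ => h) = ribbonAct k K Γ v h := fun h =>
    congrArg (ribbonAct k K Γ v) (unitEquiv_tprod fun _ => h)
  have hin : ∀ h, d (incl k () h) = ribbonAct k K Γ v h := fun h => by rw [incl_unit, hd]
  have hm : IsModuleAlgebraAct (ribbonAct k K Γ v) (ribbonMul Γ R ρ v) :=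
    isModuleAlgebraAct_vertexAct (hR v)
  have hrel := vertexRelations (R := R v) (σ := fun x : Γ.EndsAt v => sigma ρ x.1)
    (τ := fun x => tau x.1) (hR v)
  have hend : ∀ (x : Γ.EndsAt v) (h : K) α, ribbonAct k K Γ v h (single x α) =
    single x (endAct k K (tau x.1) h α) := fun x h α => vertexAct_single (hR v) x h α
  have d_one : d 1 = 1 := by
    rw [PiTensorProduct.one_def]
    exact (hd 1).trans (tensorAct_one _ _)
  have d_mul : ∀ h h', d (h * h') = d h' * d h := by
    intro h h'
    rw [unit_eq_tprod h, unit_eq_tprod h', PiTensorProduct.tprod_mul_tprod]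
    exact (hd _).trans ((tensorAct_mul _ _ _ _).trans (congrArg₂ _ (hd _).symm (hd _).symm))
  refine ⟨HopfGaugeTheory.ofDual (ribbonMul Γ R ρ v) d d_one d_mul ?_ ?_ ?_ ?_ ?_ ?_ ?_ ?_ ?_ ?_ ?_,
    rfl, ?_⟩
  · exact fun a b c => LinearMap.congr_fun (vertexMul_assoc (hR v) a b) c
  · exact fun a => LinearMap.congr_fun (vertexMul_one (hR v)) a
  · exact fun a => vertexMul_apply_one (hR v) a
  · exact fun e α β => ⟨_, hrel.same e α β⟩
  · exact fun e f α β hef => vertexMul_single_single_mem (hR v) hef α β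
  · intro e f α β h
    -- All edges of $Γ_v$ meet at $v$, so the condition on disjoint edges is vacuous.
    have h1 : ∀ x : Γ.EndsAt v, none ∈
        ({(Γ.nbhd v).src x, (Γ.nbhd v).tgt x} : Set (Option (Γ.EndsAt v))) := by
      intro x
      by_cases hx : x.1.isLeft <;> simp [DirectedGraph.nbhd, hx]
    exact (Set.disjoint_left.1 h (h1 e) (h1 f)).elim
  · intro h a b
    rw [unit_eq_tprod h, tensorComul_unit, map_sum, hd, hm]
    refine Finset.sum_congr rfl fun p _ => ?_
    rw [TensorProduct.lift.tmul, LinearMap.compl₁₂_apply, LinearMap.flip_apply,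
      LinearMap.flip_apply, hd, hd]
  · intro h
    rw [unit_eq_tprod h, hd, tensorCounit_tprod]
    exact (tensorAct_fnOne _ _).trans (by simp)
  · intro e u _ h1 h2
    by_cases he : e.1.isLeft <;> simp [DirectedGraph.nbhd, he] at h1 h2
  · intro e u _ h1 h α
    have he : tau e.1 = false := by
      by_contra he
      simp [DirectedGraph.nbhd, Bool.eq_true_of_not_eq_false he, ← tau.eq_def] at h1
    rw [← he]
    exact (LinearMap.congr_fun (hin h) _).trans (hend e h α)
  · intro e u _ h1 h α
    have he : tau e.1 = true := by
      by_contra he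
      simp [DirectedGraph.nbhd, Bool.eq_false_of_not_eq_true he, ← tau.eq_def] at h1
    rw [← he]
    exact (LinearMap.congr_fun (hin h) _).trans (hend e h α)
  · refine LinearMap.ext fun h => ?_
    exact (transpose_actOfDual d d_one d_mul _).trans (hin h)

end VertexGaugeTheory

/-! ### Operators on one component of a tensor product of vertex spaces. -/

section Components

variable {k : Type*} [Field k] {V : Type*} {W : V → Type*} [∀ v, AddCommMonoid (W v)]
  [∀ v, Module k (W v)]

theorem piTensor_ext₂ {V' : Type*} {W' : V' → Type*} [∀ v, AddCommMonoid (W' v)]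
    [∀ v, Module k (W' v)] {P : Type*} [AddCommMonoid P] [Module k P]
    {f g : (⨂[k] v, W v) →ₗ[k] (⨂[k] v, W' v) →ₗ[k] P}
    (h : ∀ x y, f (PiTensorProduct.tprod k x) (PiTensorProduct.tprod k y) =
      g (PiTensorProduct.tprod k x) (PiTensorProduct.tprod k y)) : f = g :=
  PiTensorProduct.ext (MultilinearMap.ext fun x =>
    PiTensorProduct.ext (MultilinearMap.ext fun y => h x y))

open scoped Classical in
variable (k W) in
/-- The operator on `⨂ᵥ Wᵥ` which acts by `f` on the factor `W v` and trivially on all others,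
as a linear map in `f`. -/
def atComponent (v : V) : Module.End k (W v) →ₗ[k] Module.End k (⨂[k] v, W v) :=
  (PiTensorProduct.mapMultilinear k W W).toLinearMap (fun _ => LinearMap.id) v

theorem atComponent_tprod [DecidableEq V] (v : V) (f : Module.End k (W v)) (w : ∀ v, W v) :
    atComponent k W v f (PiTensorProduct.tprod k w) =
      PiTensorProduct.tprod k (Function.update w v (f (w v))) := by
  classical
  simp only [atComponent, MultilinearMap.toLinearMap_apply, PiTensorProduct.mapMultilinear_apply,
    PiTensorProduct.map_tprod]
  congr 1
  ext j
  by_cases h : j = v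
  · subst h; simp
  · simp [h]

theorem atComponent_mul (v : V) (f g : Module.End k (W v)) :
    atComponent k W v (f * g) = atComponent k W v f * atComponent k W v g := by
  classical
  refine PiTensorProduct.ext (MultilinearMap.ext fun w => ?_)
  simp [atComponent_tprod]

@[simp]
theorem atComponent_one (v : V) : atComponent k W v (1 : Module.End k (W v)) = 1 := by
  classical
  refine PiTensorProduct.ext (MultilinearMap.ext fun w => ?_)
  simp [atComponent_tprod]

theorem map_commute_atComponent {f : ∀ v, Module.End k (W v)} {v : V} {g : Module.End k (W v)}
    (h : Commute (f v) g) :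
    Commute (PiTensorProduct.map f : Module.End k (⨂[k] v, W v)) (atComponent k W v g) := by
  classical
  refine PiTensorProduct.ext (MultilinearMap.ext fun w => ?_)
  simp only [LinearMap.compMultilinearMap_apply, Module.End.mul_apply, atComponent_tprod,
    PiTensorProduct.map_tprod]
  congr 1
  ext u
  by_cases hu : u = v
  · subst hu
    simpa using LinearMap.congr_fun h.eq (w u)
  · simp [hu]

theorem isModuleAlgebraAct_atComponent {C : Type*} [AddCommGroup C] [Module k C] [Coalgebra k C]
    {m : ∀ v, W v →ₗ[k] W v →ₗ[k] W v} {v : V} {o : C →ₗ[k] Module.End k (W v)}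
    (ho : IsModuleAlgebraAct o (m v)) :
    IsModuleAlgebraAct (atComponent k W v ∘ₗ o) (PiTensorProduct.map₂ m) := by
  classical
  intro h x y
  let F : (⨂[k] v, W v) →ₗ[k] (⨂[k] v, W v) →ₗ[k] ⨂[k] v, W v :=
    (PiTensorProduct.map₂ m).compr₂ (atComponent k W v (o h))
  let G : (⨂[k] v, W v) →ₗ[k] (⨂[k] v, W v) →ₗ[k] ⨂[k] v, W v :=
    ∑ p ∈ (ℛ k h).index, (PiTensorProduct.map₂ m).compl₁₂
      (atComponent k W v (o ((ℛ k h).left p))) (atComponent k W v (o ((ℛ k h).right p)))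
  have hFG : F = G := by
    refine piTensor_ext₂ fun x y => ?_
    simp only [F, G, LinearMap.compr₂_apply, LinearMap.sum_apply, LinearMap.compl₁₂_apply,
      PiTensorProduct.map₂_tprod_tprod, atComponent_tprod, ho h (x v) (y v)]
    rw [MultilinearMap.map_update_sum]
    refine Finset.sum_congr rfl fun p _ => congrArg _ (funext fun u => ?_)
    by_cases hu : u = v
    · subst hu; simp
    · simp [hu]
  have := LinearMap.congr_fun (LinearMap.congr_fun hFG x) y
  simpa only [F, G, LinearMap.compr₂_apply, LinearMap.sum_apply, LinearMap.compl₁₂_apply,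
    LinearMap.comp_apply] using this

end Components

section Factors

variable {k : Type*} [Field k] {ι M : Type*} [AddCommGroup M] [Module k M]

/-- An element of `⨂ M` which is fixed by the operators `f i` on the factors is fixed by their
tensor product. -/
theorem map_eq_self_of_atFactor [Finite ι] {f : ι → Module.End k M} {x : ⨂[k] _ : ι, M}
    (h : ∀ i, atFactor k i (f i) x = x) : PiTensorProduct.map f x = x := by
  classical
  have := Fintype.ofFinite ι
  suffices hs : ∀ s : Finset ι,
      PiTensorProduct.map (fun i => if i ∈ s then f i else LinearMap.id) x = x by
    simpa using hs Finset.univ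
  intro s
  induction s using Finset.induction_on with
  | empty => simp
  | insert i s hi ih =>
    have h1 : PiTensorProduct.map (fun j => if j ∈ insert i s then f j else LinearMap.id) =
        atFactor k i (f i) * PiTensorProduct.map (fun j => if j ∈ s then f j else LinearMap.id) := by
      refine PiTensorProduct.ext (MultilinearMap.ext fun w => ?_)
      simp only [LinearMap.compMultilinearMap_apply, Module.End.mul_apply, atFactor_tprod,
        PiTensorProduct.map_tprod]
      congr 1
      ext j
      by_cases hj : j = i
      · subst hj; simp [hi]
      · simp [hj]
    rw [h1, Module.End.mul_apply, ih, h]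

theorem map_comp_atFactor {N : Type*} [AddCommGroup N] [Module k N] (i : ι) (r : M →ₗ[k] N)
    {f : Module.End k M} {g : Module.End k N} (h : r ∘ₗ f = g ∘ₗ r) (x : ⨂[k] _ : ι, M) :
    PiTensorProduct.map (fun _ => r) (atFactor k i f x) =
      atFactor k i g (PiTensorProduct.map (fun _ => r) x) := by
  classical
  suffices hs : PiTensorProduct.map (fun _ => r) ∘ₗ atFactor k i f =
      atFactor k i g ∘ₗ PiTensorProduct.map (fun _ => r) from LinearMap.congr_fun hs x
  refine PiTensorProduct.ext (MultilinearMap.ext fun w => ?_)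
  simp only [LinearMap.compMultilinearMap_apply, LinearMap.comp_apply, atFactor_tprod,
    PiTensorProduct.map_tprod]
  congr 1
  ext j
  by_cases hj : j = i
  · subst hj; simpa using LinearMap.congr_fun h (w j)
  · simp [hj]

end Factors

/-! ### Sorting the edge ends by vertices and by edges. -/

section Splitting

variable {k K : Type*} [Field k] [Ring K] [HopfAlgebra k K] {V E : Type*} [Finite V] [Finite E]

local notation "ε" => Coalgebra.counit (R := k) (A := K)

/-- The element of `⨂ᵥ K*^{⊗v}` with entry `β x` at the edge end `x`. -/
def ends (Γ : DirectedGraph V E) (β : E ⊕ E → D k K) : VertexFns k K Γ :=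
  groupTensor k Γ.endVertex (D k K) β

variable {Γ : DirectedGraph V E}

theorem endSplit_tprod (α β : E → D k K) :
    endSplit k K Γ (PiTensorProduct.tprod k fun e => α e ⊗ₜ[k] β e) = ends Γ (Sum.elim α β) := by
  have h1 : (interchange k E (D k K) (D k K)).symm (PiTensorProduct.tprod k fun e => α e ⊗ₜ β e) =
      PiTensorProduct.tprod k α ⊗ₜ[k] PiTensorProduct.tprod k β := by
    rw [LinearEquiv.symm_apply_eq]
    change _ = interchangeMap k E _ _ _
    rw [interchangeMap, TensorProduct.lift.tmul, PiTensorProduct.map₂_tprod_tprod]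
    rfl
  rw [endSplit, LinearEquiv.trans_apply, LinearEquiv.trans_apply, h1,
    PiTensorProduct.tmulEquiv_apply]
  change PiTensorProduct.lift (groupTensor k Γ.endVertex (D k K)) _ = _
  rw [PiTensorProduct.lift.tprod]
  rfl

theorem ends_eq_endSplit (β : E ⊕ E → D k K) : ends Γ β =
    endSplit k K Γ (PiTensorProduct.tprod k fun e => β (Sum.inl e) ⊗ₜ[k] β (Sum.inr e)) := by
  rw [endSplit_tprod]
  congr 1
  ext (e | e) <;> rfl

theorem ends_ext {P : Type*} [AddCommMonoid P] [Module k P] {f g : VertexFns k K Γ →ₗ[k] P}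
    (h : ∀ β, f (ends Γ β) = g (ends Γ β)) : f = g := by
  have h1 : f ∘ₗ (group k Γ.endVertex (D k K)).toLinearMap =
      g ∘ₗ (group k Γ.endVertex (D k K)).toLinearMap := by
    refine PiTensorProduct.ext (MultilinearMap.ext fun β => ?_)
    have h2 : group k Γ.endVertex (D k K) (PiTensorProduct.tprod k β) = ends Γ β :=
      PiTensorProduct.lift.tprod _
    simp only [LinearMap.compMultilinearMap_apply, LinearMap.comp_apply, LinearEquiv.coe_coe, h2, h]
  refine LinearMap.ext fun x => ?_
  have := LinearMap.congr_fun h1 ((group k Γ.endVertex (D k K)).symm x)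
  simpa only [LinearMap.comp_apply, LinearEquiv.coe_coe, LinearEquiv.apply_symm_apply] using this

theorem ends_ext₂ {P : Type*} [AddCommMonoid P] [Module k P]
    {f g : VertexFns k K Γ →ₗ[k] VertexFns k K Γ →ₗ[k] P}
    (h : ∀ β γ, f (ends Γ β) (ends Γ γ) = g (ends Γ β) (ends Γ γ)) : f = g :=
  ends_ext fun β => ends_ext fun γ => h β γ

variable (Γ) in
/-- The operator which acts by `f` on the factor of the edge end `x`. -/
def atEnd (x : E ⊕ E) : Module.End k (D k K) →ₗ[k] Module.End k (VertexFns k K Γ) :=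
  atComponent k (fun v => ⨂[k] _ : Γ.EndsAt v, D k K) (Γ.endVertex x) ∘ₗ atFactor k ⟨x, rfl⟩

omit [Finite V] [Finite E] in
theorem atEnd_eq {v : V} (x : Γ.EndsAt v) (f : Module.End k (D k K)) : atEnd Γ x.1 f =
    atComponent k (fun v => ⨂[k] _ : Γ.EndsAt v, D k K) v (atFactor k x f) := by
  obtain ⟨x, rfl⟩ := x
  rfl

omit [Finite V] [Finite E] in
theorem atEnd_ends [DecidableEq (E ⊕ E)] (x : E ⊕ E) (f : Module.End k (D k K))
    (β : E ⊕ E → D k K) :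
    atEnd Γ x f (ends Γ β) = ends Γ (Function.update β x (f (β x))) := by
  classical
  refine (atComponent_tprod _ _ _).trans ?_
  rw [atFactor_tprod]
  exact congrArg _ (group_update k Γ.endVertex (D k K) β x (f (β x))).symm

/-- The product is organised by vertices but $G^*$ by edges; this and the next lemma translate
between the two. -/
theorem atEnd_inl (e : E) (f : Module.End k (D k K)) :
    atEnd Γ (Sum.inl e) f =
      (endSplit k K Γ).conj (atFactor (M := D k K ⊗[k] D k K) k e (LinearMap.rTensor (D k K) f)) := by
  classical
  refine ends_ext fun β => ?_
  rw [atEnd_ends, ends_eq_endSplit β, LinearEquiv.conj_apply_apply, LinearEquiv.symm_apply_apply,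
    atFactor_tprod, ends_eq_endSplit]
  congr 2
  ext e' : 1
  by_cases h : e' = e
  · subst h; simp
  · simp [h]

theorem atEnd_inr (e : E) (f : Module.End k (D k K)) :
    atEnd Γ (Sum.inr e) f =
      (endSplit k K Γ).conj (atFactor (M := D k K ⊗[k] D k K) k e (LinearMap.lTensor (D k K) f)) := by
  classical
  refine ends_ext fun β => ?_
  rw [atEnd_ends, ends_eq_endSplit β, LinearEquiv.conj_apply_apply, LinearEquiv.symm_apply_apply,
    atFactor_tprod, ends_eq_endSplit]
  congr 2
  ext e' : 1
  by_cases h : e' = e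
  · subst h; simp
  · simp [h]

end Splitting

/-! ### The map $α ↦ α_2 ⊗ α_1$ on one edge. -/

section Embedding

variable {k K : Type*} [Field k] [Ring K] [HopfAlgebra k K] [Module.Finite k K]

local notation "ε" => Coalgebra.counit (R := k) (A := K)

theorem dualDistrib_dualComul (α : D k K) (x y : K) :
    TensorProduct.dualDistrib k K K (dualComul k K α) (x ⊗ₜ y) = α (x * y) := by
  have h : TensorProduct.dualDistribEquiv k K K (dualComul k K α) = (LinearMap.mul' k K).dualMap α :=
    LinearEquiv.apply_symm_apply _ _
  exact LinearMap.congr_fun h (x ⊗ₜ y)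

theorem dual_tmul_ext {s t : D k K ⊗[k] D k K}
    (h : ∀ x y, TensorProduct.dualDistrib k K K s (x ⊗ₜ y) =
      TensorProduct.dualDistrib k K K t (x ⊗ₜ y)) : s = t :=
  (TensorProduct.dualDistribEquiv k K K).injective (TensorProduct.ext' h)

variable (k K) in
/-- The map `α ↦ α₂ ⊗ α₁`. -/
def splitEdge : D k K →ₗ[k] D k K ⊗[k] D k K :=
  (TensorProduct.comm k (D k K) (D k K)).toLinearMap ∘ₗ dualComul k K

/-- On an edge $G^*$ is thus dual to $x ⊗ y ↦ yx$: a connection on the edge is the product of its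
target part and its starting part. -/
theorem dualDistrib_splitEdge (α : D k K) (x y : K) :
    TensorProduct.dualDistrib k K K (splitEdge k K α) (x ⊗ₜ y) = α (y * x) := by
  rw [← dualDistrib_dualComul α y x, splitEdge, LinearMap.comp_apply]
  generalize dualComul k K α = t
  induction t with
  | zero => simp
  | tmul a b => simp [mul_comm]
  | add a b ha hb => simp only [map_add, LinearMap.add_apply, ha, hb]

omit [Module.Finite k K] in
theorem dualDistrib_rTensor (h : K) (t : D k K ⊗[k] D k K) (x y : K) :
    TensorProduct.dualDistrib k K K (LinearMap.rTensor (D k K) (regRight k K h) t) (x ⊗ₜ y) =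
      TensorProduct.dualDistrib k K K t ((h * x) ⊗ₜ y) := by
  induction t with
  | zero => simp
  | tmul a b => simp
  | add a b ha hb => simp only [map_add, LinearMap.add_apply, ha, hb]

omit [Module.Finite k K] in
theorem dualDistrib_lTensor (h : K) (t : D k K ⊗[k] D k K) (x y : K) :
    TensorProduct.dualDistrib k K K (LinearMap.lTensor (D k K) (regLeft k K h) t) (x ⊗ₜ y) =
      TensorProduct.dualDistrib k K K t (x ⊗ₜ (y * h)) := by
  induction t with
  | zero => simp
  | tmul a b => simp
  | add a b ha hb => simp only [map_add, LinearMap.add_apply, ha, hb]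

variable (k K) in
/-- The map `α ⊗ β ↦ ⟨α, 1⟩ β`. -/
def mergeEdge : D k K ⊗[k] D k K →ₗ[k] D k K :=
  TensorProduct.lift (LinearMap.lsmul k (D k K) ∘ₗ Module.Dual.eval k K 1)

omit [Module.Finite k K] in
@[simp]
theorem mergeEdge_tmul (α β : D k K) : mergeEdge k K (α ⊗ₜ β) = α 1 • β := rfl

omit [Module.Finite k K] in
theorem mergeEdge_apply (t : D k K ⊗[k] D k K) (y : K) :
    mergeEdge k K t y = TensorProduct.dualDistrib k K K t (1 ⊗ₜ y) := by
  induction t with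
  | zero => simp
  | tmul a b => simp
  | add a b ha hb => simp only [map_add, LinearMap.add_apply, ha, hb]

theorem mergeEdge_splitEdge (α : D k K) : mergeEdge k K (splitEdge k K α) = α := by
  ext y
  rw [mergeEdge_apply, dualDistrib_splitEdge, mul_one]

theorem splitEdge_counit : splitEdge k K ε = ε ⊗ₜ ε := by
  refine dual_tmul_ext fun x y => ?_
  rw [dualDistrib_splitEdge]
  simp [mul_comm]

omit [Module.Finite k K] in
theorem mergeEdge_lTensor (h : K) :
    mergeEdge k K ∘ₗ LinearMap.lTensor (D k K) (regLeft k K h) = regLeft k K h ∘ₗ mergeEdge k K := by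
  ext; simp

/-- The two regular actions agree on the image of `α ↦ α₂ ⊗ α₁`. -/
theorem rTensor_splitEdge (h : K) (α : D k K) :
    LinearMap.rTensor (D k K) (regRight k K h) (splitEdge k K α) =
      LinearMap.lTensor (D k K) (regLeft k K h) (splitEdge k K α) := by
  refine dual_tmul_ext fun x y => ?_
  rw [dualDistrib_rTensor, dualDistrib_lTensor, dualDistrib_splitEdge, dualDistrib_splitEdge,
    mul_assoc]

variable {ι : Type*}

/-- Invariance under the difference of the two regular actions in one factor. -/
theorem atFactor_splitEdge_mergeEdge {i : ι} {x : ⨂[k] _ : ι, (D k K ⊗[k] D k K)}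
    (hx : ∀ h, atFactor (M := D k K ⊗[k] D k K) k i (LinearMap.rTensor (D k K) (regRight k K h)) x =
      atFactor (M := D k K ⊗[k] D k K) k i (LinearMap.lTensor (D k K) (regLeft k K h)) x) :
    atFactor (M := D k K ⊗[k] D k K) k i (splitEdge k K ∘ₗ mergeEdge k K) x = x := by
  let b := Module.finBasis k K
  -- Expand $x = \sum_j x^jb_j$. Then $t(x, y) = \sum_j x^jt(b_j, y)$, and invariance turns $t(b_j,
  -- y)$ into $t(1, yb_j)$, so that $t(x, y) = t(1, yx)$.
  let Q : Fin (Module.finrank k K) → Module.End k (D k K ⊗[k] D k K) := fun j =>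
    TensorProduct.mk k (D k K) (D k K) (b.coord j) ∘ₗ mergeEdge k K
  have hQ : ∀ j t x y, TensorProduct.dualDistrib k K K (Q j t) (x ⊗ₜ y) =
      b.coord j x * TensorProduct.dualDistrib k K K t (1 ⊗ₜ y) := by
    intro j t x y
    rw [← mergeEdge_apply]
    simp [Q]
  have key : ∀ (x : K) (φ : D k K), φ x = ∑ j, b.coord j x * φ (b j) := by
    intro x φ
    conv_lhs => rw [← b.sum_repr x]
    simp only [map_sum, map_smul, smul_eq_mul, Module.Basis.coord_apply]
  have h1 : (1 : Module.End k (D k K ⊗[k] D k K)) =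
      ∑ j, Q j * LinearMap.rTensor (D k K) (regRight k K (b j)) := by
    refine LinearMap.ext fun t => dual_tmul_ext fun x y => ?_
    simp only [LinearMap.sum_apply, map_sum, Module.End.mul_apply, hQ, dualDistrib_rTensor, mul_one,
      Module.End.one_apply]
    exact key x (TensorProduct.dualDistrib k K K t ∘ₗ (TensorProduct.mk k K K).flip y)
  have h2 : splitEdge k K ∘ₗ mergeEdge k K =
      ∑ j, Q j * LinearMap.lTensor (D k K) (regLeft k K (b j)) := by
    refine LinearMap.ext fun t => dual_tmul_ext fun x y => ?_
    simp only [LinearMap.sum_apply, map_sum, Module.End.mul_apply, hQ, dualDistrib_lTensor,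
      LinearMap.comp_apply, dualDistrib_splitEdge, mergeEdge_apply]
    exact key x (TensorProduct.dualDistrib k K K t ∘ₗ TensorProduct.mk k K K 1 ∘ₗ
      LinearMap.mulLeft k y)
  have h3 : x = ∑ j, atFactor (M := D k K ⊗[k] D k K) k i (Q j)
      (atFactor (M := D k K ⊗[k] D k K) k i (LinearMap.rTensor (D k K) (regRight k K (b j))) x) := by
    have := congrArg (fun f => atFactor (M := D k K ⊗[k] D k K) k i f x) h1
    simpa only [atFactor_one, Module.End.one_apply, map_sum, atFactor_mul, LinearMap.sum_apply,
      Module.End.mul_apply] using this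
  conv_rhs => rw [h3]
  rw [h2]
  simp only [map_sum, atFactor_mul, LinearMap.sum_apply, Module.End.mul_apply, hx]

end Embedding

theorem map₂_assoc {k V : Type*} [Field k] {W : V → Type*} [∀ v, AddCommMonoid (W v)]
    [∀ v, Module k (W v)] {m : ∀ v, W v →ₗ[k] W v →ₗ[k] W v}
    (h : ∀ v a b c, m v (m v a b) c = m v a (m v b c)) (x y z : ⨂[k] v, W v) :
    PiTensorProduct.map₂ m (PiTensorProduct.map₂ m x y) z =
      PiTensorProduct.map₂ m x (PiTensorProduct.map₂ m y z) := by
  induction x using PiTensorProduct.induction_on with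
  | add a b ha hb => simp only [map_add, LinearMap.add_apply, ha, hb]
  | smul_tprod c x =>
    induction y using PiTensorProduct.induction_on with
    | add a b ha hb => simp only [map_add, LinearMap.add_apply, ha, hb]
    | smul_tprod c' y =>
      induction z using PiTensorProduct.induction_on with
      | add a b ha hb => simp only [map_add, ha, hb]
      | smul_tprod c'' z =>
        simp only [map_smul, LinearMap.smul_apply, PiTensorProduct.map₂_tprod_tprod, h]

/-! ### The image of $G^*$ in the tensor product of the vertex algebras. -/

section GraphAlgebra

variable {k K : Type*} [Field k] [Ring K] [HopfAlgebra k K] {V E : Type*} [Finite V] [Finite E]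

local notation "ε" => Coalgebra.counit (R := k) (A := K)

section Embedding

variable [Module.Finite k K] {Γ : DirectedGraph V E}

theorem gStar_apply (a : ⨂[k] _ : E, D k K) : gStar k K Γ a =
    endSplit k K Γ (PiTensorProduct.map (fun _ => splitEdge k K) a) := rfl

omit [Module.Finite k K] in
variable (k K Γ) in
/-- A left inverse of `G*`. -/
def gMerge : VertexFns k K Γ →ₗ[k] ⨂[k] _ : E, D k K :=
  PiTensorProduct.map (fun _ => mergeEdge k K) ∘ₗ (endSplit k K Γ).symm.toLinearMap

theorem gMerge_gStar (a : ⨂[k] _ : E, D k K) : gMerge k K Γ (gStar k K Γ a) = a := by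
  rw [gStar_apply, gMerge, LinearMap.comp_apply, LinearEquiv.coe_coe, LinearEquiv.symm_apply_apply,
    ← LinearMap.comp_apply, ← PiTensorProduct.map_comp]
  have h : (fun _ : E => mergeEdge k K ∘ₗ splitEdge k K) = fun _ => LinearMap.id :=
    funext fun _ => LinearMap.ext mergeEdge_splitEdge
  rw [h, PiTensorProduct.map_id, LinearMap.id_apply]

theorem gStar_injective : Function.Injective (gStar k K Γ) :=
  Function.LeftInverse.injective gMerge_gStar

theorem gStar_tprod (α : E → D k K) : gStar k K Γ (PiTensorProduct.tprod k α) =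
    endSplit k K Γ (PiTensorProduct.tprod k fun e => splitEdge k K (α e)) := by
  rw [gStar_apply, PiTensorProduct.map_tprod]

omit [Module.Finite k K] [Finite V] [Finite E] in
theorem ends_counit : ends Γ (fun _ => ε) =
    PiTensorProduct.tprod k fun v => fnOne k K (Γ.EndsAt v) := rfl

theorem gStar_fnOne : gStar k K Γ (fnOne k K E) =
    PiTensorProduct.tprod k fun v => fnOne k K (Γ.EndsAt v) := by
  rw [fnOne, gStar_tprod, ← ends_counit, ends_eq_endSplit]
  simp only [splitEdge_counit]

variable (k K Γ) in
omit [Module.Finite k K] [Finite V] [Finite E] in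
/-- The regular action of `K` at an edge end which commutes with gauge transformations. -/
def endOther (x : E ⊕ E) : K →ₗ[k] Module.End k (VertexFns k K Γ) :=
  atEnd Γ x ∘ₗ otherAct (tau x)

omit [Module.Finite k K] in
theorem endOther_inl (e : E) (h : K) : endOther k K Γ (Sum.inl e) h =
    (endSplit k K Γ).conj (atFactor (M := D k K ⊗[k] D k K) k e
      (LinearMap.rTensor (D k K) (regRight k K h))) :=
  atEnd_inl e _

omit [Module.Finite k K] in
theorem endOther_inr (e : E) (h : K) : endOther k K Γ (Sum.inr e) h =
    (endSplit k K Γ).conj (atFactor (M := D k K ⊗[k] D k K) k e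
      (LinearMap.lTensor (D k K) (regLeft k K h))) :=
  atEnd_inr e _

/-- The image of `G*` consists of the elements on which the two regular actions of `K` at the ends
of each edge agree. -/
theorem mem_range_gStar {x : VertexFns k K Γ} : x ∈ LinearMap.range (gStar k K Γ) ↔
    ∀ e h, endOther k K Γ (Sum.inl e) h x = endOther k K Γ (Sum.inr e) h x := by
  constructor
  · rintro ⟨a, rfl⟩ e h
    rw [endOther_inl, endOther_inr, LinearEquiv.conj_apply_apply, LinearEquiv.conj_apply_apply,
      gStar_apply, LinearEquiv.symm_apply_apply]
    congr 1
    classical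
    induction a using PiTensorProduct.induction_on with
    | smul_tprod c α =>
      simp only [map_smul, PiTensorProduct.map_tprod]
      congr 1
      refine (atFactor_tprod (M := D k K ⊗[k] D k K) _ _ _).trans
        (Eq.trans ?_ (atFactor_tprod (M := D k K ⊗[k] D k K) _ _ _).symm)
      rw [rTensor_splitEdge]
    | add a b ha hb => simp only [map_add, ha, hb]
  · intro hx
    -- Edge by edge, invariance means being fixed by `splitEdge k K ∘ₗ mergeEdge k K`; fixing every
    -- factor then fixes the whole tensor.
    have h1 : ∀ e, atFactor (M := D k K ⊗[k] D k K) k e (splitEdge k K ∘ₗ mergeEdge k K)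
        ((endSplit k K Γ).symm x) = (endSplit k K Γ).symm x := by
      intro e
      refine atFactor_splitEdge_mergeEdge fun h => ?_
      have := hx e h
      rw [endOther_inl, endOther_inr, LinearEquiv.conj_apply_apply,
        LinearEquiv.conj_apply_apply] at this
      exact (endSplit k K Γ).injective this
    have h2 := map_eq_self_of_atFactor (M := D k K ⊗[k] D k K) h1
    refine ⟨gMerge k K Γ x, ?_⟩
    rw [gStar_apply, gMerge, LinearMap.comp_apply, ← LinearMap.comp_apply (PiTensorProduct.map _),
      ← PiTensorProduct.map_comp]
    exact (endSplit k K Γ).symm_apply_eq.1 h2.symm |>.symm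

theorem gStar_gMerge {x : VertexFns k K Γ} (hx : x ∈ LinearMap.range (gStar k K Γ)) :
    gStar k K Γ (gMerge k K Γ x) = x := by
  obtain ⟨a, rfl⟩ := hx
  rw [gMerge_gStar]

-- Lets triviality of the other action at a target end be read off on the edge factor after pulling
-- back.
omit [Module.Finite k K] in
theorem gMerge_endOther_inr (e : E) (h : K) (x : VertexFns k K Γ) :
    gMerge k K Γ (endOther k K Γ (Sum.inr e) h x) =
      atFactor k e (regLeft k K h) (gMerge k K Γ x) := by
  have h1 : ∀ x, gMerge k K Γ x =
    PiTensorProduct.map (fun _ => mergeEdge k K) ((endSplit k K Γ).symm x) := fun _ => rfl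
  rw [endOther_inr, LinearEquiv.conj_apply_apply, h1, h1, LinearEquiv.symm_apply_apply]
  generalize (endSplit k K Γ).symm x = t
  have h2 := map_comp_atFactor (M := D k K ⊗[k] D k K) (N := D k K) e (mergeEdge k K)
    (mergeEdge_lTensor h) t
  rw [h2]

end Embedding

variable (Γ : CiliatedRibbonGraph V E) (R : V → K ⊗[k] K) (s : E ⊕ E → Bool)

/-- The product of the tensor product of the vertex algebras. -/
def graphMul : VertexFns k K Γ.toDirectedGraph →ₗ[k] VertexFns k K Γ.toDirectedGraph →ₗ[k]
    VertexFns k K Γ.toDirectedGraph :=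
  PiTensorProduct.map₂ fun v =>
    letI := Γ.endOrder v
    vertexMul (R v) (fun x : Γ.EndsAt v => s x.1) (fun x => tau x.1)

variable {Γ R s}

omit [Finite V] in
theorem graphMul_one (hR : ∀ v, IsRMatrix k (R v)) (x : VertexFns k K Γ.toDirectedGraph) :
    graphMul Γ R s x (PiTensorProduct.tprod k fun v => fnOne k K (Γ.EndsAt v)) = x := by
  have h : (graphMul Γ R s).flip (PiTensorProduct.tprod k fun v => fnOne k K (Γ.EndsAt v)) =
      LinearMap.id := by
    refine PiTensorProduct.ext (MultilinearMap.ext fun w => ?_)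
    refine (PiTensorProduct.map₂_tprod_tprod _ _ _).trans (congrArg _ (funext fun v => ?_))
    let := Γ.endOrder v
    exact vertexMul_apply_one (hR v) _
  exact LinearMap.congr_fun h x

omit [Finite V] in
theorem one_graphMul (hR : ∀ v, IsRMatrix k (R v)) (x : VertexFns k K Γ.toDirectedGraph) :
    graphMul Γ R s (PiTensorProduct.tprod k fun v => fnOne k K (Γ.EndsAt v)) x = x := by
  have h : graphMul Γ R s (PiTensorProduct.tprod k fun v => fnOne k K (Γ.EndsAt v)) =
      LinearMap.id := by
    refine PiTensorProduct.ext (MultilinearMap.ext fun w => ?_)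
    refine (PiTensorProduct.map₂_tprod_tprod _ _ _).trans (congrArg _ (funext fun v => ?_))
    let := Γ.endOrder v
    exact LinearMap.congr_fun (vertexMul_one (hR v)) _
  exact LinearMap.congr_fun h x

omit [Finite V] in
theorem graphMul_assoc (hR : ∀ v, IsRMatrix k (R v)) (x y z : VertexFns k K Γ.toDirectedGraph) :
    graphMul Γ R s (graphMul Γ R s x y) z = graphMul Γ R s x (graphMul Γ R s y z) := by
  refine map₂_assoc (fun v => ?_) x y z
  let := Γ.endOrder v
  intro a b c
  have h1 := vertexMul_assoc (σ := fun x : Γ.EndsAt v => s x.1) (τ := fun x => tau x.1) (hR v) a b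
  have h2 := LinearMap.congr_fun h1 c
  rw [Module.End.mul_apply] at h2
  exact h2

omit [Finite V] [Finite E] in
theorem endOther_eq (x : E ⊕ E) (τ : Γ.EndsAt (Γ.endVertex x) → Bool) (hτ : τ ⟨x, rfl⟩ = tau x) :
    endOther k K Γ.toDirectedGraph x =
      atComponent k (fun v => ⨂[k] _ : Γ.EndsAt v, D k K) (Γ.endVertex x) ∘ₗ
        otherAt k K τ ⟨x, rfl⟩ := by
  refine LinearMap.ext fun h => ?_
  rw [LinearMap.comp_apply, otherAt_apply, hτ]
  rfl

omit [Finite V] in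
theorem isModuleAlgebraAct_endOther (hR : ∀ v, IsRMatrix k (R v)) {x : E ⊕ E} (hx : s x = !tau x) :
    IsModuleAlgebraAct (endOther k K Γ.toDirectedGraph x) (graphMul Γ R s) := by
  let := Γ.endOrder (Γ.endVertex x)
  rw [endOther_eq x (fun y => tau y.1) rfl]
  have h := isModuleAlgebraAct_otherAt (σ := fun y : Γ.EndsAt (Γ.endVertex x) => s y.1)
      (τ := fun y => tau y.1) (hR (Γ.endVertex x)) (i := ⟨x, rfl⟩) hx
  exact isModuleAlgebraAct_atComponent (m := fun v => letI := Γ.endOrder v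
      vertexMul (R v) (fun x : Γ.EndsAt v => s x.1) (fun x => tau x.1)) h

omit [Finite V] in
theorem isModuleAlgebraAct_endOther_cop (hR : ∀ v, IsRMatrix k (R v)) {x : E ⊕ E}
    (hx : s x = tau x) :
    IsModuleAlgebraAct (endOther k K Γ.toDirectedGraph x ∘ₗ ofCop k K) (graphMul Γ R s) := by
  let := Γ.endOrder (Γ.endVertex x)
  rw [endOther_eq x (fun y => tau y.1) rfl, LinearMap.comp_assoc]
  have h := isModuleAlgebraAct_otherAt_cop (σ := fun y : Γ.EndsAt (Γ.endVertex x) => s y.1)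
      (τ := fun y => tau y.1) (hR (Γ.endVertex x)) (i := ⟨x, rfl⟩) hx
  exact isModuleAlgebraAct_atComponent (m := fun v => letI := Γ.endOrder v
      vertexMul (R v) (fun x : Γ.EndsAt v => s x.1) (fun x => tau x.1)) h

/-- The image of `G*` is a subalgebra. -/
theorem graphMul_mem_range [Module.Finite k K] (hR : ∀ v, IsRMatrix k (R v))
    (hs : ∀ e, s (Sum.inr e) = !s (Sum.inl e)) {x y : VertexFns k K Γ.toDirectedGraph}
    (hx : x ∈ LinearMap.range (gStar k K Γ.toDirectedGraph))
    (hy : y ∈ LinearMap.range (gStar k K Γ.toDirectedGraph)) :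
    graphMul Γ R s x y ∈ LinearMap.range (gStar k K Γ.toDirectedGraph) := by
  rw [mem_range_gStar] at hx hy ⊢
  intro e h
  -- Since $τ$ and $σ$ both change between the ends of $e$, either both ends use $Δ$ or both use
  -- $Δ^{op}$, and the two expansions agree term by term.
  cases h1 : s (Sum.inl e) with
  | false =>
    have h2 := isModuleAlgebraAct_endOther (Γ := Γ) hR (s := s) (x := Sum.inl e) h1
    have h3 := isModuleAlgebraAct_endOther (Γ := Γ) hR (s := s) (x := Sum.inr e)
      ((hs e).trans (by rw [h1]; rfl))
    rw [h2, h3]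
    simp only [hx e, hy e]
  | true =>
    have h2 := isModuleAlgebraAct_endOther_cop (Γ := Γ) hR (s := s) (x := Sum.inl e) h1
    have h3 := isModuleAlgebraAct_endOther_cop (Γ := Γ) hR (s := s) (x := Sum.inr e)
      ((hs e).trans (by rw [h1]; rfl))
    rw [isModuleAlgebraAct_cop] at h2 h3
    rw [h2, h3]
    simp only [hx e, hy e]

-- Elements on which the other action at an end is trivial are closed under products, whichever of
-- $Δ$ and $Δ^{op}$ governs this end. This controls the support of products of edge functions.
omit [Finite V] in
theorem endOther_graphMul (hR : ∀ v, IsRMatrix k (R v)) {e : E ⊕ E}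
    {x y : VertexFns k K Γ.toDirectedGraph}
    (hx : ∀ h, endOther k K Γ.toDirectedGraph e h x = ε h • x)
    (hy : ∀ h, endOther k K Γ.toDirectedGraph e h y = ε h • y) (h : K) :
    endOther k K Γ.toDirectedGraph e h (graphMul Γ R s x y) = ε h • graphMul Γ R s x y := by
  have h4 := congrArg (Coalgebra.counit (R := k)) (Coalgebra.sum_counit_smul (ℛ k h))
  simp only [map_sum, map_smul, smul_eq_mul] at h4
  by_cases h1 : s e = tau e
  · have h2 := isModuleAlgebraAct_endOther_cop (Γ := Γ) hR h1
    rw [isModuleAlgebraAct_cop] at h2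
    simp only [h2 h x y, hx, hy, map_smul, LinearMap.smul_apply, smul_smul, ← Finset.sum_smul, h4]
  · have h2 := isModuleAlgebraAct_endOther (Γ := Γ) hR (Bool.eq_not_of_ne h1)
    simp only [h2 h x y, hx, hy, map_smul, LinearMap.smul_apply, smul_smul, ← Finset.sum_smul]
    rw [← h4]
    simp only [mul_comm]

section ProductAct

omit [Finite V] in
theorem productAct_tprod (h : V → K) : productAct (ribbonAct k K Γ) (PiTensorProduct.tprod k h) =
    PiTensorProduct.map fun v => ribbonAct k K Γ v (h v) := by
  rw [productAct, LinearMap.comp_apply, PiTensorProduct.map_tprod,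
    PiTensorProduct.piTensorHomMap_tprod_eq_map]

omit [Finite V] in
theorem productAct_one : productAct (ribbonAct k K Γ) 1 = 1 := by
  rw [PiTensorProduct.one_def, productAct_tprod]
  have h : ∀ v, ribbonAct k K Γ v ((1 : V → K) v) = LinearMap.id := fun v =>
    letI := Γ.endOrder v
    tensorAct_one _ _
  simp only [h]
  exact PiTensorProduct.map_id

omit [Finite V] in
theorem productAct_mul (h h' : ⨂[k] _ : V, K) : productAct (ribbonAct k K Γ) (h * h') =
    productAct (ribbonAct k K Γ) h' * productAct (ribbonAct k K Γ) h := by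
  let F := (LinearMap.mul k (⨂[k] _ : V, K)).compr₂ (productAct (ribbonAct k K Γ))
  let G := ((LinearMap.mul k (Module.End k (VertexFns k K Γ.toDirectedGraph))).compl₁₂
    (productAct (ribbonAct k K Γ)) (productAct (ribbonAct k K Γ))).flip
  have hFG : F = G := by
    refine piTensor_ext₂ fun x y => ?_
    change productAct (ribbonAct k K Γ) (PiTensorProduct.tprod k x * PiTensorProduct.tprod k y) =
      productAct (ribbonAct k K Γ) (PiTensorProduct.tprod k y) *
        productAct (ribbonAct k K Γ) (PiTensorProduct.tprod k x)
    rw [PiTensorProduct.tprod_mul_tprod, productAct_tprod, productAct_tprod, productAct_tprod]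
    refine (congrArg _ (funext fun v => ?_)).trans (PiTensorProduct.map_comp _ _)
    let := Γ.endOrder v
    exact tensorAct_mul _ _ _ _
  exact LinearMap.congr_fun (LinearMap.congr_fun hFG h) h'

theorem productAct_fnOne (h : ⨂[k] _ : V, K) : productAct (ribbonAct k K Γ) h
    (PiTensorProduct.tprod k fun v => fnOne k K (Γ.EndsAt v)) =
      tensorCounit k K V h • PiTensorProduct.tprod k fun v => fnOne k K (Γ.EndsAt v) := by
  have := Fintype.ofFinite V
  induction h using PiTensorProduct.induction_on with
  | add a b ha hb => simp only [map_add, LinearMap.add_apply, ha, hb, add_smul]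
  | smul_tprod c h =>
    rw [map_smul, map_smul, LinearMap.smul_apply, smul_assoc, productAct_tprod,
      PiTensorProduct.map_tprod, tensorCounit_tprod, ← MultilinearMap.map_smul_univ]
    refine congrArg _ (congrArg _ (funext fun v => ?_))
    let := Γ.endOrder v
    exact tensorAct_fnOne _ _

theorem productAct_graphMul (hR : ∀ v, IsRMatrix k (R v)) (h : ⨂[k] _ : V, K)
    (x y : VertexFns k K Γ.toDirectedGraph) :
    productAct (ribbonAct k K Γ) h (graphMul Γ R s x y) =
      TensorProduct.lift ((graphMul Γ R s).compl₁₂ ((productAct (ribbonAct k K Γ)).flip x)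
        ((productAct (ribbonAct k K Γ)).flip y)) (tensorComul k K V h) := by
  classical
  have := Fintype.ofFinite V
  induction h using PiTensorProduct.induction_on with
  | add a b ha hb => simp only [map_add, LinearMap.add_apply, ha, hb]
  | smul_tprod c h =>
    rw [map_smul, map_smul, map_smul, LinearMap.smul_apply]
    congr 1
    rw [tensorComul_tprod, map_sum]
    simp only [TensorProduct.lift.tmul, LinearMap.compl₁₂_apply, LinearMap.flip_apply,
      productAct_tprod]
    let F := (graphMul Γ R s).compr₂ (PiTensorProduct.map fun v => ribbonAct k K Γ v (h v))
    let G := ∑ p ∈ Fintype.piFinset fun v => (ℛ k (h v)).index, (graphMul Γ R s).compl₁₂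
      (PiTensorProduct.map fun v => ribbonAct k K Γ v ((ℛ k (h v)).left (p v)))
      (PiTensorProduct.map fun v => ribbonAct k K Γ v ((ℛ k (h v)).right (p v)))
    have hFG : F = G := by
      refine piTensor_ext₂ fun x y => ?_
      simp only [F, G, LinearMap.compr₂_apply, LinearMap.sum_apply, LinearMap.compl₁₂_apply,
        graphMul, PiTensorProduct.map₂_tprod_tprod, PiTensorProduct.map_tprod]
      refine Eq.trans (congrArg _ (funext fun v => ?_)) (MultilinearMap.map_sum_finset _
        (fun v p => (letI := Γ.endOrder v
          vertexMul (R v) (fun x : Γ.EndsAt v => s x.1) (fun x => tau x.1))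
            (ribbonAct k K Γ v ((ℛ k (h v)).left p) (x v))
            (ribbonAct k K Γ v ((ℛ k (h v)).right p) (y v))) _)
      let := Γ.endOrder v
      exact isModuleAlgebraAct_vertexAct (hR v) (h v) (x v) (y v)
    have := LinearMap.congr_fun (LinearMap.congr_fun hFG x) y
    simpa only [F, G, LinearMap.compr₂_apply, LinearMap.sum_apply, LinearMap.compl₁₂_apply] using this

-- Left and right regular actions commute; therefore gauge transformations preserve the condition
-- that characterises the image of $G^*$.
omit [Finite V] in
theorem commute_productAct_endOther (h : ⨂[k] _ : V, K) (x : E ⊕ E) (h' : K) :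
    Commute (productAct (ribbonAct k K Γ) h) (endOther k K Γ.toDirectedGraph x h') := by
  induction h using PiTensorProduct.induction_on with
  | add a b ha hb => rw [map_add]; exact ha.add_left hb
  | smul_tprod c h =>
    rw [map_smul, productAct_tprod]
    refine Commute.smul_left ?_ c
    let := Γ.endOrder (Γ.endVertex x)
    exact map_commute_atComponent (W := fun v => ⨂[k] _ : Γ.EndsAt v, D k K)
      (commute_vertexAct_otherAt (τ := fun y : Γ.EndsAt (Γ.endVertex x) => tau y.1) ⟨x, rfl⟩ _ h')

/-- The image of `G*` is a submodule. -/
theorem productAct_mem_range [Module.Finite k K] (h : ⨂[k] _ : V, K)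
    {x : VertexFns k K Γ.toDirectedGraph}
    (hx : x ∈ LinearMap.range (gStar k K Γ.toDirectedGraph)) :
    productAct (ribbonAct k K Γ) h x ∈ LinearMap.range (gStar k K Γ.toDirectedGraph) := by
  rw [mem_range_gStar] at hx ⊢
  intro e h'
  have h1 := fun y => LinearMap.congr_fun (commute_productAct_endOther (Γ := Γ) h y h').eq x
  simp only [Module.End.mul_apply] at h1
  rw [← h1, ← h1, hx]

end ProductAct

end GraphAlgebra

/-! ### Supports of functions, detected by the regular action. -/

section Supports

variable {k K : Type*} [Field k] [Ring K] [HopfAlgebra k K] {ι : Type*}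

local notation "ε" => Coalgebra.counit (R := k) (A := K)

variable (k K) in
/-- The projection `α ↦ ⟨α, 1⟩ 1` onto the multiples of the unit. -/
def unitProj : Module.End k (D k K) := LinearMap.smulRight (Module.Dual.eval k K 1) ε

@[simp]
theorem unitProj_apply (α : D k K) : unitProj k K α = α 1 • ε := rfl

/-- In one factor, $α(y) = (y ▷ α)(1) = ε(y)α(1)$. In a tensor power the same computation is carried
out with a basis of $K$. -/
theorem atFactor_unitProj [Module.Finite k K] {i : ι} {x : ⨂[k] _ : ι, D k K}
    (hx : ∀ h, atFactor k i (regLeft k K h) x = ε h • x) : atFactor k i (unitProj k K) x = x := by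
  let b := Module.finBasis k K
  let J : Fin (Module.finrank k K) → Module.End k (D k K) := fun j =>
    LinearMap.smulRight (Module.Dual.eval k K 1) (b.coord j)
  have key : ∀ (x : K) (φ : D k K), φ x = ∑ j, b.coord j x * φ (b j) := by
    intro x φ
    conv_lhs => rw [← b.sum_repr x]
    simp only [map_sum, map_smul, smul_eq_mul, Module.Basis.coord_apply]
  have h1 : (1 : Module.End k (D k K)) = ∑ j, J j * regLeft k K (b j) := by
    ext α y
    simp [J, key y α]
  have h2 : unitProj k K = ∑ j, ε (b j) • J j := by
    ext α y
    simp only [J, unitProj_apply, LinearMap.smul_apply, LinearMap.sum_apply, key y ε, smul_eq_mul,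
      LinearMap.smulRight_apply, Module.Dual.eval_apply, Finset.mul_sum]
    exact Finset.sum_congr rfl fun j _ => by ring
  have h3 := congrArg (fun f => atFactor k i f x) h1
  simp only [atFactor_one, Module.End.one_apply, map_sum, atFactor_mul, LinearMap.sum_apply,
    Module.End.mul_apply, hx, map_smul] at h3
  rw [h2]
  simp only [map_sum, map_smul, LinearMap.sum_apply, LinearMap.smul_apply]
  exact h3.symm

open scoped Classical in
theorem map_unitProj_tprod [Fintype ι] (S : Finset ι) (α : ι → D k K) :
    PiTensorProduct.map (fun i => if i ∈ S then LinearMap.id else unitProj k K)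
      (PiTensorProduct.tprod k α) = (∏ i, if i ∈ S then 1 else α i 1) •
        PiTensorProduct.tprod k fun i => if i ∈ S then α i else ε := by
  rw [PiTensorProduct.map_tprod, ← MultilinearMap.map_smul_univ]
  refine congrArg _ (funext fun i => ?_)
  by_cases h : i ∈ S <;> simp [h]

open scoped Classical in
theorem mem_range_singleLin [Finite ι] [Module.Finite k K] {e : ι} {x : ⨂[k] _ : ι, D k K}
    (hx : ∀ i, i ≠ e → ∀ h, atFactor k i (regLeft k K h) x = ε h • x) :
    x ∈ LinearMap.range (singleLin k K e) := by
  have := Fintype.ofFinite ι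
  have h1 := map_eq_self_of_atFactor (x := x)
    (f := fun i => if i ∈ ({e} : Finset ι) then LinearMap.id else unitProj k K) fun i => by
      by_cases h : i ∈ ({e} : Finset ι)
      · simp only [h, if_true]
        exact LinearMap.congr_fun (atFactor_one i) x
      · simp only [h, if_false]
        exact atFactor_unitProj (hx i (by simpa using h))
  rw [← h1]
  clear h1 hx
  induction x using PiTensorProduct.induction_on with
  | add a b ha hb => rw [map_add]; exact add_mem ha hb
  | smul_tprod c α =>
    rw [map_smul, map_unitProj_tprod]
    refine Submodule.smul_mem _ c (Submodule.smul_mem _ _ ⟨α e, ?_⟩)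
    rw [singleLin_apply, single_eq]
    refine congrArg _ (funext fun i => ?_)
    by_cases h : i = e
    · subst h; simp
    · simp [h]

open scoped Classical in
theorem mem_span_pairAt [Finite ι] [Module.Finite k K] {e f : ι}
    {x : ⨂[k] _ : ι, D k K}
    (hx : ∀ i, i ≠ e → i ≠ f → ∀ h, atFactor k i (regLeft k K h) x = ε h • x) :
    x ∈ Submodule.span k (Set.range fun p : D k K × D k K => pairAt e f p.1 p.2) := by
  have := Fintype.ofFinite ι
  have h1 := map_eq_self_of_atFactor (x := x)
    (f := fun i => if i ∈ ({e, f} : Finset ι) then LinearMap.id else unitProj k K) fun i => by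
      by_cases h : i ∈ ({e, f} : Finset ι)
      · simp only [h, if_true]
        exact LinearMap.congr_fun (atFactor_one i) x
      · simp only [h, if_false]
        simp only [Finset.mem_insert, Finset.mem_singleton, not_or] at h
        exact atFactor_unitProj (hx i h.1 h.2)
  rw [← h1]
  clear h1 hx
  induction x using PiTensorProduct.induction_on with
  | add a b ha hb => rw [map_add]; exact add_mem ha hb
  | smul_tprod c α =>
    rw [map_smul, map_unitProj_tprod]
    refine Submodule.smul_mem _ c (Submodule.smul_mem _ _
      (Submodule.subset_span ⟨(α e, α f), ?_⟩))
    refine (pairAt_eq _ _ _ _).trans (congrArg _ (funext fun i => ?_))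
    by_cases h : i = f
    · subst h; simp
    · by_cases h' : i = e
      · subst h'; simp [h]
      · simp [h, h']

end Supports

/-! ### Functions supported on one edge and their products. -/

section Edges

variable {k K : Type*} [Field k] [Ring K] [HopfAlgebra k K] {V E : Type*} [Finite V] [Finite E]

local notation "ε" => Coalgebra.counit (R := k) (A := K)
local notation "𝑺" => HopfAlgebra.antipode k (A := K)

open scoped Classical in
variable (k K) in
/-- The linear map `α ⊗ β ↦ (α ⊗ β)_{s(e)t(e)}`. -/
def edgeEnds (Γ : DirectedGraph V E) (e : E) : D k K ⊗[k] D k K →ₗ[k] VertexFns k K Γ :=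
  (endSplit k K Γ).toLinearMap ∘ₗ
    (PiTensorProduct.tprod k).toLinearMap (fun _ : E => (ε : D k K) ⊗ₜ[k] (ε : D k K)) e

theorem edgeEnds_apply [DecidableEq E] {Γ : DirectedGraph V E} (e : E) (t : D k K ⊗[k] D k K) :
    edgeEnds k K Γ e t = endSplit k K Γ (PiTensorProduct.tprod k
      (Function.update (fun _ => (ε : D k K) ⊗ₜ[k] (ε : D k K)) e t)) := by
  simp only [edgeEnds, LinearMap.comp_apply, MultilinearMap.toLinearMap_apply]
  congr!

theorem edgeEnds_tmul [DecidableEq E] {Γ : DirectedGraph V E} (e : E) (a b : D k K) :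
    edgeEnds k K Γ e (a ⊗ₜ b) = ends Γ (Sum.elim (Function.update (fun _ => ε) e a)
      (Function.update (fun _ => ε) e b)) := by
  rw [edgeEnds_apply, ← endSplit_tprod]
  refine congrArg _ (congrArg _ (funext fun i => ?_))
  by_cases h : i = e
  · subst h; simp
  · simp [h]

theorem gStar_single [Module.Finite k K] {Γ : DirectedGraph V E} (e : E) (α : D k K) :
    gStar k K Γ (single e α) = edgeEnds k K Γ e (splitEdge k K α) := by
  classical
  rw [edgeEnds_apply, single_eq, gStar_tprod]
  refine congrArg _ (congrArg _ (funext fun i => ?_))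
  by_cases h : i = e
  · subst h; simp
  · simp [h, splitEdge_counit]

theorem gStar_pairAt [Module.Finite k K] [DecidableEq E] {Γ : DirectedGraph V E} (e f : E)
    (α β : D k K) :
    gStar k K Γ (pairAt e f α β) = endSplit k K Γ (PiTensorProduct.tprod k
      (Function.update (Function.update (fun _ => (ε : D k K) ⊗ₜ[k] (ε : D k K)) e
        (splitEdge k K α)) f (splitEdge k K β))) := by
  rw [pairAt_eq, gStar_tprod]
  refine congrArg _ (congrArg _ (funext fun i => ?_))
  by_cases h : i = f
  · subst h; simp
  · by_cases h' : i = e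
    · subst h'; simp [h]
    · simp [h, h', splitEdge_counit]

theorem endOther_inr_edgeEnds {Γ : DirectedGraph V E} {e f : E} (h : f ≠ e) (x : K)
    (t : D k K ⊗[k] D k K) :
    endOther k K Γ (Sum.inr f) x (edgeEnds k K Γ e t) = ε x • edgeEnds k K Γ e t := by
  classical
  induction t with
  | zero => simp
  | add a b ha hb => simp only [map_add, ha, hb, smul_add]
  | tmul a b =>
    rw [edgeEnds_tmul]
    refine (atEnd_ends _ _ _).trans ?_
    have h1 : otherAct (tau (Sum.inr f : E ⊕ E)) x ((Sum.elim (Function.update (fun _ => ε) e a)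
        (Function.update (fun _ => ε) e b) : E ⊕ E → D k K) (Sum.inr f)) = ε x • ε := by
      simp [h]
    rw [h1]
    refine (MultilinearMap.map_update_smul _ _ _ _ _).trans ?_
    rw [Function.update_eq_self_iff.2 (by simp [h])]
    rfl

variable {Γ : CiliatedRibbonGraph V E} {R : V → K ⊗[k] K} {s : E ⊕ E → Bool}

-- At every vertex one of the two elements is the unit, so no relation of the vertex algebras is
-- needed.
omit [Finite V] in
theorem graphMul_ends (hR : ∀ v, IsRMatrix k (R v)) {β γ δ : E ⊕ E → D k K}
    (h : ∀ v, (∀ x : Γ.EndsAt v, β x.1 = ε ∧ δ x.1 = γ x.1) ∨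
      (∀ x : Γ.EndsAt v, γ x.1 = ε ∧ δ x.1 = β x.1)) :
    graphMul Γ R s (ends Γ.toDirectedGraph β) (ends Γ.toDirectedGraph γ) =
      ends Γ.toDirectedGraph δ := by
  refine (PiTensorProduct.map₂_tprod_tprod _ _ _).trans (congrArg _ (funext fun v => ?_))
  let := Γ.endOrder v
  obtain h | h := h v
  · simp only [fun x => (h x).1, fun x => (h x).2]
    exact LinearMap.congr_fun (vertexMul_one (hR v)) _
  · simp only [fun x => (h x).1, fun x => (h x).2]
    exact vertexMul_apply_one (hR v) _

/-- Edges without a common vertex contribute to different vertex algebras; swapping $e$ and $f$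
gives the other order of the product as well. -/
theorem graphMul_edgeEnds [DecidableEq E] (hR : ∀ v, IsRMatrix k (R v)) {e f : E}
    (hef : Disjoint ({Γ.src e, Γ.tgt e} : Set V) {Γ.src f, Γ.tgt f}) (t u : D k K ⊗[k] D k K) :
    graphMul Γ R s (edgeEnds k K Γ.toDirectedGraph e t) (edgeEnds k K Γ.toDirectedGraph f u) =
      endSplit k K Γ.toDirectedGraph (PiTensorProduct.tprod k
      (Function.update (Function.update (fun _ => (ε : D k K) ⊗ₜ[k] (ε : D k K)) e t) f u)) := by
  have hne : e ≠ f := by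
    rintro rfl
    exact Set.disjoint_left.1 hef (Set.mem_insert _ _) (Set.mem_insert _ _)
  induction t with
  | zero =>
    rw [Function.update_comm hne, MultilinearMap.map_update_zero]
    simp
  | add a b ha hb =>
    rw [Function.update_comm hne] at ha hb ⊢
    simp only [map_add, LinearMap.add_apply, ha, hb, MultilinearMap.map_update_add]
  | tmul a a' =>
    induction u with
    | zero =>
      rw [MultilinearMap.map_update_zero]
      simp
    | add b b' hb hb' =>
      simp only [map_add, hb, hb', MultilinearMap.map_update_add]
    | tmul b b' =>
      have h1 : (Function.update (Function.update (fun _ => (ε : D k K) ⊗ₜ[k] (ε : D k K)) e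
          (a ⊗ₜ a')) f (b ⊗ₜ b')) = fun i => Function.update (Function.update (fun _ => ε) e a) f b i
            ⊗ₜ[k] Function.update (Function.update (fun _ => ε) e a') f b' i := by
        funext i
        by_cases h : i = f
        · subst h; simp
        · by_cases h' : i = e
          · subst h'; simp [h]
          · simp [h, h']
      rw [h1, endSplit_tprod, edgeEnds_tmul, edgeEnds_tmul]
      refine graphMul_ends hR fun v => ?_
      by_cases hv : v ∈ ({Γ.src e, Γ.tgt e} : Set V)
      · have hv' := Set.disjoint_left.1 hef hv
        refine Or.inr ?_
        rintro ⟨i | i, rfl⟩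
        · have : i ≠ f := by rintro rfl; exact hv' (Set.mem_insert _ _)
          simp [this]
        · have : i ≠ f := by rintro rfl; exact hv' (Set.mem_insert_of_mem _ rfl)
          simp [this]
      · refine Or.inl ?_
        rintro ⟨i | i, rfl⟩
        · have : i ≠ e := by rintro rfl; exact hv (Set.mem_insert _ _)
          simp [this, Function.update_apply]
        · have : i ≠ e := by rintro rfl; exact hv (Set.mem_insert_of_mem _ rfl)
          simp [this, Function.update_apply]

end Edges

theorem map_eq_atComponent {k V : Type*} [Field k] {W : V → Type*} [∀ v, AddCommMonoid (W v)]
    [∀ v, Module k (W v)] {f : ∀ v, Module.End k (W v)} {v : V}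
    (h : ∀ u, u ≠ v → f u = LinearMap.id) :
    PiTensorProduct.map f = atComponent k W v (f v) := by
  classical
  refine PiTensorProduct.ext (MultilinearMap.ext fun w => ?_)
  simp only [LinearMap.compMultilinearMap_apply, PiTensorProduct.map_tprod, atComponent_tprod]
  refine congrArg _ (funext fun u => ?_)
  by_cases hu : u = v
  · subst hu; simp
  · simp [hu, h u hu]

/-! ### Gauge transformations on functions supported on one edge. -/

section EdgeActions

variable {k K : Type*} [Field k] [Ring K] [HopfAlgebra k K] {V E : Type*} [Finite V] [Finite E]
  {Γ : CiliatedRibbonGraph V E}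

local notation "ε" => Coalgebra.counit (R := k) (A := K)
local notation "𝑺" => HopfAlgebra.antipode k (A := K)

omit [Finite V] in
theorem productAct_incl (v : V) (h : K) : productAct (ribbonAct k K Γ) (incl k v h) =
    atComponent k (fun v => ⨂[k] _ : Γ.EndsAt v, D k K) v (ribbonAct k K Γ v h) := by
  classical
  rw [incl_eq, productAct_tprod, map_eq_atComponent (v := v), Function.update_self]
  intro u hu
  let := Γ.endOrder u
  rw [Function.update_of_ne hu]
  exact tensorAct_one _ _

variable (Γ) in
/-- The part of `ends Γ β` at the vertex `v`. -/
def endsAt (β : E ⊕ E → D k K) (v : V) : ⨂[k] _ : Γ.EndsAt v, D k K :=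
  PiTensorProduct.tprod k fun x => β x.1

omit [Finite V] [Finite E] in
theorem tprod_update_endsAt [DecidableEq V] {β β' : E ⊕ E → D k K} {v : V}
    (h : ∀ x, Γ.endVertex x ≠ v → β' x = β x) {y : ⨂[k] _ : Γ.EndsAt v, D k K}
    (hy : y = endsAt Γ β' v) :
    PiTensorProduct.tprod k (Function.update (endsAt Γ β) v y) = ends Γ.toDirectedGraph β' := by
  subst hy
  refine congrArg (PiTensorProduct.tprod k) (funext fun u => ?_)
  by_cases hu : u = v
  · subst hu; rw [Function.update_self]; rfl
  · rw [Function.update_of_ne hu]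
    refine congrArg _ (funext fun x => (h x.1 ?_).symm)
    rw [x.2]
    exact hu

omit [Finite V] in
theorem productAct_incl_ends [DecidableEq V] (v : V) (h : K) (β : E ⊕ E → D k K) :
    productAct (ribbonAct k K Γ) (incl k v h) (ends Γ.toDirectedGraph β) =
      PiTensorProduct.tprod k (Function.update (endsAt Γ β) v
        (ribbonAct k K Γ v h (endsAt Γ β v))) := by
  rw [productAct_incl]
  exact atComponent_tprod _ _ _

omit [Finite V] in
theorem ribbonAct_fnOne (v : V) (h : K) :
    ribbonAct k K Γ v h (fnOne k K (Γ.EndsAt v)) = ε h • fnOne k K (Γ.EndsAt v) := by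
  let := Γ.endOrder v
  exact tensorAct_fnOne _ _

omit [Finite V] in
theorem ribbonAct_single {R : K ⊗[k] K} (hR : IsRMatrix k R) {v : V} (x : Γ.EndsAt v) (h : K)
    (α : D k K) : ribbonAct k K Γ v h (single x α) = single x (endAct k K (tau x.1) h α) := by
  let := Γ.endOrder v
  exact vertexAct_single hR x h α

omit [Finite V] in
theorem ribbonAct_pairAt {R : K ⊗[k] K} (hR : IsRMatrix k R) {v : V} {x y : Γ.EndsAt v}
    (hxy : (Γ.endOrder v).lt x y) (h : K) (α β : D k K) : ribbonAct k K Γ v h (pairAt x y α β) =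
      ∑ p ∈ (ℛ k h).index, pairAt x y (endAct k K (tau x.1) ((ℛ k h).left p) α)
        (endAct k K (tau y.1) ((ℛ k h).right p) β) := by
  let := Γ.endOrder v
  exact vertexAct_pairAt hR hxy h α β

variable [DecidableEq E]

/-- The family with entries `a` and `b` at the ends of `e`. -/
def atEnds (e : E) (a b : D k K) : E ⊕ E → D k K :=
  Sum.elim (Function.update (fun _ => ε) e a) (Function.update (fun _ => ε) e b)

omit [Finite V] [Finite E] in
@[simp]
theorem atEnds_inl (e : E) (a b : D k K) : atEnds e a b (Sum.inl e) = a := by simp [atEnds]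

omit [Finite V] [Finite E] in
@[simp]
theorem atEnds_inr (e : E) (a b : D k K) : atEnds e a b (Sum.inr e) = b := by simp [atEnds]

omit [Finite V] [Finite E] in
theorem atEnds_of_ne {e : E} {a b : D k K} {x : E ⊕ E} (h : x ≠ Sum.inl e) (h' : x ≠ Sum.inr e) :
    atEnds e a b x = ε := by
  obtain x | x := x
  · exact Function.update_of_ne (f := fun _ => ε) (fun hx => h (congrArg _ hx)) a
  · exact Function.update_of_ne (f := fun _ => ε) (fun hx => h' (congrArg _ hx)) b

omit [Finite V] [Finite E] in
theorem endsAt_atEnds_far {e : E} {v : V} (h : v ≠ Γ.src e) (h' : v ≠ Γ.tgt e) (a b : D k K) :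
    endsAt Γ (atEnds e a b) v = fnOne k K (Γ.EndsAt v) := by
  refine congrArg _ (funext fun ⟨x, hx⟩ => atEnds_of_ne ?_ ?_)
  · rintro rfl; exact h hx.symm
  · rintro rfl; exact h' hx.symm

omit [Finite V] [Finite E] in
theorem endsAt_atEnds_src {e : E} (h : Γ.src e ≠ Γ.tgt e) (a b : D k K) :
    endsAt Γ (atEnds e a b) (Γ.src e) = single ⟨Sum.inl e, rfl⟩ a := by
  classical
  rw [single_eq]
  refine congrArg _ (funext fun ⟨x, hx⟩ => ?_)
  by_cases hxe : x = Sum.inl e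
  · subst hxe; simp
  · rw [Function.update_of_ne fun hh => hxe (congrArg Subtype.val hh)]
    refine atEnds_of_ne hxe ?_
    rintro rfl; exact h hx.symm

omit [Finite V] [Finite E] in
theorem endsAt_atEnds_tgt {e : E} (h : Γ.src e ≠ Γ.tgt e) (a b : D k K) :
    endsAt Γ (atEnds e a b) (Γ.tgt e) = single ⟨Sum.inr e, rfl⟩ b := by
  classical
  rw [single_eq]
  refine congrArg _ (funext fun ⟨x, hx⟩ => ?_)
  by_cases hxe : x = Sum.inr e
  · subst hxe; simp
  · rw [Function.update_of_ne fun hh => hxe (congrArg Subtype.val hh)]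
    refine atEnds_of_ne ?_ hxe
    rintro rfl; exact h hx

omit [Finite V] [Finite E] in
theorem endsAt_atEnds_loop {e : E} {v : V} (h : Γ.endVertex (Sum.inl e) = v)
    (h' : Γ.endVertex (Sum.inr e) = v) (a b : D k K) :
    endsAt Γ (atEnds e a b) v = pairAt ⟨Sum.inl e, h⟩ ⟨Sum.inr e, h'⟩ a b := by
  classical
  rw [pairAt_eq]
  refine congrArg _ (funext fun ⟨x, hx⟩ => ?_)
  by_cases hr : x = Sum.inr e
  · subst hr; simp
  · rw [Function.update_of_ne fun hh => hr (congrArg Subtype.val hh)]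
    by_cases hl : x = Sum.inl e
    · subst hl; simp
    · rw [Function.update_of_ne fun hh => hl (congrArg Subtype.val hh)]
      exact atEnds_of_ne hl hr

omit [DecidableEq E] in
theorem productAct_edgeEnds_far {e : E} {v : V} (h : v ≠ Γ.src e) (h' : v ≠ Γ.tgt e) (x : K)
    (t : D k K ⊗[k] D k K) : productAct (ribbonAct k K Γ) (incl k v x)
      (edgeEnds k K Γ.toDirectedGraph e t) = ε x • edgeEnds k K Γ.toDirectedGraph e t := by
  classical
  induction t with
  | zero => simp
  | add a b ha hb => simp only [map_add, ha, hb, smul_add]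
  | tmul a b =>
    rw [edgeEnds_tmul, productAct_incl_ends]
    change PiTensorProduct.tprod k (Function.update (endsAt Γ (atEnds e a b)) v
      (ribbonAct k K Γ v x (endsAt Γ (atEnds e a b) v))) = ε x • ends _ (atEnds e a b)
    rw [endsAt_atEnds_far h h', ribbonAct_fnOne, MultilinearMap.map_update_smul,
      ← endsAt_atEnds_far h h' a b, Function.update_eq_self]
    rfl

omit [DecidableEq E] in
theorem productAct_edgeEnds_src {R : K ⊗[k] K} (hR : IsRMatrix k R) {e : E}
    (h : Γ.src e ≠ Γ.tgt e) (x : K) (t : D k K ⊗[k] D k K) :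
    productAct (ribbonAct k K Γ) (incl k (Γ.src e) x) (edgeEnds k K Γ.toDirectedGraph e t) =
      edgeEnds k K Γ.toDirectedGraph e (TensorProduct.map (endAct k K true x) LinearMap.id t) := by
  classical
  induction t with
  | zero => simp
  | add a b ha hb => simp only [map_add, ha, hb]
  | tmul a b =>
    rw [edgeEnds_tmul, productAct_incl_ends, TensorProduct.map_tmul, edgeEnds_tmul]
    change PiTensorProduct.tprod k (Function.update (endsAt Γ (atEnds e a b)) _
      (ribbonAct k K Γ _ x (endsAt Γ (atEnds e a b) _))) = ends _ (atEnds e (endAct k K true x a) b)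
    rw [endsAt_atEnds_src h, ribbonAct_single hR]
    refine tprod_update_endsAt ?_ (endsAt_atEnds_src h _ b).symm
    rintro (y | y) hy
    · have : y ≠ e := by rintro rfl; exact hy rfl
      simp [atEnds, this]
    · simp [atEnds]

omit [DecidableEq E] in
theorem productAct_edgeEnds_tgt {R : K ⊗[k] K} (hR : IsRMatrix k R) {e : E}
    (h : Γ.src e ≠ Γ.tgt e) (x : K) (t : D k K ⊗[k] D k K) :
    productAct (ribbonAct k K Γ) (incl k (Γ.tgt e) x) (edgeEnds k K Γ.toDirectedGraph e t) =
      edgeEnds k K Γ.toDirectedGraph e (TensorProduct.map LinearMap.id (endAct k K false x) t) := by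
  classical
  induction t with
  | zero => simp
  | add a b ha hb => simp only [map_add, ha, hb]
  | tmul a b =>
    rw [edgeEnds_tmul, productAct_incl_ends, TensorProduct.map_tmul, edgeEnds_tmul]
    change PiTensorProduct.tprod k (Function.update (endsAt Γ (atEnds e a b)) _
      (ribbonAct k K Γ _ x (endsAt Γ (atEnds e a b) _))) = ends _ (atEnds e a (endAct k K false x b))
    rw [endsAt_atEnds_tgt h, ribbonAct_single hR]
    refine tprod_update_endsAt ?_ (endsAt_atEnds_tgt h a _).symm
    rintro (y | y) hy
    · simp [atEnds]
    · have : y ≠ e := by rintro rfl; exact hy rfl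
      simp [atEnds, this]

-- The hypothesis `hx` leaves open which end of the loop comes first, so that both orderings are
-- covered.
omit [DecidableEq E] in
theorem productAct_edgeEnds_loop {e : E} {v : V} (h : Γ.endVertex (Sum.inl e) = v)
    (h' : Γ.endVertex (Sum.inr e) = v) (x : K) {κ : Type*} {I : Finset κ} {y z : κ → K}
    (hx : ∀ a b, ribbonAct k K Γ v x (pairAt ⟨Sum.inl e, h⟩ ⟨Sum.inr e, h'⟩ a b) =
      ∑ p ∈ I, pairAt ⟨Sum.inl e, h⟩ ⟨Sum.inr e, h'⟩ (endAct k K true (y p) a)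
        (endAct k K false (z p) b)) (t : D k K ⊗[k] D k K) :
    productAct (ribbonAct k K Γ) (incl k v x) (edgeEnds k K Γ.toDirectedGraph e t) =
      edgeEnds k K Γ.toDirectedGraph e
        (∑ p ∈ I, TensorProduct.map (endAct k K true (y p)) (endAct k K false (z p)) t) := by
  classical
  induction t with
  | zero => simp
  | add a b ha hb => simp only [map_add, ha, hb, Finset.sum_add_distrib]
  | tmul a b =>
    rw [edgeEnds_tmul, productAct_incl_ends, map_sum]
    simp only [TensorProduct.map_tmul, edgeEnds_tmul]
    change PiTensorProduct.tprod k (Function.update (endsAt Γ (atEnds e a b)) _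
      (ribbonAct k K Γ _ x (endsAt Γ (atEnds e a b) _))) =
        ∑ p ∈ I, ends _ (atEnds e (endAct k K true (y p) a) (endAct k K false (z p) b))
    rw [endsAt_atEnds_loop h h', hx, MultilinearMap.map_update_sum]
    refine Finset.sum_congr rfl fun p _ =>
      tprod_update_endsAt ?_ (endsAt_atEnds_loop h h' _ _).symm
    rintro (u | u) hu
    · have : u ≠ e := by rintro rfl; exact hu h
      simp [atEnds, this]
    · have : u ≠ e := by rintro rfl; exact hu h'
      simp [atEnds, this]

-- Both sides evaluate to $α(ywuS(x))$: gauge transformations touch the outer sides of the product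
-- $wu$, while $G^*$ splits it in the middle.
omit [DecidableEq E] in
theorem map_endAct_splitEdge [Module.Finite k K] (x y : K) (α : D k K) :
    TensorProduct.map (endAct k K true x) (endAct k K false y) (splitEdge k K α) =
      splitEdge k K (endAct k K true x (endAct k K false y α)) := by
  have h : ∀ (t : D k K ⊗[k] D k K) (u w : K), TensorProduct.dualDistrib k K K
      (TensorProduct.map (endAct k K true x) (endAct k K false y) t) (u ⊗ₜ w) =
      TensorProduct.dualDistrib k K K t ((u * 𝑺 x) ⊗ₜ (y * w)) := by
    intro t u w
    induction t with
    | zero => simp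
    | tmul a b => simp [endAct]
    | add a b ha hb => simp only [map_add, LinearMap.add_apply, ha, hb]
  refine dual_tmul_ext fun u w => ?_
  rw [h, dualDistrib_splitEdge, dualDistrib_splitEdge]
  simp [endAct, mul_assoc]

end EdgeActions

/-! ### The pulled back gauge theory and its explicit gauge transformations. -/

section Pullback

variable {k K : Type*} [Field k] [Ring K] [HopfAlgebra k K] [Module.Finite k K] {V E : Type*}
  [Finite V] [Finite E]

local notation "ε" => Coalgebra.counit (R := k) (A := K)
local notation "𝑺" => HopfAlgebra.antipode k (A := K)

section Definitions

variable (Γ : CiliatedRibbonGraph V E) (R : V → K ⊗[k] K) (s : E ⊕ E → Bool)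

/-- The pullback of the product of the vertex algebras along `G*`. -/
def pullMul : (⨂[k] _ : E, D k K) →ₗ[k] (⨂[k] _ : E, D k K) →ₗ[k] ⨂[k] _ : E, D k K :=
  ((graphMul Γ R s).compl₁₂ (gStar k K Γ.toDirectedGraph) (gStar k K Γ.toDirectedGraph)).compr₂
    (gMerge k K Γ.toDirectedGraph)

variable (k K) in
/-- The pullback of the action of gauge transformations along `G*`. -/
def pullAct : (⨂[k] _ : V, K) →ₗ[k] Module.End k (⨂[k] _ : E, D k K) :=
  LinearMap.compRight k (gMerge k K Γ.toDirectedGraph) ∘ₗ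
    LinearMap.lcomp k _ (gStar k K Γ.toDirectedGraph) ∘ₗ productAct (ribbonAct k K Γ)

end Definitions

variable {Γ : CiliatedRibbonGraph V E} {R : V → K ⊗[k] K} {s : E ⊕ E → Bool}

theorem gStar_pullMul (hR : ∀ v, IsRMatrix k (R v)) (hs : ∀ e, s (Sum.inr e) = !s (Sum.inl e))
    (a b : ⨂[k] _ : E, D k K) : gStar k K Γ.toDirectedGraph (pullMul Γ R s a b) =
      graphMul Γ R s (gStar k K Γ.toDirectedGraph a) (gStar k K Γ.toDirectedGraph b) :=
  gStar_gMerge (graphMul_mem_range hR hs ⟨a, rfl⟩ ⟨b, rfl⟩)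

theorem gStar_pullAct (h : ⨂[k] _ : V, K) (a : ⨂[k] _ : E, D k K) :
    gStar k K Γ.toDirectedGraph (pullAct k K Γ h a) =
      productAct (ribbonAct k K Γ) h (gStar k K Γ.toDirectedGraph a) :=
  gStar_gMerge (productAct_mem_range h ⟨a, rfl⟩)

theorem pullAct_one : pullAct k K Γ 1 = 1 := by
  refine LinearMap.ext fun a => gStar_injective (Γ := Γ.toDirectedGraph) ?_
  rw [gStar_pullAct, productAct_one]
  rfl

theorem pullAct_mul (h h' : ⨂[k] _ : V, K) :
    pullAct k K Γ (h * h') = pullAct k K Γ h' * pullAct k K Γ h := by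
  refine LinearMap.ext fun a => gStar_injective (Γ := Γ.toDirectedGraph) ?_
  rw [Module.End.mul_apply, gStar_pullAct, gStar_pullAct, gStar_pullAct, productAct_mul]
  rfl

theorem pullAct_far {e : E} {v : V} (h : v ≠ Γ.src e) (h' : v ≠ Γ.tgt e) (x : K) (α : D k K) :
    pullAct k K Γ (incl k v x) (single e α) = ε x • single e α := by
  refine gStar_injective (Γ := Γ.toDirectedGraph) ?_
  rw [gStar_pullAct, map_smul, gStar_single, productAct_edgeEnds_far h h']

theorem pullAct_src {R : K ⊗[k] K} (hR : IsRMatrix k R) {e : E} (h : Γ.src e ≠ Γ.tgt e) (x : K)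
    (α : D k K) :
    pullAct k K Γ (incl k (Γ.src e) x) (single e α) = single e (endAct k K true x α) := by
  refine gStar_injective (Γ := Γ.toDirectedGraph) ?_
  have h1 := map_endAct_splitEdge x (1 : K) α
  rw [endAct_one, Module.End.one_apply] at h1
  rw [gStar_pullAct, gStar_single, productAct_edgeEnds_src hR h, gStar_single, ← h1]
  rfl

theorem pullAct_tgt {R : K ⊗[k] K} (hR : IsRMatrix k R) {e : E} (h : Γ.src e ≠ Γ.tgt e) (x : K)
    (α : D k K) :
    pullAct k K Γ (incl k (Γ.tgt e) x) (single e α) = single e (endAct k K false x α) := by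
  refine gStar_injective (Γ := Γ.toDirectedGraph) ?_
  have h1 := map_endAct_splitEdge (1 : K) x α
  rw [endAct_one, Module.End.one_apply] at h1
  rw [gStar_pullAct, gStar_single, productAct_edgeEnds_tgt hR h, gStar_single, ← h1]
  rfl

/-- The vertex action hands $h_1$ to the earlier end, here the target end, and $h_2$ to the later
one. -/
theorem pullAct_loop_tgt_lt {R : K ⊗[k] K} (hR : IsRMatrix k R) {e : E}
    (h : Γ.Before (Sum.inr e) (Sum.inl e)) (x : K) (α : D k K) :
    pullAct k K Γ (incl k (Γ.src e) x) (single e α) = ∑ p ∈ (ℛ k x).index,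
      single e (endAct k K true ((ℛ k x).right p) (endAct k K false ((ℛ k x).left p) α)) := by
  classical
  obtain ⟨v, h1, h2, h3⟩ := h
  subst h2
  refine gStar_injective (Γ := Γ.toDirectedGraph) ?_
  simp only [gStar_pullAct, map_sum, gStar_single, ← map_endAct_splitEdge]
  rw [← map_sum]
  refine productAct_edgeEnds_loop rfl h1 x (fun a b => ?_) _
  have hne : (⟨Sum.inl e, rfl⟩ : Γ.EndsAt (Γ.endVertex (Sum.inl e))) ≠ ⟨Sum.inr e, h1⟩ := by
    simp
  simp only [pairAt_comm hne]
  exact ribbonAct_pairAt hR h3 x b a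

theorem pullAct_loop_src_lt {R : K ⊗[k] K} (hR : IsRMatrix k R) {e : E}
    (h : Γ.Before (Sum.inl e) (Sum.inr e)) (x : K) (α : D k K) :
    pullAct k K Γ (incl k (Γ.src e) x) (single e α) = ∑ p ∈ (ℛ k x).index,
      single e (endAct k K true ((ℛ k x).left p) (endAct k K false ((ℛ k x).right p) α)) := by
  obtain ⟨v, h1, h2, h3⟩ := h
  subst h1
  refine gStar_injective (Γ := Γ.toDirectedGraph) ?_
  simp only [gStar_pullAct, map_sum, gStar_single, ← map_endAct_splitEdge]
  rw [← map_sum]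
  exact productAct_edgeEnds_loop rfl h2 x (fun a b => ribbonAct_pairAt hR h3 x a b) _

/-- At the target end of any third edge both factors are trivial for the other action, hence so is
their product, and the left inverse of $G^*$ transports this to the edge. -/
theorem atFactor_pullMul_single (hR : ∀ v, IsRMatrix k (R v))
    {e f i : E} (hie : i ≠ e) (hif : i ≠ f) (α β : D k K) (h : K) :
    atFactor k i (regLeft k K h) (pullMul Γ R s (single e α) (single f β)) =
      ε h • pullMul Γ R s (single e α) (single f β) := by
  have h1 : pullMul Γ R s (single e α) (single f β) = gMerge k K Γ.toDirectedGraph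
    (graphMul Γ R s (gStar k K Γ.toDirectedGraph (single e α))
      (gStar k K Γ.toDirectedGraph (single f β))) := rfl
  rw [h1, ← gMerge_endOther_inr, gStar_single, gStar_single,
    endOther_graphMul hR (endOther_inr_edgeEnds hie · _) (endOther_inr_edgeEnds hif · _), map_smul]

variable (Γ) in
/-- The pullback of the tensor product of the vertex algebras along `G*`. -/
def pullTheory (hR : ∀ v, IsRMatrix k (R v)) (hs : ∀ e, s (Sum.inr e) = !s (Sum.inl e)) :
    GraphGaugeTheory k K Γ.toDirectedGraph :=
  HopfGaugeTheory.ofDual (pullMul Γ R s) (pullAct k K Γ) pullAct_one pullAct_mul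
    (fun a b c => gStar_injective (Γ := Γ.toDirectedGraph) <| by
      rw [gStar_pullMul hR hs, gStar_pullMul hR hs, graphMul_assoc hR, ← gStar_pullMul hR hs,
        ← gStar_pullMul hR hs])
    (fun a => gStar_injective (Γ := Γ.toDirectedGraph) <| by rw [gStar_pullMul hR hs, gStar_fnOne, one_graphMul hR])
    (fun a => gStar_injective (Γ := Γ.toDirectedGraph) <| by rw [gStar_pullMul hR hs, gStar_fnOne, graphMul_one hR])
    -- The product is trivial at every edge except $e$, so it has the form $(γ)_e$.
    (fun e α β => by
      obtain ⟨γ, hγ⟩ := mem_range_singleLin (e := e) (x := pullMul Γ R s (single e α) (single e β))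
        fun i hi h => atFactor_pullMul_single hR hi hi α β h
      exact ⟨γ, hγ.symm⟩)
    (fun e f α β _ => mem_span_pairAt fun i hi hi' h => atFactor_pullMul_single hR hi hi' α β h)
    (fun e f α β hef => by
      classical
      constructor <;> refine gStar_injective (Γ := Γ.toDirectedGraph) ?_ <;>
        rw [gStar_pullMul hR hs, gStar_single, gStar_single, gStar_pairAt]
      · exact graphMul_edgeEnds hR hef _ _
      · rw [graphMul_edgeEnds hR hef.symm, Function.update_comm]
        rintro rfl
        exact Set.disjoint_left.1 hef (Set.mem_insert _ _) (Set.mem_insert _ _))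
    (fun h a b => gStar_injective (Γ := Γ.toDirectedGraph) <| by
      rw [gStar_pullAct, gStar_pullMul hR hs, productAct_graphMul hR]
      generalize tensorComul k K V h = t
      induction t with
      | zero => simp
      | add x y hx hy => simp only [map_add, hx, hy]
      | tmul x y =>
        simp only [TensorProduct.lift.tmul, LinearMap.compl₁₂_apply, LinearMap.flip_apply,
          gStar_pullMul hR hs, gStar_pullAct])
    (fun h => gStar_injective (Γ := Γ.toDirectedGraph) <| by
      rw [gStar_pullAct, map_smul, gStar_fnOne, productAct_fnOne])
    (fun e u _ h1 h2 x α => pullAct_far h1 h2 x α)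
    (fun e u h1 h2 x α => by
      obtain rfl : u = Γ.tgt e := h2
      exact pullAct_tgt (hR (Γ.tgt e)) h1 x α)
    (fun e u h1 h2 x α => by
      obtain rfl : u = Γ.src e := h2
      exact pullAct_src (hR (Γ.src e)) h1 x α)

variable (hR : ∀ v, IsRMatrix k (R v)) (hs : ∀ e, s (Sum.inr e) = !s (Sum.inl e))

theorem transpose_pullTheory_act (h : ⨂[k] _ : V, K) :
    transpose E ((pullTheory Γ hR hs).act h) = pullAct k K Γ h :=
  transpose_actOfDual (pullAct k K Γ) pullAct_one pullAct_mul h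

theorem isModuleAlgebraHom_pullTheory :
    (∀ x y, gStar k K Γ.toDirectedGraph ((pullTheory Γ hR hs).mul x y) =
      graphMul Γ R s (gStar k K Γ.toDirectedGraph x) (gStar k K Γ.toDirectedGraph y)) ∧
    ∀ h x, gStar k K Γ.toDirectedGraph ((pullTheory Γ hR hs).dualAct h x) =
      productAct (ribbonAct k K Γ) h (gStar k K Γ.toDirectedGraph x) := by
  refine ⟨gStar_pullMul hR hs, fun h x => ?_⟩
  rw [← gStar_pullAct, ← transpose_pullTheory_act hR hs]
  rfl

omit [Module.Finite k K] [Finite E] in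
theorem sandwich_incl (e : E) (y h h' : K) :
    sandwich k e (incl k e y) (h ⊗ₜ[k] h') = incl k e (h * y * 𝑺 h') := by
  rw [map_mul, map_mul]
  rfl

theorem hasStandardAction_pullTheory : HasStandardAction Γ (pullTheory Γ hR hs) where
  far e v h h' x y := by
    rw [edgePart_of_transpose (g := ε x • LinearMap.id) (fun α => ?_), edgePart_eq]
    · simp
    · rw [transpose_pullTheory_act, pullAct_far h h', ← singleLin_apply, ← singleLin_apply,
        ← map_smul]
      exact congrArg _ (by ext; simp)
  nonloop e he h h' x := by
    rw [edgePart_of_transpose (g := LinearMap.mulLeft k h' ∘ₗ LinearMap.mulRight k (𝑺 h))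
      (fun α => ?_), edgePart_eq, sandwich_incl]
    · simp [mul_assoc]
    · rw [transpose_pullTheory_act, pullAct_mul, Module.End.mul_apply, pullAct_src (hR (Γ.src e)) he,
        pullAct_tgt (hR (Γ.tgt e)) he]
      refine congrArg _ ?_
      ext; simp [endAct, mul_assoc]
  loop_tgt_lt e he h x := by
    rw [edgePart_of_transpose (g := ∑ p ∈ (ℛ k h).index, LinearMap.mulLeft k ((ℛ k h).left p) ∘ₗ
      LinearMap.mulRight k (𝑺 ((ℛ k h).right p))) (fun α => ?_), edgePart_eq, ← (ℛ k h).eq, map_sum]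
    · simp [sandwich_incl, mul_assoc]
    · rw [transpose_pullTheory_act, pullAct_loop_tgt_lt (hR (Γ.src e)) he]
      simp only [← singleLin_apply, ← map_sum]
      refine congrArg _ ?_
      ext; simp [endAct]
  loop_src_lt e he h x := by
    rw [edgePart_of_transpose (g := ∑ p ∈ (ℛ k h).index, LinearMap.mulLeft k ((ℛ k h).right p) ∘ₗ
      LinearMap.mulRight k (𝑺 ((ℛ k h).left p))) (fun α => ?_), edgePart_eq, ← (ℛ k h).eq, map_sum,
      map_sum]
    · simp [sandwich_incl, mul_assoc]
    · rw [transpose_pullTheory_act, pullAct_loop_src_lt (hR (Γ.src e)) he]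
      simp only [← singleLin_apply, ← map_sum]
      refine congrArg _ ?_
      ext; simp [endAct]

end Pullback

/-! ### Independence of the choice of edge ends. -/

theorem map₂_eq_sum_of_component {k V : Type*} [Field k] {W : V → Type*} [∀ v, AddCommMonoid (W v)]
    [∀ v, Module k (W v)] {m m' : ∀ v, W v →ₗ[k] W v →ₗ[k] W v} {v : V} {κ : Type*} {I : Finset κ}
    {f g : κ → Module.End k (W v)} (h : ∀ u, u ≠ v → m u = m' u)
    (hv : ∀ x y, m v x y = ∑ r ∈ I, m' v (f r x) (g r y)) (x y : ⨂[k] v, W v) :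
    PiTensorProduct.map₂ m x y = ∑ r ∈ I,
      PiTensorProduct.map₂ m' (atComponent k W v (f r) x) (atComponent k W v (g r) y) := by
  classical
  let F : (⨂[k] v, W v) →ₗ[k] (⨂[k] v, W v) →ₗ[k] ⨂[k] v, W v := PiTensorProduct.map₂ m
  let G : (⨂[k] v, W v) →ₗ[k] (⨂[k] v, W v) →ₗ[k] ⨂[k] v, W v :=
    ∑ r ∈ I, (PiTensorProduct.map₂ m').compl₁₂ (atComponent k W v (f r)) (atComponent k W v (g r))
  have hFG : F = G := by
    refine piTensor_ext₂ fun x y => ?_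
    simp only [F, G, LinearMap.sum_apply, LinearMap.compl₁₂_apply,
      PiTensorProduct.map₂_tprod_tprod, atComponent_tprod]
    have h1 : (fun u => m u (x u) (y u)) = Function.update (fun u => m' u (x u) (y u)) v
        (∑ r ∈ I, m' v (f r (x v)) (g r (y v))) := by
      funext u
      by_cases hu : u = v
      · subst hu; simp [hv]
      · simp [hu, h u hu]
    rw [h1, MultilinearMap.map_update_sum]
    refine Finset.sum_congr rfl fun r _ => congrArg _ (funext fun u => ?_)
    by_cases hu : u = v
    · subst hu; simp
    · simp [hu]
  have := LinearMap.congr_fun (LinearMap.congr_fun hFG x) y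
  simpa only [F, G, LinearMap.sum_apply, LinearMap.compl₁₂_apply] using this

section Independence

variable {k K : Type*} [Field k] [Ring K] [HopfAlgebra k K] {V E : Type*} [Finite V] [Finite E]
  {Γ : CiliatedRibbonGraph V E} {R : V → K ⊗[k] K} {s s' : E ⊕ E → Bool}

omit [Finite V] in
theorem graphMul_twist (hR : ∀ v, IsRMatrix k (R v)) {e : E ⊕ E} {n : ℕ} {a b : Fin n → K}
    (hab : R (Γ.endVertex e) = ∑ r, a r ⊗ₜ[k] b r) (he : s e = false) (he' : s' e = true)
    (hss : ∀ x, x ≠ e → s x = s' x) (x y : VertexFns k K Γ.toDirectedGraph) :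
    graphMul Γ R s x y = ∑ r, graphMul Γ R s' (endOther k K Γ.toDirectedGraph e (b r) x)
      (endOther k K Γ.toDirectedGraph e (a r) y) := by
  rw [endOther_eq e (fun y => tau y.1) rfl]
  let := Γ.endOrder (Γ.endVertex e)
  refine map₂_eq_sum_of_component (v := Γ.endVertex e) (fun u hu => ?_) (fun x y => ?_) x y
  · let := Γ.endOrder u
    have h1 : (fun x : Γ.EndsAt u => s x.1) = fun x => s' x.1 :=
      funext fun ⟨x, hx⟩ => hss x (by rintro rfl; exact hu hx.symm)
    rw [h1]
  · have h1 := vertexMul_twist (hR (Γ.endVertex e)) hab (τ := fun y : Γ.EndsAt _ => tau y.1)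
      (σ := fun x : Γ.EndsAt _ => s x.1) (σ' := fun x => s' x.1) (i := ⟨e, rfl⟩) he he'
      (fun j hj => hss j.1 fun h => hj (Subtype.ext h)) x
    have h2 := LinearMap.congr_fun h1 y
    rw [LinearMap.sum_apply] at h2
    exact h2

variable [Module.Finite k K]

/-- Both products are twists by the same $R$ of the product with $σ = 1$ at both ends of $e$, one at
the starting and one at the target end. On the image of $G^*$ the twisting actions agree. -/
theorem graphMul_eq_of_swap (hR : ∀ v, IsRMatrix k (R v)) (hRR : ∀ v w, R v = R w) {e : E}
    (h1 : s (Sum.inl e) = false) (h2 : s (Sum.inr e) = true) (h3 : s' (Sum.inl e) = true)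
    (h4 : s' (Sum.inr e) = false) (hss : ∀ x, x ≠ Sum.inl e → x ≠ Sum.inr e → s x = s' x)
    {x y : VertexFns k K Γ.toDirectedGraph}
    (hx : x ∈ LinearMap.range (gStar k K Γ.toDirectedGraph))
    (hy : y ∈ LinearMap.range (gStar k K Γ.toDirectedGraph)) :
    graphMul Γ R s x y = graphMul Γ R s' x y := by
  classical
  rw [mem_range_gStar] at hx hy
  obtain ⟨n, a, b, hab⟩ := exists_sum_tmul (R (Γ.endVertex (Sum.inl e)))
  -- This auxiliary choice does not come from any $ρ$; the twist lemma does not need that.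
  let t : E ⊕ E → Bool := Function.update s (Sum.inl e) true
  have ht : t (Sum.inl e) = true := Function.update_self _ _ _
  have ht' : t (Sum.inr e) = true := (Function.update_of_ne (by simp) _ _).trans h2
  rw [graphMul_twist hR hab h1 ht (fun z hz => (Function.update_of_ne hz _ _).symm),
    graphMul_twist hR ((hRR _ _).trans hab) h4 ht' (fun z hz => ?_)]
  · simp only [hx e, hy e]
  · by_cases hz' : z = Sum.inl e
    · subst hz'; rw [h3, ht]
    · exact (hss z hz' hz).symm.trans (Function.update_of_ne hz' _ _).symm

theorem graphMul_eq_of_mem_range (hR : ∀ v, IsRMatrix k (R v)) (hRR : ∀ v w, R v = R w)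
    (hs : ∀ e, s (Sum.inr e) = !s (Sum.inl e)) (hs' : ∀ e, s' (Sum.inr e) = !s' (Sum.inl e))
    {x y : VertexFns k K Γ.toDirectedGraph}
    (hx : x ∈ LinearMap.range (gStar k K Γ.toDirectedGraph))
    (hy : y ∈ LinearMap.range (gStar k K Γ.toDirectedGraph)) :
    graphMul Γ R s x y = graphMul Γ R s' x y := by
  classical
  have := Fintype.ofFinite E
  suffices h : ∀ F : Finset E, ∀ s : E ⊕ E → Bool, (∀ e, s (Sum.inr e) = !s (Sum.inl e)) →
      (∀ e ∉ F, s (Sum.inl e) = s' (Sum.inl e)) → graphMul Γ R s x y = graphMul Γ R s' x y from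
    h Finset.univ s hs fun e he => (he (Finset.mem_univ e)).elim
  clear hs
  intro F
  induction F using Finset.induction_on with
  | empty =>
    intro s hs h
    have : s = s' := by
      funext z
      obtain z | z := z
      · exact h z (by simp)
      · rw [hs, hs', h z (by simp)]
    rw [this]
  | insert e F he ih =>
    intro s hs h
    -- Induction over the edges where the choices may differ: $t$ follows $s'$ on $e$ and $s$
    -- elsewhere.
    let t : E ⊕ E → Bool := fun z => if Sum.elim id id z = e then s' z else s z
    have hte : t (Sum.inl e) = s' (Sum.inl e) := if_pos rfl
    have hte' : t (Sum.inr e) = s' (Sum.inr e) := if_pos rfl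
    have htz : ∀ z, z ≠ Sum.inl e → z ≠ Sum.inr e → s z = t z := by
      rintro (z | z) hz hz'
      · exact (if_neg fun hh => hz (congrArg Sum.inl hh)).symm
      · exact (if_neg fun hh => hz' (congrArg Sum.inr hh)).symm
    have ht : ∀ z, t (Sum.inr z) = !t (Sum.inl z) := by
      intro z
      by_cases hz : z = e
      · subst hz; rw [hte, hte', hs']
      · rw [← htz (Sum.inl z) (by simpa using hz) (by simp),
          ← htz (Sum.inr z) (by simp) (by simpa using hz), hs]
    rw [← ih t ht fun z hz => ?_]
    · by_cases hst : s (Sum.inl e) = s' (Sum.inl e)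
      · have : s = t := by
          funext z
          by_cases hz : z = Sum.inl e
          · subst hz; rw [hte, hst]
          · by_cases hz' : z = Sum.inr e
            · subst hz'; rw [hte', hs, hs', hst]
            · exact htz z hz hz'
        rw [this]
      · cases h1 : s (Sum.inl e) with
        | false =>
          have h2 : s' (Sum.inl e) = true := by
            rw [h1] at hst
            exact Bool.eq_true_of_not_eq_false (Ne.symm hst)
          exact graphMul_eq_of_swap hR hRR h1 (by rw [hs, h1]; rfl) (hte.trans h2)
            (by rw [hte', hs', h2]; rfl) htz hx hy
        | true =>
          have h2 : s' (Sum.inl e) = false := by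
            rw [h1] at hst
            exact Bool.eq_false_of_not_eq_true (Ne.symm hst)
          exact (graphMul_eq_of_swap hR hRR (hte.trans h2) (by rw [hte', hs', h2]; rfl) h1
            (by rw [hs, h1]; rfl) (fun z hz hz' => (htz z hz hz').symm) hx hy).symm
    · by_cases hze : z = e
      · subst hze; exact hte
      · rw [← htz (Sum.inl z) (by simpa using hze) (by simp)]
        exact h z (by simp [hze, hz])

end Independence

/-- An end of $e$ can only be hit by $ρ$ at $e$ itself, so exactly one of the two ends lies in the
image of $ρ$. -/
theorem sigma_inr {E : Type*} {ρ : E → E ⊕ E} (hρ : IsEndChoice ρ) (e : E) :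
    sigma ρ (Sum.inr e) = !sigma ρ (Sum.inl e) := by
  have h1 : Sum.inl e ∈ Set.range ρ ↔ ρ e = Sum.inl e := by
    refine ⟨?_, fun h => ⟨e, h⟩⟩
    rintro ⟨f, hf⟩
    obtain h | h := hρ f
    · have := Sum.inl_injective (h.symm.trans hf)
      subst this; exact hf
    · exact (Sum.inr_ne_inl (h.symm.trans hf)).elim
  have h2 : Sum.inr e ∈ Set.range ρ ↔ ρ e = Sum.inr e := by
    refine ⟨?_, fun h => ⟨e, h⟩⟩
    rintro ⟨f, hf⟩
    obtain h | h := hρ f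
    · exact (Sum.inl_ne_inr (h.symm.trans hf)).elim
    · have := Sum.inr_injective (h.symm.trans hf)
      subst this; exact hf
  obtain h | h := hρ e
  · rw [sigma, sigma, if_pos (h1.2 h), if_neg fun hh => Sum.inl_ne_inr (h.symm.trans (h2.1 hh))]
    rfl
  · rw [sigma, sigma, if_pos (h2.2 h), if_neg fun hh => Sum.inr_ne_inl (h.symm.trans (h1.1 hh))]
    rfl

/-! ### Uniqueness and locality. -/

section Uniqueness

variable {k K : Type*} [Field k] [Ring K] [HopfAlgebra k K] [Module.Finite k K] {V E : Type*}
  [Finite V] [Finite E]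

/-- A gauge theory is determined by the images of its operations under `G*`. -/
theorem GraphGaugeTheory.ext_gStar {Γ : DirectedGraph V E} {T T' : GraphGaugeTheory k K Γ}
    (hmul : ∀ x y, gStar k K Γ (T.mul x y) = gStar k K Γ (T'.mul x y))
    (hact : ∀ h x, gStar k K Γ (T.dualAct h x) = gStar k K Γ (T'.dualAct h x)) : T = T' :=
  HopfGaugeTheory.ext (LinearMap.ext₂ fun x y => gStar_injective (hmul x y))
    (AlgHom.ext fun h => transpose_injective (LinearMap.ext fun x => gStar_injective (hact h x)))

variable {Γ : CiliatedRibbonGraph V E} {R : V → K ⊗[k] K} {ρ ρ' : E → E ⊕ E}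

theorem isPullback_pullTheory (hR : ∀ v, IsRMatrix k (R v)) (hρ : IsEndChoice ρ) :
    IsPullback Γ R ρ (pullTheory Γ hR (sigma_inr hρ)) where
  map_mul := (isModuleAlgebraHom_pullTheory hR (sigma_inr hρ)).1
  map_one := gStar_fnOne
  map_act := (isModuleAlgebraHom_pullTheory hR (sigma_inr hρ)).2

theorem IsPullback.eq {T T' : GraphGaugeTheory k K Γ.toDirectedGraph} (h : IsPullback Γ R ρ T)
    (h' : IsPullback Γ R ρ T') : T' = T :=
  GraphGaugeTheory.ext_gStar (fun x y => (h'.map_mul x y).trans (h.map_mul x y).symm)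
    fun x y => (h'.map_act x y).trans (h.map_act x y).symm

theorem IsPullback.eq_of_forall_eq (hR : ∀ v, IsRMatrix k (R v)) (hRR : ∀ v w, R v = R w)
    (hρ : IsEndChoice ρ) (hρ' : IsEndChoice ρ') {T T' : GraphGaugeTheory k K Γ.toDirectedGraph}
    (h : IsPullback Γ R ρ T) (h' : IsPullback Γ R ρ' T') : T' = T :=
  GraphGaugeTheory.ext_gStar
    (fun x y => (h'.map_mul x y).trans ((graphMul_eq_of_mem_range hR hRR (sigma_inr hρ')
      (sigma_inr hρ) ⟨x, rfl⟩ ⟨y, rfl⟩).trans (h.map_mul x y).symm))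
    fun x y => (h'.map_act x y).trans (h.map_act x y).symm

theorem isLocal_pullTheory (hR : ∀ v, IsRMatrix k (R v)) (hρ : IsEndChoice ρ) :
    IsLocal (pullTheory Γ hR (sigma_inr hρ)) := by
  choose A hA hA' using exists_vertexGaugeTheory Γ hR ρ
  refine ⟨A, ?_⟩
  simp only [hA, hA']
  exact isPullback_pullTheory hR hρ

end Uniqueness

/-! ### The projector given by the Haar integral. -/

section Projector

variable {k K : Type*} [Field k] [CharZero k] [Ring K] [HopfAlgebra k K] [Module.Finite k K]

local notation "𝑺" => HopfAlgebra.antipode k (A := K)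

variable (k) in
/-- The map `α ⊗ β ↦ ⟨α₁ S(β₂), ℓ⟩ α₂ ⊗ β₁`. -/
def haarEdge (ℓ : K) : Module.End k (D k K ⊗[k] D k K) :=
  TensorProduct.lift ((TensorProduct.mapBilinear (RingHom.id k) (D k K) (D k K) (D k K)
      (D k K)).compl₁₂ (regRight k K) (regLeft k K ∘ₗ HopfAlgebra.antipode k (A := K)))
      (Coalgebra.comul (R := k) ℓ)

omit [CharZero k] [Module.Finite k K] in
theorem dualDistrib_haarEdge (ℓ : K) (t : D k K ⊗[k] D k K) (x y : K) :
    TensorProduct.dualDistrib k K K (haarEdge k ℓ t) (x ⊗ₜ y) = ∑ q ∈ (ℛ k ℓ).index,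
      TensorProduct.dualDistrib k K K t (((ℛ k ℓ).left q * x) ⊗ₜ (y * 𝑺 ((ℛ k ℓ).right q))) := by
  rw [haarEdge, ← (ℛ k ℓ).eq, map_sum, LinearMap.sum_apply, map_sum, LinearMap.sum_apply]
  refine Finset.sum_congr rfl fun q _ => ?_
  induction t with
  | zero => simp
  | tmul a b => simp
  | add a b ha hb => simp only [map_add, LinearMap.add_apply, ha, hb]

/-- Evaluated on $x ⊗ y$ the left side is $α(y\sum S(ℓ_2)ℓ_1\,x)$, and $\sum S(ℓ_2)ℓ_1 = 1$ because
$S$ is an involution. -/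
theorem haarEdge_splitEdge (hK : IsRibbon k K) {ℓ : K} (hℓ : IsHaarIntegral k ℓ) (α : D k K) :
    haarEdge k ℓ (splitEdge k K α) = splitEdge k K α := by
  refine dual_tmul_ext fun x y => ?_
  have h1 := congrArg (α ∘ₗ LinearMap.mulLeft k y ∘ₗ LinearMap.mulRight k x)
    (hℓ.sum_antipode_mul hK)
  rw [map_sum] at h1
  simp only [dualDistrib_haarEdge, dualDistrib_splitEdge]
  simpa [mul_assoc] using h1

/-- With $S^2 = \mathrm{id}$, `casimir_right` reads $ℓ_1h ⊗ S(ℓ_2) = ℓ_1 ⊗ hS(ℓ_2)$. So the range of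
the averaging map satisfies the condition that describes the image of $G^*$. -/
theorem rTensor_haarEdge (hK : IsRibbon k K) {ℓ : K} (hℓ : IsHaarIntegral k ℓ) (h : K) :
    LinearMap.rTensor (D k K) (regRight k K h) ∘ₗ haarEdge k ℓ =
      LinearMap.lTensor (D k K) (regLeft k K h) ∘ₗ haarEdge k ℓ := by
  refine LinearMap.ext fun t => dual_tmul_ext fun x y => ?_
  have h1 := congrArg (TensorProduct.dualDistrib k K K t ∘ₗ
    TensorProduct.map (LinearMap.mulRight k x) (LinearMap.mulLeft k y)) (hℓ.casimir_right h)
  rw [hℓ.antipode_antipode hK, map_sum, map_sum] at h1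
  simp only [LinearMap.comp_apply, dualDistrib_rTensor, dualDistrib_lTensor, dualDistrib_haarEdge]
  simpa [mul_assoc] using h1

variable {V E : Type*} [Finite V] [Finite E]

theorem isProj_haarProj (hK : IsRibbon k K) {ℓ : K} (hℓ : IsHaarIntegral k ℓ)
    (Γ : DirectedGraph V E) :
    LinearMap.IsProj (LinearMap.range (gStar k K Γ)) (haarProj Γ ℓ) where
  map_mem x := by
    rw [mem_range_gStar]
    intro e h
    have h1 : ∀ x, haarProj Γ ℓ x = endSplit k K Γ (PiTensorProduct.map (fun _ => haarEdge k ℓ)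
        ((endSplit k K Γ).symm x)) := fun _ => rfl
    rw [endOther_inl, endOther_inr, LinearEquiv.conj_apply_apply, LinearEquiv.conj_apply_apply,
      h1, LinearEquiv.symm_apply_apply]
    congr 1
    generalize (endSplit k K Γ).symm x = t
    classical
    induction t using PiTensorProduct.induction_on with
    | smul_tprod c α =>
      simp only [map_smul, PiTensorProduct.map_tprod]
      congr 1
      refine (atFactor_tprod (M := D k K ⊗[k] D k K) _ _ _).trans
        (Eq.trans ?_ (atFactor_tprod (M := D k K ⊗[k] D k K) _ _ _).symm)
      have h2 := LinearMap.congr_fun (rTensor_haarEdge hK hℓ h) (α e)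
      rw [LinearMap.comp_apply, LinearMap.comp_apply] at h2
      rw [h2]
    | add a b ha hb => simp only [map_add, ha, hb]
  map_id := by
    rintro _ ⟨a, rfl⟩
    have h1 : ∀ x, haarProj Γ ℓ x = endSplit k K Γ (PiTensorProduct.map (fun _ => haarEdge k ℓ)
        ((endSplit k K Γ).symm x)) := fun _ => rfl
    have h2 : (fun _ : E => haarEdge k ℓ ∘ₗ splitEdge k K) = fun _ => splitEdge k K :=
      funext fun _ => LinearMap.ext (haarEdge_splitEdge hK hℓ)
    rw [h1, gStar_apply, LinearEquiv.symm_apply_apply, ← LinearMap.comp_apply,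
      ← PiTensorProduct.map_comp, h2]

end Projector

end HopfGauge

end

theorem mainTheorem3 {k K V E : Type*} [Field k] [CharZero k] [Ring K] [HopfAlgebra k K]
    [Module.Finite k K] [Finite V] [Finite E]
    (hK : IsRibbon k K)
    (Γ : CiliatedRibbonGraph V E)
    (R : V → K ⊗[k] K) (hR : ∀ v, IsRMatrix k (R v))
    (ρ : E → E ⊕ E) (hρ : IsEndChoice ρ) :
    -- each `A*_v` satisfies its defining relations and is a gauge theory on `Γ_v`
    (∀ v, RibbonRelations Γ R ρ v ∧
      ∃ A : VertexGaugeTheory k K Γ.toDirectedGraph v, A.mul = ribbonMul Γ R ρ v ∧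
        A.dualAct ∘ₗ (incl k ()).toLinearMap = ribbonAct k K Γ v) ∧
    -- the image of the embedding `G*` is a subalgebra
    Function.Injective (gStar k K Γ.toDirectedGraph) ∧
    (PiTensorProduct.tprod k fun v => fnOne k K (Γ.EndsAt v)) ∈
      LinearMap.range (gStar k K Γ.toDirectedGraph) ∧
    (∀ x ∈ LinearMap.range (gStar k K Γ.toDirectedGraph),
      ∀ y ∈ LinearMap.range (gStar k K Γ.toDirectedGraph),
        PiTensorProduct.map₂ (ribbonMul Γ R ρ) x y ∈
          LinearMap.range (gStar k K Γ.toDirectedGraph)) ∧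
    -- and a submodule
    (∀ (h : ⨂[k] _ : V, K), ∀ x ∈ LinearMap.range (gStar k K Γ.toDirectedGraph),
      productAct (ribbonAct k K Γ) h x ∈ LinearMap.range (gStar k K Γ.toDirectedGraph)) ∧
    -- the pulled back structures form a gauge theory on `Γ`, unique with this property
    (∃ T : GraphGaugeTheory k K Γ.toDirectedGraph,
      IsPullback Γ R ρ T ∧
      (∀ T' : GraphGaugeTheory k K Γ.toDirectedGraph, IsPullback Γ R ρ T' → T' = T) ∧
      -- it is local, and its gauge transformations act by the explicit formulas
      IsLocal T ∧
      HasStandardAction Γ T ∧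
      -- for equal `R`-matrices it does not depend on `ρ`
      ((∀ v w, R v = R w) → ∀ ρ' : E → E ⊕ E, IsEndChoice ρ' →
        ∀ T' : GraphGaugeTheory k K Γ.toDirectedGraph, IsPullback Γ R ρ' T' → T' = T)) ∧
    -- the Haar integral defines a projector onto the image of `G*`
    (∀ ℓ : K, IsHaarIntegral k ℓ →
      LinearMap.IsProj (LinearMap.range (gStar k K Γ.toDirectedGraph))
        (haarProj Γ.toDirectedGraph ℓ)) := by
  refine ⟨fun v => ⟨?_, exists_vertexGaugeTheory Γ hR ρ v⟩, gStar_injective, ⟨_, gStar_fnOne⟩,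
    fun x hx y hy => graphMul_mem_range hR (sigma_inr hρ) hx hy,
    fun h x hx => productAct_mem_range h hx,
    ⟨pullTheory Γ hR (sigma_inr hρ), isPullback_pullTheory hR hρ,
      fun T' hT' => (isPullback_pullTheory hR hρ).eq hT', isLocal_pullTheory hR hρ,
      hasStandardAction_pullTheory hR (sigma_inr hρ),
      fun hRR ρ' hρ' T' hT' => (isPullback_pullTheory hR hρ).eq_of_forall_eq hR hRR hρ hρ' hT'⟩,
    fun ℓ hℓ => isProj_haarProj hK hℓ _⟩
  let := Γ.endOrder v
  exact vertexRelations (hR v)
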